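/- Let $(M,\nabla)$ be an affine surface: $M$ is a smooth surface and $\nabla$ is a smooth torsion free connection on $TM$, with Christoffel symbols $\nabla_{\partial_{x^i}}\partial_{x^j}=\Gamma_{ij}{}^k\partial_{x^k}$, Ricci tensor $\rho_\nabla(x,y)=\operatorname{Tr}\{z\mapsto R_\nabla(z,x)y\}$, and symmetrized Ricci tensor $\rho_{s,\nabla}(x,y)=\frac12\{\rho_\nabla(x,y)+\rho_\nabla(y,x)\}$. For smooth $f$ let $\mathcal{H}_\nabla f=(\partial_{x^i}\partial_{x^j}f-\Gamma_{ij}{}^k\partial_{x^k}f)\,dx^i\otimes dx^j$ be the Hessian, and for $\mu\in\mathbb{R}$ let $E(\mu,\nabla)=\{f\in C^\infty(M):\mathcal{H}_\nabla f=\mu f\rho_{s,\nabla}\}$. Let $\hat f\in C^\infty(M)$, let $\Phi$ be an arbitrary smooth symmetric $(0,2)$-tensor field on $M$, and consider the equation $$\mathcal{H}_\nabla\hat f+2\rho_{s,\nabla}-\tfrac12\mu\, d\hat f\otimes d\hat f=0.\qquad(*)$$ (1) If $\mu\neq0$, then $\hat f$ satisfies $(*)$ if and only if $e^{-\frac12\mu\hat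 f}\in E(\mu,\nabla)$. (2) Suppose that $\hat f$ satisfies $(*)$ (with $\mu=0$ allowed). Let $\pi:T^*M\to M$ be the cotangent bundle. For local coordinates $(x^1,x^2)$ on $M$, let $(y_1,y_2)$ be the dual fiber coordinates, $\omega=y_1dx^1+y_2dx^2$. The deformed Riemannian extension $$g_{\nabla,\Phi}=dx^i\otimes dy_i+dy_i\otimes dx^i+\{-2y_k\Gamma_{ij}{}^k+\Phi_{ij}\}\,dx^i\otimes dx^j$$ and the form $dx^1\wedge dx^2\wedge dy_1\wedge dy_2$ do not depend on the local coordinates $(x^1,x^2)$, and define a pseudo-Riemannian metric $g_{\nabla,\Phi}$ and an orientation on $T^*M$. Moreover, with $g=g_{\nabla,\Phi}$, $F=\pi^*\hat f$ and $\mu_{T^*M}=\frac12\mu$: - $(T^*M,g,F,\mu_{T^*M})$ is quasi-Einstein with $\lambda=0$, i.e. $\mathcal{H}_{\nabla^g}F+\rho_g-\mu_{T^*M}\,dF\otimes dF=0$, where $\nabla^g$ is the Levi-Civita connection and $\rho_g$ the Ricci tensor of $g$; - $g$ has signature $(2,2)$; - it is isotropic, i.e. $\|dF\|_g^2=0$;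 - $(T^*M,g)$ is a Walker manifold, i.e. it admits a smooth parallel distribution of totally null $2$-planes; - $(T^*M,g)$ is self-dual for the above orientation, i.e. the anti-self-dual part $W^-$ of its Weyl tensor vanishes. -/

import Mathlib

open scoped Manifold ContDiff Topology

noncomputable section

/-! ### Tensor calculus in coordinates

Here `E` is the coordinate space, `z : E` is the coordinate of a point, and a connection is given by
its Christoffel symbols, i.e. by the map `Γ z u v = ∇_u v` (at `z`, for `u` and `v` regarded as
constant vector fields, so that `Γ z (e_i) (e_j) = Γ_ij^k e_k`). -/

namespace LocalCoord

variable {E : Type*} [NormedAddCommGroup E] [NormedSpace ℝ E]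

/-- `(∂_i ∂_j f - Γ_ij^k ∂_k f) u^i v^j`. -/
def hessian (Γ : E → E → E → E) (f : E → ℝ) (z u v : E) : ℝ :=
  fderiv ℝ (fun z' => fderiv ℝ f z' v) z u - fderiv ℝ f z (Γ z u v)

/-- `R(u, v) w = ∇_u ∇_v w - ∇_v ∇_u w` for constant vector fields `u`, `v`, `w`. -/
def curvature (Γ : E → E → E → E) (z u v w : E) : E :=
  fderiv ℝ (fun z' => Γ z' v w) z u - fderiv ℝ (fun z' => Γ z' u w) z v
    + Γ z u (Γ z v w) - Γ z v (Γ z u w)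

/-- The trace of a linear map of a finite dimensional space (computed in a basis). -/
def trace [FiniteDimensional ℝ E] (L : E → E) : ℝ :=
  ∑ i, (Module.finBasis ℝ E).repr (L (Module.finBasis ℝ E i)) i

/-- The Ricci tensor `ρ(x, y) = Tr {t ↦ R(t, x) y}`. -/
def ricci [FiniteDimensional ℝ E] (Γ : E → E → E → E) (z x y : E) : ℝ :=
  trace (fun t => curvature Γ z t x y)

/-- The Levi-Civita Christoffel symbols of the metric `G`:
`G(∇_u v, w) = 1/2 (∂_u G(v, w) + ∂_v G(u, w) - ∂_w G(u, v))` for constant `u`, `v`, `w`. -/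
def leviCivita (G : E → E →L[ℝ] E →L[ℝ] ℝ) (z u v : E) : E :=
  (G z).inverse ((1 / 2 : ℝ) •
    (fderiv ℝ G z u v + fderiv ℝ G z v u - ((fderiv ℝ G z).flip u).flip v))

/-- The full contraction `G^{ij} T_{ij}` of a bilinear form with the inverse metric. -/
def contraction [FiniteDimensional ℝ E] (G : E →L[ℝ] E →L[ℝ] ℝ) (T : E → E → ℝ) : ℝ :=
  ∑ i, ∑ j, (Matrix.of fun k l => G (Module.finBasis ℝ E k) (Module.finBasis ℝ E l))⁻¹ i j
    * T (Module.finBasis ℝ E i) (Module.finBasis ℝ E j)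

/-- The Weyl tensor of a metric in dimension four, as a `(0,4)`-tensor, with the sign convention
`R(x, y, v, w) = G(R(x, y) v, w)`. -/
def weyl4 [FiniteDimensional ℝ E] (G : E → E →L[ℝ] E →L[ℝ] ℝ) (z x y v w : E) : ℝ :=
  let ρ := ricci (leviCivita G) z
  G z (curvature (leviCivita G) z x y v) w
    - (1 / 2) * (ρ y v * G z x w - ρ x v * G z y w + G z y v * ρ x w - G z x v * ρ y w)
    + contraction (G z) ρ / 6 * (G z y v * G z x w - G z x v * G z y w)

end LocalCoord

/-! ### Charts of a manifold

`N` is a manifold (without boundary) modelled on `I : ModelWithCorners ℝ E H`. -/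

section Charts

variable {E : Type*} [NormedAddCommGroup E] [NormedSpace ℝ E] {H : Type*} [TopologicalSpace H]
  (I : ModelWithCorners ℝ E H) {N : Type*} [TopologicalSpace N] [ChartedSpace H N]

/-- The coordinates in the chart `φ` of a tangent vector at `q`. -/
def chartVec (φ : OpenPartialHomeomorph N H) (q : N) (u : TangentSpace I q) : E :=
  mvfderiv I (φ.extend I) q u

/-- The vector field on the domain of the chart `φ` whose coordinates are constant, equal to `v`. -/
def chartField (φ : OpenPartialHomeomorph N H) (v : E) (q : N) : TangentSpace I q :=
  VectorField.mpullback I 𝓘(ℝ, E) (φ.extend I) (fun _ => v) q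

/-- The expression in the chart `φ` of a `(0,2)`-tensor field `g`. -/
def tensorIn (g : ∀ q : N, TangentSpace I q →L[ℝ] TangentSpace I q →L[ℝ] ℝ)
    (φ : OpenPartialHomeomorph N H) (z : E) : E →L[ℝ] E →L[ℝ] ℝ :=
  let q := (φ.extend I).symm z
  let A : E →L[ℝ] TangentSpace I q := (mfderiv I 𝓘(ℝ, E) (φ.extend I) q).inverse
  (A.precomp ℝ).comp ((g q).comp A)

/-- A smooth `(0,2)`-tensor field. -/
def IsSmoothTensor [IsManifold I 1 N]
    (g : ∀ q : N, TangentSpace I q →L[ℝ] TangentSpace I q →L[ℝ] ℝ) : Prop :=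
  ContMDiff I (I.prod 𝓘(ℝ, E →L[ℝ] E →L[ℝ] ℝ)) ∞
    (fun q => Bundle.TotalSpace.mk' (E →L[ℝ] E →L[ℝ] ℝ)
      (E := fun q : N => TangentSpace I q →L[ℝ] TangentSpace I q →L[ℝ] ℝ) q (g q))

end Charts

/-! ### Affine connections -/

section Affine

variable {E : Type*} [NormedAddCommGroup E] [NormedSpace ℝ E] [FiniteDimensional ℝ E]
  {H : Type*} [TopologicalSpace H] {I : ModelWithCorners ℝ E H}
  {N : Type*} [TopologicalSpace N] [ChartedSpace H N] [IsManifold I 1 N]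

/-- The Christoffel symbols in the chart `φ` of a connection on the tangent bundle:
`(u, v) ↦ Γ_ij^k u^i v^j ∂_k = ∇_u v` for the constant vector fields `u`, `v` of the chart. -/
def christoffel (nabla : CovariantDerivative I E (TangentSpace I : N → Type _))
    (φ : OpenPartialHomeomorph N H) (z u v : E) : E :=
  let q := (φ.extend I).symm z
  chartVec I φ q (nabla (chartField I φ v) q (chartField I φ u q))

/-- The Hessian `ℋ_∇ f` at `q`. -/
def affineHessian (nabla : CovariantDerivative I E (TangentSpace I : N → Type _))
    (f : N → ℝ) (q : N) (u v : TangentSpace I q) : ℝ :=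
  LocalCoord.hessian (christoffel nabla (chartAt H q)) (f ∘ (extChartAt I q).symm)
    (extChartAt I q q) (chartVec I (chartAt H q) q u) (chartVec I (chartAt H q) q v)

/-- The Ricci tensor `ρ_∇` at `q`. -/
def affineRicci (nabla : CovariantDerivative I E (TangentSpace I : N → Type _))
    (q : N) (u v : TangentSpace I q) : ℝ :=
  LocalCoord.ricci (christoffel nabla (chartAt H q))
    (extChartAt I q q) (chartVec I (chartAt H q) q u) (chartVec I (chartAt H q) q v)

/-- The symmetrized Ricci tensor `ρ_{s,∇}` at `q`. -/
def affineRicciSymm (nabla : CovariantDerivative I E (TangentSpace I : N → Type _))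
    (q : N) (u v : TangentSpace I q) : ℝ :=
  (1 / 2) * (affineRicci nabla q u v + affineRicci nabla q v u)

/-- The solution space `E(μ, ∇)` of the affine quasi-Einstein equation `ℋ_∇ f = μ f ρ_{s,∇}`. -/
def quasiEinsteinSpace (μ : ℝ)
    (nabla : CovariantDerivative I E (TangentSpace I : N → Type _)) : Set (N → ℝ) :=
  {f | ContMDiff I 𝓘(ℝ, ℝ) ∞ f ∧ ∀ (q : N) (u v : TangentSpace I q),
    affineHessian nabla f q u v = μ * f q * affineRicciSymm nabla q u v}

/-- The nonlinear equation `ℋ_∇ h + 2 ρ_{s,∇} - (μ/2) dh ⊗ dh = 0` for a smooth function `h`. -/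
def SolvesNonlinearEquation (μ : ℝ)
    (nabla : CovariantDerivative I E (TangentSpace I : N → Type _)) (h : N → ℝ) : Prop :=
  ContMDiff I 𝓘(ℝ, ℝ) ∞ h ∧ ∀ (q : N) (u v : TangentSpace I q),
    affineHessian nabla h q u v + 2 * affineRicciSymm nabla q u v
      - (1 / 2) * μ * (mvfderiv I h q u * mvfderiv I h q v) = 0

end Affine

/-! ### Pseudo-Riemannian manifolds -/

section PseudoRiemannian

variable {E : Type*} [NormedAddCommGroup E] [NormedSpace ℝ E]
  {H : Type*} [TopologicalSpace H] (I : ModelWithCorners ℝ E H)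
  {N : Type*} [TopologicalSpace N] [ChartedSpace H N]
  (g : ∀ q : N, TangentSpace I q →L[ℝ] TangentSpace I q →L[ℝ] ℝ)

/-- `g` is a smooth symmetric nondegenerate `(0,2)`-tensor field. -/
structure IsPseudoRiemannianMetric [IsManifold I 1 N] : Prop where
  smooth : IsSmoothTensor I g
  symm : ∀ (q : N) (u v : TangentSpace I q), g q u v = g q v u
  nondegenerate : ∀ (q : N) (u : TangentSpace I q), (∀ v, g q u v = 0) → u = 0

/-- `e` is a pseudo-orthonormal frame at `q` with `e 0`, `e 1` spacelike and `e 2`, `e 3` timelike. -/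
def IsFrame22 (q : N) (e : Fin 4 → TangentSpace I q) : Prop :=
  ∀ i j, g q (e i) (e j) = if i = j then (![1, 1, -1, -1] : Fin 4 → ℝ) i else 0

/-- `g` has (neutral) signature `(2,2)`. -/
def HasSignature22 : Prop :=
  ∀ q : N, ∃ e : Module.Basis (Fin 4) ℝ (TangentSpace I q), IsFrame22 I g q e

/-- The Levi-Civita covariant derivative `∇_u Y` at `q`. -/
def leviCivitaDeriv (Y : ∀ q : N, TangentSpace I q) (q : N) (u : TangentSpace I q) :
    TangentSpace I q :=
  let φ := chartAt H q
  let z := extChartAt I q q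
  chartField I φ
    (fderiv ℝ (fun z' => chartVec I φ ((φ.extend I).symm z') (Y ((φ.extend I).symm z'))) z
        (chartVec I φ q u)
      + LocalCoord.leviCivita (tensorIn I g φ) z (chartVec I φ q u) (chartVec I φ q (Y q))) q

/-- The Hessian of `F` at `q` with respect to the Levi-Civita connection of `g`. -/
def metricHessian (F : N → ℝ) (q : N) (u v : TangentSpace I q) : ℝ :=
  LocalCoord.hessian (LocalCoord.leviCivita (tensorIn I g (chartAt H q)))
    (F ∘ (extChartAt I q).symm) (extChartAt I q q)
    (chartVec I (chartAt H q) q u) (chartVec I (chartAt H q) q v)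

/-- The Ricci tensor of `g` at `q`. -/
def metricRicci [FiniteDimensional ℝ E] (q : N) (u v : TangentSpace I q) : ℝ :=
  LocalCoord.ricci (LocalCoord.leviCivita (tensorIn I g (chartAt H q)))
    (extChartAt I q q) (chartVec I (chartAt H q) q u) (chartVec I (chartAt H q) q v)

/-- The Weyl tensor of `g` (in dimension four) at `q`. -/
def metricWeyl4 [FiniteDimensional ℝ E] (q : N) (x y v w : TangentSpace I q) : ℝ :=
  LocalCoord.weyl4 (tensorIn I g (chartAt H q)) (extChartAt I q q)
    (chartVec I (chartAt H q) q x) (chartVec I (chartAt H q) q y)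
    (chartVec I (chartAt H q) q v) (chartVec I (chartAt H q) q w)

/-- `(N, g, F, μ)` is quasi-Einstein with constant `lam`: `ℋ F + ρ - μ dF ⊗ dF = lam g`. -/
structure IsQuasiEinstein [FiniteDimensional ℝ E] [IsManifold I 1 N]
    (F : N → ℝ) (μ lam : ℝ) : Prop where
  metric : IsPseudoRiemannianMetric I g
  smooth : ContMDiff I 𝓘(ℝ, ℝ) ∞ F
  equation : ∀ (q : N) (u v : TangentSpace I q),
    metricHessian I g F q u v + metricRicci I g q u v
      - μ * (mvfderiv I F q u * mvfderiv I F q v) = lam * g q u v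

/-- `‖dF‖² = 0`: at every point the gradient of `F` is a null vector. -/
def IsIsotropic (F : N → ℝ) : Prop :=
  ∀ q : N, mvfderiv I F q ((g q).inverse (mvfderiv I F q)) = 0

/-- `Y` is a smooth section over `U` of the plane field `D`. -/
def IsSmoothSectionOn [IsManifold I 1 N] (D : ∀ q : N, Submodule ℝ (TangentSpace I q))
    (Y : ∀ q : N, TangentSpace I q) (U : Set N) : Prop :=
  ContMDiffOn I I.tangent ∞ (fun q => (⟨q, Y q⟩ : TangentBundle I N)) U ∧ ∀ q ∈ U, Y q ∈ D q

/-- A four dimensional pseudo-Riemannian manifold is a Walker manifold if it admits a smooth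
distribution of two dimensional totally null planes which is parallel. -/
def IsWalker4 [IsManifold I 1 N] : Prop :=
  Module.finrank ℝ E = 4 ∧ ∃ D : ∀ q : N, Submodule ℝ (TangentSpace I q),
    (∀ q, Module.finrank ℝ (D q) = 2) ∧
    (∀ (q : N), ∀ v ∈ D q, ∃ U ∈ 𝓝 q, ∃ Y, IsSmoothSectionOn I D Y U ∧ Y q = v) ∧
    (∀ (q : N), ∀ u ∈ D q, ∀ v ∈ D q, g q u v = 0) ∧
    (∀ (q : N), ∀ U ∈ 𝓝 q, ∀ Y, IsSmoothSectionOn I D Y U →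
      ∀ u : TangentSpace I q, leviCivitaDeriv I g Y q u ∈ D q)

/-- A nowhere zero continuous 4-form on a 4-manifold; it determines an orientation. Continuity
is that of the component of the form in each chart of the atlas. -/
def IsOrientationForm (vol : ∀ q : N, TangentSpace I q [⋀^Fin 4]→ₗ[ℝ] ℝ) : Prop :=
  Module.finrank ℝ E = 4 ∧ (∀ q, vol q ≠ 0) ∧
    ∀ (p : N) (b : Fin 4 → E),
      ContinuousOn (fun q => vol q (fun i => chartField I (chartAt H p) (b i) q)) (chartAt H p).source

/-- `g`, of signature `(2,2)`, is self-dual (`W⁻ = 0`) for the orientation given by the 4-form `vol`.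
With respect to a positively oriented pseudo-orthonormal frame, the anti-self-dual bivectors are
spanned by `e₀ ∧ e₁ - e₂ ∧ e₃`, `e₀ ∧ e₂ - e₁ ∧ e₃` and `e₀ ∧ e₃ + e₁ ∧ e₂` (for the Hodge star
operator given by `α ∧ ⋆β = g(α, β) e₀ ∧ e₁ ∧ e₂ ∧ e₃`); the Weyl tensor has to vanish on these. -/
def IsSelfDual [FiniteDimensional ℝ E]
    (vol : ∀ q : N, TangentSpace I q [⋀^Fin 4]→ₗ[ℝ] ℝ) : Prop :=
  ∀ (q : N) (e : Fin 4 → TangentSpace I q), IsFrame22 I g q e → 0 < vol q e →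
    ∀ x y : TangentSpace I q,
      metricWeyl4 I g q x y (e 0) (e 1) - metricWeyl4 I g q x y (e 2) (e 3) = 0 ∧
      metricWeyl4 I g q x y (e 0) (e 2) - metricWeyl4 I g q x y (e 1) (e 3) = 0 ∧
      metricWeyl4 I g q x y (e 0) (e 3) + metricWeyl4 I g q x y (e 1) (e 2) = 0

end PseudoRiemannian

/-! ### The cotangent bundle of a surface and the deformed Riemannian extension -/

/-- The model space of surfaces. -/
abbrev Plane : Type := EuclideanSpace ℝ (Fin 2)

section Cotangent

variable (M : Type*) [TopologicalSpace M] [ChartedSpace Plane M] [IsManifold (𝓡 2) ∞ M]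

/-- The cotangent bundle `T*M`; a point is a pair `⟨x, ω⟩` with `ω` a covector at `x`. -/
abbrev Cotangent : Type _ :=
  Bundle.TotalSpace (Plane →L[ℝ] ℝ) (fun x : M => TangentSpace (𝓡 2) x →L[ℝ] ℝ)

/-- The model with corners of `T*M`. -/
abbrev cotangentModel :
    ModelWithCorners ℝ (Plane × (Plane →L[ℝ] ℝ)) (ModelProd Plane (Plane →L[ℝ] ℝ)) :=
  (𝓡 2).prod 𝓘(ℝ, Plane →L[ℝ] ℝ)

variable {M}

/-- The tangent space of `T*M` at `P`. -/
abbrev CotangentTangent (P : Cotangent M) : Type := TangentSpace cotangentModel P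

/-- The coordinate vector field `∂_{x^i}` of the chart `φ` of `M`. -/
def partialField (φ : OpenPartialHomeomorph M Plane) (i : Fin 2) (x : M) : TangentSpace (𝓡 2) x :=
  chartField (𝓡 2) φ (EuclideanSpace.single i (1 : ℝ)) x

/-- The coordinate function `x^i` on `T*M` induced by the chart `φ` of `M`. -/
def coordX (φ : OpenPartialHomeomorph M Plane) (i : Fin 2) (P : Cotangent M) : ℝ :=
  φ P.proj i

/-- The dual coordinate function `y_i` on `T*M`: if `ω = y_1 dx^1 + y_2 dx^2`, then
`y_i = ω(∂_{x^i})`. -/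
def coordY (φ : OpenPartialHomeomorph M Plane) (i : Fin 2) (P : Cotangent M) : ℝ :=
  P.snd (partialField φ i P.proj)

/-- The 1-form `dx^i` on `T*M`, at `P`. -/
def formX (φ : OpenPartialHomeomorph M Plane) (i : Fin 2) (P : Cotangent M) :
    CotangentTangent P →L[ℝ] ℝ :=
  mvfderiv cotangentModel (coordX φ i) P

/-- The 1-form `dy_i` on `T*M`, at `P`. -/
def formY (φ : OpenPartialHomeomorph M Plane) (i : Fin 2) (P : Cotangent M) :
    CotangentTangent P →L[ℝ] ℝ :=
  mvfderiv cotangentModel (coordY φ i) P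

/-- The deformed Riemannian extension
`dx^i ⊗ dy_i + dy_i ⊗ dx^i + (-2 y_k Γ_ij^k + Φ_ij) dx^i ⊗ dx^j` in the coordinates `(x, y)`
induced by the chart `φ` of `M`, at a point `P` over the domain of `φ`. -/
def riemannianExtensionIn
    (nabla : CovariantDerivative (𝓡 2) Plane (TangentSpace (𝓡 2) : M → Type _))
    (Φ : ∀ x : M, TangentSpace (𝓡 2) x →L[ℝ] TangentSpace (𝓡 2) x →L[ℝ] ℝ)
    (φ : OpenPartialHomeomorph M Plane) (P : Cotangent M) :
    CotangentTangent P →L[ℝ] CotangentTangent P →L[ℝ] ℝ :=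
  (∑ i, ((formX φ i P).smulRight (formY φ i P) + (formY φ i P).smulRight (formX φ i P)))
  + ∑ i, ∑ j,
    (-2 * ∑ k, coordY φ k P *
        christoffel nabla φ (φ P.proj) (EuclideanSpace.single i 1) (EuclideanSpace.single j 1) k
      + Φ P.proj (partialField φ i P.proj) (partialField φ j P.proj))
    • (formX φ i P).smulRight (formX φ j P)

/-- The deformed Riemannian extension `g_{∇,Φ}` on `T*M`. -/
def riemannianExtension
    (nabla : CovariantDerivative (𝓡 2) Plane (TangentSpace (𝓡 2) : M → Type _))
    (Φ : ∀ x : M, TangentSpace (𝓡 2) x →L[ℝ] TangentSpace (𝓡 2) x →L[ℝ] ℝ)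
    (P : Cotangent M) : CotangentTangent P →L[ℝ] CotangentTangent P →L[ℝ] ℝ :=
  riemannianExtensionIn nabla Φ (chartAt Plane P.proj) P

/-- The 4-form `dx^1 ∧ dx^2 ∧ dy_1 ∧ dy_2` in the coordinates induced by the chart `φ`. -/
def cotangentVolumeIn (φ : OpenPartialHomeomorph M Plane) (P : Cotangent M) :
    CotangentTangent P [⋀^Fin 4]→ₗ[ℝ] ℝ :=
  (Matrix.detRowAlternating (R := ℝ) (n := Fin 4)).compLinearMap
    (LinearMap.pi fun a : Fin 4 =>
      ((![formX φ 0 P, formX φ 1 P, formY φ 0 P, formY φ 1 P] a :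
        CotangentTangent P →L[ℝ] ℝ) : CotangentTangent P →ₗ[ℝ] ℝ))

/-- The canonical volume form of `T*M`, which defines its canonical orientation. -/
def cotangentVolume (P : Cotangent M) : CotangentTangent P [⋀^Fin 4]→ₗ[ℝ] ℝ :=
  cotangentVolumeIn (chartAt Plane P.proj) P

end Cotangent

end

/-!
The first part is the substitution `h = exp (-μ f / 2)`: by the chain rule
`ℋ h = h (-μ/2 ℋ f + μ²/4 df ⊗ df)`, so `ℋ h - μ h ρ_s` is `-μ/2 h` times the left hand side of the
nonlinear equation (`exp_mem_quasiEinsteinSpace_iff`).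

For the second part, let `(x, η)` be the coordinates of the cotangent bundle defined by a chart of
the surface. The metric is `LocalCoord.extension Γ Φ`, the form
`(u, α), (v, β) ↦ α v + β u - 2 η (Γ (u, v)) + Φ (u, v)`. Writing `dx^i`, `dy_i` of any other chart
in these coordinates produces second derivatives of the transition map, which cancel against those
in the transformation law of the Christoffel symbols (`riemannianExtensionIn_apply`); this is the
independence of the chart.

The Koszul formula gives the Levi-Civita connection of `extension Γ Φ`. Its horizontal part is `Γ`
(`leviCivita_extension_fst`), whence the vertical planes are parallel and the Hessian of a pulled
back function is the pull-back of its Hessian. The curvature endomorphisms `U ↦ R(U, W) T` are block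
triangular, with diagonal blocks given by the curvature of `Γ`, whence the Ricci tensor is
the pull-back of `2 ρ_s` (`ricci_extension`). Thus the quasi-Einstein equation is the
pull-back of the nonlinear equation. Vertical vectors are null, and the gradient of a pulled back
function is vertical.

Over a surface the curvature of `Γ` is determined by a single endomorphism, and the scalar curvature
of the extension vanishes, its Ricci operator being nilpotent. It follows that the 2-forms
`W(X, Y, ·, ·)` lie in the span of `dx¹ ∧ dx²` and the canonical symplectic form
(`weyl4_extension`). Both are self-dual: for a positively oriented pseudo-orthonormal frame this is
Jacobi's identity for complementary minors of its coordinate matrix (`splitFrame_selfDual`).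
-/

section

-- Instances on iterated spaces of continuous linear maps need a deeper search.
set_option maxSynthPendingDepth 3

/-! ### Pseudo-orthonormal frames of the split form -/

/-- For a positively oriented pseudo-orthonormal frame of `ℝ⁴` with the split form
`2 (p r + q s)`, the inverse of the coordinate matrix is, up to signs and a permutation, its
transpose, so that Jacobi's identity equates complementary minors. -/
theorem splitFrame_minor {p q r s ε : Fin 4 → ℝ} (hε : ∀ i, ε i ^ 2 = 1)
    (h : ∀ i j, p i * r j + q i * s j + r i * p j + s i * q j = if i = j then ε i else 0)
    (hdet : 0 < (Matrix.of ![p, q, r, s]).det) :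
    p 0 * q 1 - q 0 * p 1 = ε 2 * ε 3 * (p 2 * q 3 - q 2 * p 3) ∧
    (p 0 * r 1 - r 0 * p 1) + (q 0 * s 1 - s 0 * q 1)
      = ε 2 * ε 3 * ((p 2 * r 3 - r 2 * p 3) + (q 2 * s 3 - s 2 * q 3)) := by
  set A : Matrix (Fin 4) (Fin 4) ℝ := (Matrix.of ![p, q, r, s]).transpose with hA
  have hd : 0 < A.det := by rw [hA, Matrix.det_transpose]; exact hdet
  have hX : A * Matrix.of ![r, s, p, q] = Matrix.diagonal ε := by
    ext i j
    simp only [Matrix.mul_apply, hA, Matrix.transpose_apply, Fin.sum_univ_four, Matrix.of_apply,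
      Matrix.diagonal_apply, ← h]
    simp
  have hsq : (Matrix.of ![r, s, p, q]).det = A.det := by
    rw [hA, Matrix.det_transpose, Matrix.det_succ_row_zero]
    simp [Fin.sum_univ_succ, Matrix.det_succ_row_zero, Fin.succAbove]
    ring
  have hone : A.det = 1 := by
    have h1 := congrArg Matrix.det hX
    rw [Matrix.det_mul, hsq, Matrix.det_diagonal] at h1
    have h2 : (A.det * A.det) ^ 2 = 1 := by
      rw [h1, ← Finset.prod_pow, Finset.prod_congr rfl fun i _ => hε i, Finset.prod_const_one]
    have h3 : A.det * A.det = 1 := by nlinarith [mul_pos hd hd]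
    nlinarith
  -- `A` maps the column `ε k • (r k, s k, p k, q k)` to the `k`-th basis vector.
  have key : ∀ N N' : Matrix (Fin 4) (Fin 4) ℝ, A * N = N' → N'.det = N.det := fun N N' hN => by
    rw [← hN, Matrix.det_mul, hone, one_mul]
  have e2 : ∀ i, p i * r 2 + q i * s 2 + (r i * p 2 + s i * q 2) = if i = 2 then ε 2 else 0 := by
    intro i; rw [← add_assoc, h]; split_ifs with hi <;> simp [hi]
  have e3 : ∀ i, p i * r 3 + q i * s 3 + (r i * p 3 + s i * q 3) = if i = 3 then ε 3 else 0 := by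
    intro i; rw [← add_assoc, h]; split_ifs with hi <;> simp [hi]
  have main : ∀ c d : Fin 4 → ℝ, ∀ c' d' : Fin 4 → ℝ,
      (∀ i, c' i = p i * c 0 + q i * c 1 + (r i * c 2 + s i * c 3)) →
      (∀ i, d' i = p i * d 0 + q i * d 1 + (r i * d 2 + s i * d 3)) →
      (Matrix.of ![c', d', Pi.single 2 (ε 2), Pi.single 3 (ε 3)]).det
        = (Matrix.of ![c, d, ![r 2, s 2, p 2, q 2], ![r 3, s 3, p 3, q 3]]).det := by
    intro c d c' d' hc hd'
    rw [← Matrix.det_transpose, ← Matrix.det_transpose (Matrix.of ![c, d, _, _])]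
    apply key
    ext i j
    have h2 := e2 i
    have h3 := e3 i
    fin_cases j <;>
      simp [hA, Matrix.mul_apply, Fin.sum_univ_four, hc, hd', Pi.single_apply, ← h2, ← h3] <;> ring
  have k01 := main ![1, 0, 0, 0] ![0, 1, 0, 0] p q (fun i => by simp) (fun i => by simp)
  have k02 := main ![1, 0, 0, 0] ![0, 0, 1, 0] p r (fun i => by simp) (fun i => by simp)
  have k13 := main ![0, 1, 0, 0] ![0, 0, 0, 1] q s (fun i => by simp) (fun i => by simp)
  simp [Matrix.det_succ_row_zero, Fin.sum_univ_succ, Fin.succAbove, Pi.single_apply] at k01 k02 k13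
  have h2 := hε 2
  have h3 := hε 3
  constructor
  · linear_combination ε 2 * ε 3 * k01 - (p 0 * q 1 - q 0 * p 1) * (ε 3 ^ 2 * h2 + h3)
  · linear_combination ε 2 * ε 3 * (k02 + k13)
      - ((p 0 * r 1 - r 0 * p 1) + (q 0 * s 1 - s 0 * q 1)) * (ε 3 ^ 2 * h2 + h3)

/-- Both `p ∧ q` and the symplectic form `p ∧ r + q ∧ s` annihilate the anti-self-dual bivectors
of a positively oriented pseudo-orthonormal frame of the split form. -/
theorem splitFrame_selfDual {p q r s : Fin 4 → ℝ}
    (h : ∀ i j, p i * r j + q i * s j + r i * p j + s i * q j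
      = if i = j then (![1, 1, -1, -1] : Fin 4 → ℝ) i else 0)
    (hdet : 0 < (Matrix.of ![p, q, r, s]).det) (c k : ℝ) (θ : Fin 4 → Fin 4 → ℝ)
    (hθ : ∀ i j, θ i j = c * (p i * q j - q i * p j)
      + k * ((p i * r j - r i * p j) + (q i * s j - s i * q j))) :
    θ 0 1 - θ 2 3 = 0 ∧ θ 0 2 - θ 1 3 = 0 ∧ θ 0 3 + θ 1 2 = 0 := by
  -- An even permutation of the frame reduces each bivector to complementary minors.
  have perm : ∀ σ : Equiv.Perm (Fin 4), Equiv.Perm.sign σ = 1 →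
      θ (σ 0) (σ 1) = (![1, 1, -1, -1] : Fin 4 → ℝ) (σ 2) * (![1, 1, -1, -1] : Fin 4 → ℝ) (σ 3)
        * θ (σ 2) (σ 3) := by
    intro σ hσ
    have hd : 0 < (Matrix.of ![p ∘ σ, q ∘ σ, r ∘ σ, s ∘ σ]).det := by
      have : Matrix.of ![p ∘ σ, q ∘ σ, r ∘ σ, s ∘ σ]
          = (Matrix.of ![p, q, r, s]).submatrix id σ := by
        ext i j; fin_cases i <;> rfl
      rw [this, Matrix.det_permute', hσ]
      simpa using hdet
    have hs : ∀ i : Fin 4, (![1, 1, -1, -1] : Fin 4 → ℝ) i ^ 2 = 1 := by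
      intro i; fin_cases i <;> norm_num
    obtain ⟨h1, h2⟩ := splitFrame_minor (ε := ![1, 1, -1, -1] ∘ σ) (fun i => hs (σ i))
      (fun i j => by simpa using h (σ i) (σ j)) hd
    simp only [Function.comp_apply] at h1 h2
    rw [hθ, hθ]
    linear_combination c * h1 + k * h2
  have a := perm 1 (by simp)
  have b := perm (Equiv.swap 1 2 * Equiv.swap 2 3) (by decide)
  have d := perm (Equiv.swap 2 3 * Equiv.swap 1 2) (by decide)
  have ev1 : (Equiv.swap 1 2 * Equiv.swap 2 3 : Equiv.Perm (Fin 4)) 0 = 0 := by decide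
  have ev2 : (Equiv.swap 1 2 * Equiv.swap 2 3 : Equiv.Perm (Fin 4)) 1 = 2 := by decide
  have ev3 : (Equiv.swap 1 2 * Equiv.swap 2 3 : Equiv.Perm (Fin 4)) 2 = 3 := by decide
  have ev4 : (Equiv.swap 1 2 * Equiv.swap 2 3 : Equiv.Perm (Fin 4)) 3 = 1 := by decide
  have ev5 : (Equiv.swap 2 3 * Equiv.swap 1 2 : Equiv.Perm (Fin 4)) 0 = 0 := by decide
  have ev6 : (Equiv.swap 2 3 * Equiv.swap 1 2 : Equiv.Perm (Fin 4)) 1 = 3 := by decide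
  have ev7 : (Equiv.swap 2 3 * Equiv.swap 1 2 : Equiv.Perm (Fin 4)) 2 = 1 := by decide
  have ev8 : (Equiv.swap 2 3 * Equiv.swap 1 2 : Equiv.Perm (Fin 4)) 3 = 2 := by decide
  rw [ev1, ev2, ev3, ev4] at b
  rw [ev5, ev6, ev7, ev8] at d
  simp at a b d
  have sw := hθ 3 1
  have sw' := hθ 1 3
  exact ⟨by linarith, by linarith, by linarith⟩

/-! ### Curvature of a connection given by bilinear Christoffel symbols -/

namespace LocalCoord

variable {E : Type*} [NormedAddCommGroup E] [NormedSpace ℝ E]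

theorem hasFDerivAt_apply_apply {F F' : Type*} [NormedAddCommGroup F] [NormedSpace ℝ F]
    [NormedAddCommGroup F'] [NormedSpace ℝ F'] {B : E → F →L[ℝ] F →L[ℝ] F'} {z : E}
    (hB : DifferentiableAt ℝ B z) (v w : F) :
    HasFDerivAt (fun z' => B z' v w) (((fderiv ℝ B z).flip v).flip w) z := by
  refine ((hB.hasFDerivAt.clm_apply (hasFDerivAt_const v z)).clm_apply
    (hasFDerivAt_const w z)).congr_fderiv ?_
  ext u
  simp

theorem fderiv_apply_apply {F F' : Type*} [NormedAddCommGroup F] [NormedSpace ℝ F]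
    [NormedAddCommGroup F'] [NormedSpace ℝ F'] {B : E → F →L[ℝ] F →L[ℝ] F'} {z : E}
    (hB : DifferentiableAt ℝ B z) (u : E) (v w : F) :
    fderiv ℝ (fun z' => B z' v w) z u = fderiv ℝ B z u v w := by
  rw [(hasFDerivAt_apply_apply hB v w).fderiv]; rfl

theorem curvature_eq {Γ : E → E → E → E} {L : E → E →L[ℝ] E →L[ℝ] E} {z : E}
    (hΓ : ∀ᶠ z' in 𝓝 z, ∀ u v, Γ z' u v = L z' u v) (hL : DifferentiableAt ℝ L z) (u v w : E) :
    curvature Γ z u v w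
      = fderiv ℝ L z u v w - fderiv ℝ L z v u w + L z u (L z v w) - L z v (L z u w) := by
  have hd : ∀ a b c : E, fderiv ℝ (fun z' => Γ z' a b) z c = fderiv ℝ L z c a b := by
    intro a b c
    have h1 : (fun z' => Γ z' a b) =ᶠ[𝓝 z] fun z' => L z' a b := hΓ.mono fun z' h => h a b
    rw [h1.fderiv_eq]
    exact fderiv_apply_apply hL c a b
  have hz := hΓ.self_of_nhds
  simp only [curvature, hd, hz]

theorem trace_eq [FiniteDimensional ℝ E] (T : E →ₗ[ℝ] E) :
    trace (fun v => T v) = LinearMap.trace ℝ E T := by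
  rw [LinearMap.trace_eq_matrix_trace ℝ (Module.finBasis ℝ E)]
  simp [trace, Matrix.trace, LinearMap.toMatrix_apply]

/-- The contraction of `T` with the inverse metric is the trace of the endomorphism `S` defined by
`G (S u) v = T u v`, so it vanishes if `S` is trace-free. -/
theorem contraction_eq_zero [FiniteDimensional ℝ E] (G : E →L[ℝ] E →L[ℝ] ℝ)
    (hG : ∀ u v, G u v = G v u) (T : E → E → ℝ) (S : E →ₗ[ℝ] E) (hS : ∀ u v, G (S u) v = T u v)
    (h0 : LinearMap.trace ℝ E S = 0) : contraction G T = 0 := by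
  set b := Module.finBasis ℝ E
  set Mx : Matrix _ _ ℝ := Matrix.of fun k l => G (b k) (b l) with hM
  by_cases hu : IsUnit Mx.det
  · have hT : ∀ i j, T (b i) (b j) = ∑ k, b.repr (S (b i)) k * Mx j k := by
      intro i j
      rw [← hS]
      conv_lhs => rw [← b.sum_repr (S (b i))]
      simp [hM, hG (b j), -Module.Basis.sum_repr]
    have hinv : Mx⁻¹ * Mx = 1 := Matrix.nonsing_inv_mul _ hu
    rw [LinearMap.trace_eq_matrix_trace ℝ b] at h0
    rw [← h0]
    change ∑ i, ∑ j, Mx⁻¹ i j * T (b i) (b j) = _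
    simp only [Matrix.trace, Matrix.diag_apply, LinearMap.toMatrix_apply]
    refine Finset.sum_congr rfl fun i _ => ?_
    calc ∑ j, Mx⁻¹ i j * T (b i) (b j)
        = ∑ k, (∑ j, Mx⁻¹ i j * Mx j k) * b.repr (S (b i)) k := by
          simp only [hT, Finset.mul_sum, Finset.sum_mul]
          rw [Finset.sum_comm]
          exact Finset.sum_congr rfl fun k _ => Finset.sum_congr rfl fun j _ => by ring
      _ = b.repr (S (b i)) i := by
          simp only [← Matrix.mul_apply, hinv, Matrix.one_apply, ite_mul, one_mul, zero_mul]
          simp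
  -- If `G` is degenerate, the inverse of its matrix is zero by convention.
  · change ∑ i, ∑ j, Mx⁻¹ i j * T (b i) (b j) = _
    rw [Matrix.nonsing_inv_apply_not_isUnit _ hu]
    simp

/-! ### The Levi-Civita connection of a metric in coordinates -/

/-- The Levi-Civita Christoffel symbols as a continuous bilinear map. -/
noncomputable def leviCivitaL (G : E → E →L[ℝ] E →L[ℝ] ℝ) (z : E) : E →L[ℝ] E →L[ℝ] E :=
  (ContinuousLinearMap.compL ℝ E (E →L[ℝ] ℝ) E (G z).inverse).comp
    ((1 / 2 : ℝ) • (fderiv ℝ G z + (fderiv ℝ G z).flip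
      - (ContinuousLinearMap.flipₗᵢ ℝ E E ℝ).toContinuousLinearEquiv.toContinuousLinearMap.comp
          (fderiv ℝ G z).flip))

theorem leviCivita_eq (G : E → E →L[ℝ] E →L[ℝ] ℝ) (z u v : E) :
    leviCivita G z u v = leviCivitaL G z u v := by
  simp [leviCivita, leviCivitaL]

variable {G : E → E →L[ℝ] E →L[ℝ] ℝ} {O : Set E}

theorem contDiffOn_leviCivitaL [CompleteSpace E] (hO : IsOpen O) (hG : ContDiffOn ℝ ∞ G O)
    (hinv : ∀ z ∈ O, (G z).IsInvertible) : ContDiffOn ℝ ∞ (leviCivitaL G) O := by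
  have hd : ContDiffOn ℝ ∞ (fderiv ℝ G) O := hG.fderiv_of_isOpen hO (by simp)
  have hi : ContDiffOn ℝ ∞ (fun z => (G z).inverse) O := by
    intro z hz
    obtain ⟨e, he⟩ := hinv z hz
    have h1 : ContDiffAt ℝ ∞ ContinuousLinearMap.inverse (G z) := he ▸ contDiffAt_map_inverse e
    exact h1.comp_contDiffWithinAt z (hG z hz)
  have hflip : ContDiffOn ℝ ∞ (fun z => (fderiv ℝ G z).flip) O :=
    (ContinuousLinearMap.flipₗᵢ ℝ E E (E →L[ℝ] ℝ)).contDiff.comp_contDiffOn hd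
  refine ContDiffOn.clm_comp
    ((ContinuousLinearMap.compL ℝ E (E →L[ℝ] ℝ) E).contDiff.comp_contDiffOn hi) ?_
  exact (contDiffOn_const (c := (1 / 2 : ℝ))).smul
    ((hd.add hflip).sub (contDiffOn_const.clm_comp hflip))

/-- The Koszul formula for constant vector fields. -/
theorem apply_leviCivitaL {z : E} (hinv : (G z).IsInvertible) (u v w : E) :
    G z (leviCivitaL G z u v) w
      = 1 / 2 * (fderiv ℝ G z u v w + fderiv ℝ G z v u w - fderiv ℝ G z w u v) := by
  rw [← leviCivita_eq, leviCivita]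
  obtain ⟨e, he⟩ := hinv
  rw [← he, ContinuousLinearMap.inverse_equiv]
  simp

theorem fderiv_symm {z : E} (hG : DifferentiableAt ℝ G z)
    (hs : ∀ᶠ z' in 𝓝 z, ∀ u v, G z' u v = G z' v u) (u v w : E) :
    fderiv ℝ G z u v w = fderiv ℝ G z u w v := by
  rw [← fderiv_apply_apply hG, ← fderiv_apply_apply hG]
  have h1 : (fun z' => G z' v w) =ᶠ[𝓝 z] fun z' => G z' w v := hs.mono fun z' h => h v w
  rw [h1.fderiv_eq]

/-- The Levi-Civita connection is metric. -/
theorem fderiv_eq_leviCivitaL {z : E} (hG : DifferentiableAt ℝ G z)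
    (hs : ∀ᶠ z' in 𝓝 z, ∀ u v, G z' u v = G z' v u) (hinv : (G z).IsInvertible) (u v w : E) :
    fderiv ℝ G z u v w = G z (leviCivitaL G z u v) w + G z v (leviCivitaL G z u w) := by
  rw [hs.self_of_nhds v, apply_leviCivitaL hinv, apply_leviCivitaL hinv, fderiv_symm hG hs u w v,
    fderiv_symm hG hs v u w, fderiv_symm hG hs w u v]
  ring

/-- The curvature of the Levi-Civita connection takes values in skew-symmetric endomorphisms. -/
theorem curvature_skew [CompleteSpace E] (hO : IsOpen O) (hG : ContDiffOn ℝ ∞ G O)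
    (hs : ∀ z ∈ O, ∀ u v, G z u v = G z v u) (hinv : ∀ z ∈ O, (G z).IsInvertible)
    {z : E} (hz : z ∈ O) (u v w t : E) :
    G z (curvature (leviCivita G) z u v w) t = - G z (curvature (leviCivita G) z u v t) w := by
  have hOz : ∀ᶠ z' in 𝓝 z, z' ∈ O := hO.mem_nhds hz
  have hGd : ∀ z' ∈ O, DifferentiableAt ℝ G z' := fun z' h' =>
    ((hG.contDiffAt (hO.mem_nhds h')).differentiableAt (by simp))
  set L := leviCivitaL G with hL
  have hLd : DifferentiableAt ℝ L z :=
    ((contDiffOn_leviCivitaL hO hG hinv).contDiffAt (hO.mem_nhds hz)).differentiableAt (by simp)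
  have hsz : ∀ z' ∈ O, ∀ᶠ z'' in 𝓝 z', ∀ u v, G z'' u v = G z'' v u := fun z' h' =>
    (hO.eventually_mem h').mono hs
  have hmet : ∀ z' ∈ O, ∀ a b c, fderiv ℝ G z' a b c = G z' (L z' a b) c + G z' b (L z' a c) :=
    fun z' h' => fderiv_eq_leviCivitaL (hGd z' h') (hsz z' h') (hinv z' h')
  -- Skew-symmetry is the symmetry of the second derivative of `G w t`, expanded by metricity.
  have hsymm : fderiv ℝ (fderiv ℝ (fun z' => G z' w t)) z u v
      = fderiv ℝ (fderiv ℝ (fun z' => G z' w t)) z v u := by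
    have hc : ContDiffAt ℝ ∞ (fun z' => G z' w t) z :=
      ((hG.contDiffAt (hO.mem_nhds hz)).clm_apply contDiffAt_const).clm_apply contDiffAt_const
    exact (hc.isSymmSndFDerivAt
      (by simpa using WithTop.coe_le_coe.2 (le_top : (2 : ℕ∞) ≤ ⊤))).eq u v
  have hsecond : ∀ a b, fderiv ℝ (fderiv ℝ (fun z' => G z' w t)) z a b
      = fderiv ℝ G z a (L z b w) t + G z (fderiv ℝ L z a b w) t
        + (fderiv ℝ G z a (L z b t) w + G z (fderiv ℝ L z a b t) w) := by
    intro a b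
    have hc : ContDiffAt ℝ ∞ (fun z' => G z' w t) z :=
      ((hG.contDiffAt (hO.mem_nhds hz)).clm_apply contDiffAt_const).clm_apply contDiffAt_const
    have hd2 : DifferentiableAt ℝ (fderiv ℝ (fun z' => G z' w t)) z :=
      (hc.fderiv_right (m := ∞) (by simp)).differentiableAt (by simp)
    have h1 : fderiv ℝ (fderiv ℝ (fun z' => G z' w t)) z a b
        = fderiv ℝ (fun z' => fderiv ℝ (fun z'' => G z'' w t) z' b) z a := by
      rw [fderiv_clm_apply hd2 (differentiableAt_const _)]; simp
    have h2 : (fun z' => fderiv ℝ (fun z'' => G z'' w t) z' b)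
        =ᶠ[𝓝 z] fun z' => G z' (L z' b w) t + G z' (L z' b t) w := by
      filter_upwards [hOz] with z' h'
      rw [fderiv_apply_apply (hGd z' h'), hmet z' h', hs z' h' w]
    have h3 : ∀ c d : E, HasFDerivAt (fun z' => G z' (L z' b c) d)
        (((G z).comp (((fderiv ℝ L z).flip b).flip c)
          + (fderiv ℝ G z).flip (L z b c)).flip d) z := by
      intro c d
      refine (((hGd z hz).hasFDerivAt.clm_apply (hasFDerivAt_apply_apply hLd b c)).clm_apply
        (hasFDerivAt_const d z)).congr_fderiv ?_
      ext u
      simp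
    rw [h1, h2.fderiv_eq, ((h3 w t).fun_add (h3 t w)).fderiv]
    simp
    ring
  rw [hsecond, hsecond] at hsymm
  have hce := fun a b c => curvature_eq (Γ := leviCivita G)
    (Filter.Eventually.of_forall fun z' u v => leviCivita_eq G z' u v) hLd a b c
  rw [hce, hce]
  simp only [hmet z hz] at hsymm
  simp only [map_sub, map_add, sub_apply, add_apply]
  rw [hs z hz (L z v w), hs z hz (L z u w), hs z hz (L z v t), hs z hz (L z u t)] at hsymm
  linarith

end LocalCoord

/-! ### The deformed Riemannian extension in coordinates -/

/-- A nondegenerate bilinear form on a finite dimensional space is an isomorphism to the dual. -/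
theorem isInvertible_of_nondegenerate {F : Type*} [AddCommGroup F] [Module ℝ F]
    [TopologicalSpace F] [IsTopologicalAddGroup F] [ContinuousSMul ℝ F] [T2Space F]
    [FiniteDimensional ℝ F] (B : F →L[ℝ] F →L[ℝ] ℝ) (h : ∀ u, (∀ v, B u v = 0) → u = 0) :
    B.IsInvertible := by
  have hinj : Function.Injective B.toLinearMap := by
    rw [← LinearMap.ker_eq_bot, LinearMap.ker_eq_bot']
    exact fun u hu => h u fun v => congrArg (fun L : F →L[ℝ] ℝ => L v) hu
  have e0 : (F →ₗ[ℝ] ℝ) ≃ₗ[ℝ] (F →L[ℝ] ℝ) := LinearMap.toContinuousLinearMap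
  have : FiniteDimensional ℝ (F →L[ℝ] ℝ) := e0.finiteDimensional
  have hdim : Module.finrank ℝ F = Module.finrank ℝ (F →L[ℝ] ℝ) := by
    rw [← e0.finrank_eq]
    exact (Subspace.dual_finrank_eq (K := ℝ) (V := F)).symm
  let e := LinearMap.linearEquivOfInjective B.toLinearMap hinj hdim
  exact ⟨e.toContinuousLinearEquiv, by ext u v; rfl⟩

namespace LocalCoord

variable {E : Type*} [NormedAddCommGroup E] [NormedSpace ℝ E]

/-- For fixed last two arguments, the curvature is a linear map in the first. -/
noncomputable def curvatureL (L : E → E →L[ℝ] E →L[ℝ] E) (z v w : E) : E →L[ℝ] E :=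
  ((fderiv ℝ L z).flip v).flip w - (fderiv ℝ L z v).flip w + (L z).flip (L z v w)
    - (L z v).comp ((L z).flip w)

theorem curvature_eq_curvatureL {Γ : E → E → E → E} {L : E → E →L[ℝ] E →L[ℝ] E} {z : E}
    (hΓ : ∀ᶠ z' in 𝓝 z, ∀ u v, Γ z' u v = L z' u v) (hL : DifferentiableAt ℝ L z) (u v w : E) :
    curvature Γ z u v w = curvatureL L z v w u := by
  rw [curvature_eq hΓ hL]; simp [curvatureL]

theorem ricci_eq_trace [FiniteDimensional ℝ E] {Γ : E → E → E → E} {L : E → E →L[ℝ] E →L[ℝ] E}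
    {z : E} (hΓ : ∀ᶠ z' in 𝓝 z, ∀ u v, Γ z' u v = L z' u v) (hL : DifferentiableAt ℝ L z)
    (v w : E) : ricci Γ z v w = LinearMap.trace ℝ E (curvatureL L z v w).toLinearMap := by
  rw [ricci, ← trace_eq]
  congr 1
  ext t
  rw [curvature_eq_curvatureL hΓ hL]; rfl

variable {V : Type*} [NormedAddCommGroup V] [NormedSpace ℝ V]

/-- The deformed Riemannian extension of the connection `Γ` by `Φ` in the coordinates `(x, η)` of
the cotangent bundle of `V`: the form
`(u, α), (v, β) ↦ α v + β u - 2 η (Γ_x (u, v)) + Φ_x (u, v)`. -/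
noncomputable def extension (Γ : V → V →L[ℝ] V →L[ℝ] V) (Φ : V → V →L[ℝ] V →L[ℝ] ℝ)
    (z : V × (V →L[ℝ] ℝ)) : V × (V →L[ℝ] ℝ) →L[ℝ] V × (V →L[ℝ] ℝ) →L[ℝ] ℝ :=
  let p : V × (V →L[ℝ] ℝ) →L[ℝ] V := .fst ℝ V (V →L[ℝ] ℝ)
  let P : V × (V →L[ℝ] ℝ) →L[ℝ] V × (V →L[ℝ] ℝ) →L[ℝ] ℝ :=
    (p.precomp ℝ).comp (.snd ℝ V (V →L[ℝ] ℝ))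
  P + P.flip + (p.precomp ℝ).comp
    (((-2 : ℝ) • (ContinuousLinearMap.compL ℝ V V ℝ z.2).comp (Γ z.1) + Φ z.1).comp p)

variable {Γ : V → V →L[ℝ] V →L[ℝ] V} {Φ : V → V →L[ℝ] V →L[ℝ] ℝ} {O : Set V}

theorem extension_apply (z U W : V × (V →L[ℝ] ℝ)) :
    extension Γ Φ z U W
      = U.2 W.1 + W.2 U.1 - 2 * z.2 (Γ z.1 U.1 W.1) + Φ z.1 U.1 W.1 := by
  simp [extension]
  ring

theorem extension_symm {z : V × (V →L[ℝ] ℝ)} (hΓ : ∀ u v, Γ z.1 u v = Γ z.1 v u)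
    (hΦ : ∀ u v, Φ z.1 u v = Φ z.1 v u) (U W : V × (V →L[ℝ] ℝ)) :
    extension Γ Φ z U W = extension Γ Φ z W U := by
  rw [extension_apply, extension_apply, hΓ, hΦ]; ring

theorem contDiffOn_extension (hΓ : ContDiffOn ℝ ∞ Γ O) (hΦ : ContDiffOn ℝ ∞ Φ O) :
    ContDiffOn ℝ ∞ (extension Γ Φ) (Prod.fst ⁻¹' O) := by
  have h1 : ContDiffOn ℝ ∞ (fun z : V × (V →L[ℝ] ℝ) => Γ z.1) (Prod.fst ⁻¹' O) :=
    hΓ.comp contDiff_fst.contDiffOn fun _ h => h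
  have h2 : ContDiffOn ℝ ∞ (fun z : V × (V →L[ℝ] ℝ) => Φ z.1) (Prod.fst ⁻¹' O) :=
    hΦ.comp contDiff_fst.contDiffOn fun _ h => h
  have h3 : ContDiffOn ℝ ∞ (fun z : V × (V →L[ℝ] ℝ) => ContinuousLinearMap.compL ℝ V V ℝ z.2)
      (Prod.fst ⁻¹' O) :=
    ((ContinuousLinearMap.compL ℝ V V ℝ).contDiff.comp contDiff_snd).contDiffOn
  exact contDiffOn_const.add (contDiffOn_const.clm_comp
    ((((contDiffOn_const (c := (-2 : ℝ))).smul (h3.clm_comp h1)).add h2).clm_comp contDiffOn_const))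

theorem eq_zero_of_extension_eq_zero [FiniteDimensional ℝ V] (z U : V × (V →L[ℝ] ℝ))
    (h : ∀ W, extension Γ Φ z U W = 0) : U = 0 := by
  have h1 : U.1 = 0 := by
    refine SeparatingDual.eq_zero_of_forall_dual_eq_zero (R := ℝ) fun τ => ?_
    simpa [extension_apply] using h (0, τ)
  refine Prod.ext h1 ?_
  ext t
  simpa [extension_apply, h1] using h (t, 0)

theorem extension_isInvertible [FiniteDimensional ℝ V] (z : V × (V →L[ℝ] ℝ)) :
    (extension Γ Φ z).IsInvertible :=
  isInvertible_of_nondegenerate _ (eq_zero_of_extension_eq_zero z)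

theorem hasFDerivAt_snd_apply_fst {f : V → V} {f' : V →L[ℝ] V} {z : V × (V →L[ℝ] ℝ)}
    (hf : HasFDerivAt f f' z.1) :
    HasFDerivAt (fun z : V × (V →L[ℝ] ℝ) => z.2 (f z.1))
      (z.2.comp (f'.comp (.fst ℝ V (V →L[ℝ] ℝ)))
        + (ContinuousLinearMap.apply ℝ ℝ (f z.1)).comp (.snd ℝ V (V →L[ℝ] ℝ))) z := by
  refine (hasFDerivAt_snd.clm_apply (hf.comp z hasFDerivAt_fst)).congr_fderiv ?_
  ext <;> simp

theorem fderiv_extension {z : V × (V →L[ℝ] ℝ)} (hΓ : DifferentiableAt ℝ Γ z.1)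
    (hΦ : DifferentiableAt ℝ Φ z.1) (hG : DifferentiableAt ℝ (extension Γ Φ) z)
    (U W T : V × (V →L[ℝ] ℝ)) :
    fderiv ℝ (extension Γ Φ) z U W T
      = -2 * (U.2 (Γ z.1 W.1 T.1) + z.2 (fderiv ℝ Γ z.1 U.1 W.1 T.1))
        + fderiv ℝ Φ z.1 U.1 W.1 T.1 := by
  rw [← fderiv_apply_apply hG]
  simp only [extension_apply]
  have h1 := hasFDerivAt_snd_apply_fst (hasFDerivAt_apply_apply hΓ W.1 T.1)
  have h2 : HasFDerivAt (fun z' : V × (V →L[ℝ] ℝ) => Φ z'.1 W.1 T.1) _ z :=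
    (hasFDerivAt_apply_apply hΦ W.1 T.1).comp z hasFDerivAt_fst
  rw [(((h1.const_mul 2).const_sub (W.2 T.1 + T.2 W.1)).fun_add h2).fderiv]
  simp
  ring

/-- The part of the Christoffel symbols of the extension that does not involve the fibre components
of its arguments. -/
noncomputable def extensionTerm (Γ : V → V →L[ℝ] V →L[ℝ] V) (Φ : V → V →L[ℝ] V →L[ℝ] ℝ)
    (z : V × (V →L[ℝ] ℝ)) (u v t : V) : ℝ :=
  z.2 ((2 : ℝ) • Γ z.1 (Γ z.1 u v) t - fderiv ℝ Γ z.1 u v t - fderiv ℝ Γ z.1 v u t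
      + fderiv ℝ Γ z.1 t u v)
    + ((1 / 2 : ℝ) * (fderiv ℝ Φ z.1 u v t + fderiv ℝ Φ z.1 v u t - fderiv ℝ Φ z.1 t u v)
      - Φ z.1 (Γ z.1 u v) t)

section Calculus

variable [FiniteDimensional ℝ V] (hO : IsOpen O) (hΓ : ContDiffOn ℝ ∞ Γ O)
  (hΦ : ContDiffOn ℝ ∞ Φ O) (hΓs : ∀ x ∈ O, ∀ u v, Γ x u v = Γ x v u)
include hO hΓ hΦ

/-- The horizontal part of the Levi-Civita connection of the extension is the connection `Γ` itself,
on the horizontal parts of the arguments. -/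
theorem leviCivita_extension_fst {z : V × (V →L[ℝ] ℝ)} (hz : z.1 ∈ O) (U W : V × (V →L[ℝ] ℝ)) :
    (leviCivitaL (extension Γ Φ) z U W).1 = Γ z.1 U.1 W.1 := by
  have hΓd : DifferentiableAt ℝ Γ z.1 := (hΓ.contDiffAt (hO.mem_nhds hz)).differentiableAt (by simp)
  have hΦd : DifferentiableAt ℝ Φ z.1 := (hΦ.contDiffAt (hO.mem_nhds hz)).differentiableAt (by simp)
  have hGd : DifferentiableAt ℝ (extension Γ Φ) z := ((contDiffOn_extension hΓ hΦ).contDiffAt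
    ((hO.preimage continuous_fst).mem_nhds hz)).differentiableAt (by simp)
  refine (SeparatingDual.eq_iff_forall_dual_eq (R := ℝ)).2 fun τ => ?_
  have h := apply_leviCivitaL (extension_isInvertible (Γ := Γ) (Φ := Φ) z) U W (0, τ)
  simpa [extension_apply, fderiv_extension hΓd hΦd hGd] using h

theorem leviCivita_extension_snd {z : V × (V →L[ℝ] ℝ)} (hz : z.1 ∈ O) (U W : V × (V →L[ℝ] ℝ))
    (t : V) :
    (leviCivitaL (extension Γ Φ) z U W).2 t
      = -U.2 (Γ z.1 W.1 t) - W.2 (Γ z.1 U.1 t) + extensionTerm Γ Φ z U.1 W.1 t := by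
  have hΓd : DifferentiableAt ℝ Γ z.1 := (hΓ.contDiffAt (hO.mem_nhds hz)).differentiableAt (by simp)
  have hΦd : DifferentiableAt ℝ Φ z.1 := (hΦ.contDiffAt (hO.mem_nhds hz)).differentiableAt (by simp)
  have hGd : DifferentiableAt ℝ (extension Γ Φ) z := ((contDiffOn_extension hΓ hΦ).contDiffAt
    ((hO.preimage continuous_fst).mem_nhds hz)).differentiableAt (by simp)
  have h := apply_leviCivitaL (extension_isInvertible (Γ := Γ) (Φ := Φ) z) U W (t, 0)
  rw [extension_apply, leviCivita_extension_fst hO hΓ hΦ hz] at h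
  simp [fderiv_extension hΓd hΦd hGd] at h
  simp [extensionTerm]
  linarith

theorem differentiableAt_leviCivitaL_extension {z : V × (V →L[ℝ] ℝ)} (hz : z.1 ∈ O) :
    DifferentiableAt ℝ (leviCivitaL (extension Γ Φ)) z :=
  ((contDiffOn_leviCivitaL (hO.preimage continuous_fst) (contDiffOn_extension hΓ hΦ)
    fun z _ => extension_isInvertible z).contDiffAt
      ((hO.preimage continuous_fst).mem_nhds hz)).differentiableAt (by simp)

theorem fderiv_leviCivitaL_extension_fst {z : V × (V →L[ℝ] ℝ)} (hz : z.1 ∈ O)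
    (U W T : V × (V →L[ℝ] ℝ)) :
    (fderiv ℝ (leviCivitaL (extension Γ Φ)) z U W T).1 = fderiv ℝ Γ z.1 U.1 W.1 T.1 := by
  have hΓd : DifferentiableAt ℝ Γ z.1 := (hΓ.contDiffAt (hO.mem_nhds hz)).differentiableAt (by simp)
  have hL := differentiableAt_leviCivitaL_extension hO hΓ hΦ hz
  have h1 : (fun z' => (leviCivitaL (extension Γ Φ) z' W T).1)
      =ᶠ[𝓝 z] fun z' => Γ z'.1 W.1 T.1 := by
    filter_upwards [(hO.preimage continuous_fst).mem_nhds hz] with z' hz'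
    exact leviCivita_extension_fst hO hΓ hΦ hz' W T
  have h2 := (hasFDerivAt_apply_apply hL W T).fst
  have h3 := (hasFDerivAt_apply_apply hΓd W.1 T.1).comp z
    (hasFDerivAt_fst (𝕜 := ℝ) (E := V) (F := V →L[ℝ] ℝ))
  have h4 := h2.unique (h3.congr_of_eventuallyEq h1)
  simpa using congrArg (fun L => L U) h4

omit [FiniteDimensional ℝ V] in
/-- `extensionTerm` is affine in the fibre coordinate; only its derivative in the fibre direction is
made explicit. -/
theorem hasFDerivAt_extensionTerm {z : V × (V →L[ℝ] ℝ)} (hz : z.1 ∈ O) (v w t : V) :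
    ∃ D : V →L[ℝ] ℝ, HasFDerivAt (fun z' => extensionTerm Γ Φ z' v w t)
      (D.comp (.fst ℝ V (V →L[ℝ] ℝ)) + (ContinuousLinearMap.apply ℝ ℝ
        ((2 : ℝ) • Γ z.1 (Γ z.1 v w) t - fderiv ℝ Γ z.1 v w t - fderiv ℝ Γ z.1 w v t
      + fderiv ℝ Γ z.1 t v w)).comp (.snd ℝ V (V →L[ℝ] ℝ))) z := by
  have c1 : ContDiffAt ℝ ∞ Γ z.1 := hΓ.contDiffAt (hO.mem_nhds hz)
  have c2 : ContDiffAt ℝ ∞ Φ z.1 := hΦ.contDiffAt (hO.mem_nhds hz)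
  have d1 : DifferentiableAt ℝ Γ z.1 := c1.differentiableAt (by simp)
  have d2 : DifferentiableAt ℝ Φ z.1 := c2.differentiableAt (by simp)
  have d3 : DifferentiableAt ℝ (fderiv ℝ Γ) z.1 :=
    (c1.fderiv_right (m := ∞) (by simp)).differentiableAt (by simp)
  have d4 : DifferentiableAt ℝ (fderiv ℝ Φ) z.1 :=
    (c2.fderiv_right (m := ∞) (by simp)).differentiableAt (by simp)
  have e1 : DifferentiableAt ℝ (fun x => (2 : ℝ) • Γ x (Γ x v w) t - fderiv ℝ Γ x v w t
      - fderiv ℝ Γ x w v t + fderiv ℝ Γ x t v w) z.1 := by fun_prop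
  have e2 : DifferentiableAt ℝ (fun x => (1 / 2 : ℝ) * (fderiv ℝ Φ x v w t + fderiv ℝ Φ x w v t
      - fderiv ℝ Φ x t v w) - Φ x (Γ x v w) t) z.1 := by fun_prop
  have h1 := hasFDerivAt_snd_apply_fst e1.hasFDerivAt
  have h2 := e2.hasFDerivAt.comp z (hasFDerivAt_fst (𝕜 := ℝ) (E := V) (F := V →L[ℝ] ℝ))
  refine ⟨z.2.comp (fderiv ℝ (fun x => (2 : ℝ) • Γ x (Γ x v w) t - fderiv ℝ Γ x v w t
      - fderiv ℝ Γ x w v t + fderiv ℝ Γ x t v w) z.1) + fderiv ℝ (fun x => (1 / 2 : ℝ) *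
      (fderiv ℝ Φ x v w t + fderiv ℝ Φ x w v t - fderiv ℝ Φ x t v w) - Φ x (Γ x v w) t) z.1,
    (h1.add h2).congr_fderiv ?_⟩
  rw [ContinuousLinearMap.add_comp, add_right_comm]
  rfl

theorem fderiv_leviCivitaL_extension_snd {z : V × (V →L[ℝ] ℝ)} (hz : z.1 ∈ O)
    (U W T : V × (V →L[ℝ] ℝ)) (t : V) :
    (fderiv ℝ (leviCivitaL (extension Γ Φ)) z U W T).2 t
      = -W.2 (fderiv ℝ Γ z.1 U.1 T.1 t) - T.2 (fderiv ℝ Γ z.1 U.1 W.1 t)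
        + U.2 ((2 : ℝ) • Γ z.1 (Γ z.1 W.1 T.1) t - fderiv ℝ Γ z.1 W.1 T.1 t
          - fderiv ℝ Γ z.1 T.1 W.1 t + fderiv ℝ Γ z.1 t W.1 T.1)
        + fderiv ℝ (fun z' => extensionTerm Γ Φ z' W.1 T.1 t) z (U.1, 0) := by
  have hΓd : DifferentiableAt ℝ Γ z.1 := (hΓ.contDiffAt (hO.mem_nhds hz)).differentiableAt (by simp)
  have hL := differentiableAt_leviCivitaL_extension hO hΓ hΦ hz
  have h1 : (fun z' => (leviCivitaL (extension Γ Φ) z' W T).2 t)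
      =ᶠ[𝓝 z] fun z' => -W.2 (Γ z'.1 T.1 t) - T.2 (Γ z'.1 W.1 t)
        + extensionTerm Γ Φ z' W.1 T.1 t := by
    filter_upwards [(hO.preimage continuous_fst).mem_nhds hz] with z' hz'
    exact leviCivita_extension_snd hO hΓ hΦ hz' W T t
  have h2 := (hasFDerivAt_apply_apply hL W T).snd.clm_apply (hasFDerivAt_const t z)
  have h3 : ∀ (β : V →L[ℝ] ℝ) (a b : V), HasFDerivAt (fun z' : V × (V →L[ℝ] ℝ) => β (Γ z'.1 a b))
      (β.comp ((((fderiv ℝ Γ z.1).flip a).flip b).comp (.fst ℝ V (V →L[ℝ] ℝ)))) z :=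
    fun β a b => β.hasFDerivAt.comp z ((hasFDerivAt_apply_apply hΓd a b).comp z hasFDerivAt_fst)
  obtain ⟨D, hD⟩ := hasFDerivAt_extensionTerm hO hΓ hΦ hz W.1 T.1 t
  have h4 := h2.unique
    ((((h3 W.2 T.1 t).fun_neg.fun_sub (h3 T.2 W.1 t)).fun_add hD).congr_of_eventuallyEq h1)
  have h5 := congrArg (fun L => L U) h4
  rw [hD.fderiv]
  simp at h5 ⊢
  linarith

include hΓs

/-- The curvature of the extension: modulo terms that do not involve the fibre components of the
arguments, it is built from the curvature of `Γ` and of its dual connection. -/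
theorem curvature_extension {z : V × (V →L[ℝ] ℝ)} (hz : z.1 ∈ O) (U W T : V × (V →L[ℝ] ℝ)) :
    (curvature (leviCivita (extension Γ Φ)) z U W T).1
      = curvature (fun x u v => Γ x u v) z.1 U.1 W.1 T.1 ∧
    ∀ t, (curvature (leviCivita (extension Γ Φ)) z U W T).2 t
      = U.2 (curvature (fun x u v => Γ x u v) z.1 t T.1 W.1)
        - W.2 (curvature (fun x u v => Γ x u v) z.1 t T.1 U.1)
        - T.2 (curvature (fun x u v => Γ x u v) z.1 U.1 W.1 t)
        + (curvature (leviCivita (extension Γ Φ)) z (U.1, 0) (W.1, 0) (T.1, 0)).2 t := by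
  have hΓd : DifferentiableAt ℝ Γ z.1 := (hΓ.contDiffAt (hO.mem_nhds hz)).differentiableAt (by simp)
  have hL := differentiableAt_leviCivitaL_extension hO hΓ hΦ hz
  have hc := fun A B C => curvature_eq (Γ := leviCivita (extension Γ Φ)) (z := z)
    (Filter.Eventually.of_forall fun z' u v => leviCivita_eq (extension Γ Φ) z' u v) hL A B C
  have hcΓ := fun a b c => curvature_eq (Γ := fun x u v => Γ x u v) (z := z.1)
    (Filter.Eventually.of_forall fun _ _ _ => rfl) hΓd a b c
  have hs := hΓs z.1 hz
  have hds : ∀ a b c, fderiv ℝ Γ z.1 a b c = fderiv ℝ Γ z.1 a c b := by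
    intro a b c
    rw [← fderiv_apply_apply hΓd, ← fderiv_apply_apply hΓd]
    have h1 : (fun x => Γ x b c) =ᶠ[𝓝 z.1] fun x => Γ x c b := by
      filter_upwards [hO.mem_nhds hz] with x hx using hΓs x hx b c
    rw [h1.fderiv_eq]
  constructor
  · simp only [hc, hcΓ, Prod.fst_add, Prod.fst_sub, fderiv_leviCivitaL_extension_fst hO hΓ hΦ hz,
      leviCivita_extension_fst hO hΓ hΦ hz]
  · intro t
    simp only [hc, hcΓ, Prod.snd_add, Prod.snd_sub, add_apply, sub_apply,
      fderiv_leviCivitaL_extension_snd hO hΓ hΦ hz,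
      leviCivita_extension_snd hO hΓ hΦ hz, leviCivita_extension_fst hO hΓ hΦ hz, map_add, map_sub,
      map_smul, smul_eq_mul, zero_apply]
    rw [hds t W.1 T.1, hds t U.1 T.1, hds T.1 t W.1, hds T.1 t U.1, hs t (Γ z.1 T.1 W.1),
      hs T.1 W.1, hs t (Γ z.1 T.1 U.1), hs T.1 U.1, hs t W.1, hs t U.1]
    rw [hs (Γ z.1 W.1 T.1) t, hs (Γ z.1 U.1 T.1) t]
    ring

/-- The Ricci tensor of the extension is the pull-back of twice the symmetrized Ricci tensor. -/
theorem ricci_extension {z : V × (V →L[ℝ] ℝ)} (hz : z.1 ∈ O) (W T : V × (V →L[ℝ] ℝ)) :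
    ricci (leviCivita (extension Γ Φ)) z W T
      = ricci (fun x u v => Γ x u v) z.1 W.1 T.1 + ricci (fun x u v => Γ x u v) z.1 T.1 W.1 := by
  have hΓd : DifferentiableAt ℝ Γ z.1 := (hΓ.contDiffAt (hO.mem_nhds hz)).differentiableAt (by simp)
  have hL := differentiableAt_leviCivitaL_extension hO hΓ hΦ hz
  have hcΓ := fun a b c => curvature_eq_curvatureL (Γ := fun x u v => Γ x u v) (z := z.1)
    (Filter.Eventually.of_forall fun _ _ _ => rfl) hΓd a b c
  have hc := fun A B C => curvature_eq_curvatureL (Γ := leviCivita (extension Γ Φ)) (z := z)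
    (Filter.Eventually.of_forall fun z' u v => leviCivita_eq (extension Γ Φ) z' u v) hL A B C
  have hce := fun A B C => curvature_extension hO hΓ hΦ hΓs hz A B C
  rw [ricci_eq_trace (Filter.Eventually.of_forall fun z' u v =>
      leviCivita_eq (extension Γ Φ) z' u v) hL,
    ricci_eq_trace (L := Γ) (Filter.Eventually.of_forall fun _ _ _ => rfl) hΓd,
    ricci_eq_trace (L := Γ) (Filter.Eventually.of_forall fun _ _ _ => rfl) hΓd]
  set C := curvatureL (leviCivitaL (extension Γ Φ)) z W T with hC
  set A := curvatureL Γ z.1 W.1 T.1 with hA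
  set N := curvatureL Γ z.1 T.1 W.1 with hN
  let e : (V →ₗ[ℝ] ℝ) ≃ₗ[ℝ] (V →L[ℝ] ℝ) := LinearMap.toContinuousLinearMap
  have : FiniteDimensional ℝ (V →L[ℝ] ℝ) := e.finiteDimensional
  -- The vertical block is the transpose of `N`.
  let D : (V →L[ℝ] ℝ) →ₗ[ℝ] (V →L[ℝ] ℝ) := e.conj (Module.Dual.transpose N.toLinearMap)
  have hD : ∀ α t, D α t = α (N t) := fun α t => rfl
  let B : V →ₗ[ℝ] (V →L[ℝ] ℝ) :=
    LinearMap.snd ℝ V (V →L[ℝ] ℝ) ∘ₗ C.toLinearMap ∘ₗ LinearMap.inl ℝ V (V →L[ℝ] ℝ)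
  have hsplit : C.toLinearMap = LinearMap.prodMap A.toLinearMap D
      + (LinearMap.inr ℝ V (V →L[ℝ] ℝ)) ∘ₗ (B ∘ₗ LinearMap.fst ℝ V (V →L[ℝ] ℝ)) := by
    refine LinearMap.ext fun U => ?_
    refine Prod.ext ?_ ?_
    · simpa [hC, hA, ← hc, ← hcΓ] using (hce U W T).1
    · ext t
      have h1 : (C (0, U.2)).2 t = U.2 (N t) := by
        have h2 := (hce (0, U.2) W T).2 t
        simp only [hc, hcΓ, map_zero, ← hC, ← hN] at h2
        have h3 : curvatureL (leviCivitaL (extension Γ Φ)) z (W.1, 0) (T.1, 0)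
            ((0 : V), (0 : V →L[ℝ] ℝ)) = 0 := map_zero _
        have h4 : curvatureL Γ z.1 W.1 t (0 : V) = 0 := map_zero _
        have h5 : curvatureL Γ z.1 T.1 (0 : V) t = 0 := by
          rw [← hcΓ, curvature_eq (L := Γ) (Filter.Eventually.of_forall fun _ _ _ => rfl) hΓd]
          simp
        simpa [h3, h4, h5] using h2
      have h2 : C U = C (0, U.2) + C (U.1, 0) := by rw [← map_add]; simp
      have h3 := congrArg (fun p : V × (V →L[ℝ] ℝ) => p.2 t) h2
      simpa [B, hD, h1] using h3
  rw [hsplit, map_add, LinearMap.trace_prodMap', LinearMap.trace_comp_comm', LinearMap.trace_conj']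
  have h0 : (B ∘ₗ LinearMap.fst ℝ V (V →L[ℝ] ℝ)) ∘ₗ LinearMap.inr ℝ V (V →L[ℝ] ℝ) = 0 := by
    ext; simp
  rw [h0, map_zero, add_zero]
  congr 1
  exact LinearMap.trace_transpose' N.toLinearMap

end Calculus

/-- The Hessian of a function pulled back from the base is the pull-back of its Hessian, since its
differential only sees the horizontal part of the Levi-Civita connection. -/
theorem hessian_extension [FiniteDimensional ℝ V] (hO : IsOpen O) (hΓ : ContDiffOn ℝ ∞ Γ O)
    (hΦ : ContDiffOn ℝ ∞ Φ O) {f : V → ℝ} (hf : ContDiffOn ℝ ∞ f O) {z : V × (V →L[ℝ] ℝ)}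
    (hz : z.1 ∈ O) (U W : V × (V →L[ℝ] ℝ)) :
    hessian (leviCivita (extension Γ Φ)) (fun z => f z.1) z U W
      = hessian (fun x u v => Γ x u v) f z.1 U.1 W.1 := by
  have hd : ∀ z' : V × (V →L[ℝ] ℝ), z'.1 ∈ O → ∀ T : V × (V →L[ℝ] ℝ),
      fderiv ℝ (fun z => f z.1) z' T = fderiv ℝ f z'.1 T.1 := by
    intro z' hz' T
    have h1 : DifferentiableAt ℝ f z'.1 :=
      (hf.contDiffAt (hO.mem_nhds hz')).differentiableAt (by simp)
    have h2 : HasFDerivAt (fun z : V × (V →L[ℝ] ℝ) => f z.1) _ z' :=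
      h1.hasFDerivAt.comp z' hasFDerivAt_fst
    rw [h2.fderiv]; rfl
  have h2 : (fun z' => fderiv ℝ (fun z : V × (V →L[ℝ] ℝ) => f z.1) z' W)
      =ᶠ[𝓝 z] fun z' => fderiv ℝ f z'.1 W.1 := by
    filter_upwards [(hO.preimage continuous_fst).mem_nhds hz] with z' hz' using hd z' hz' W
  have h3 : DifferentiableAt ℝ (fun x => fderiv ℝ f x W.1) z.1 :=
    (((hf.contDiffAt (hO.mem_nhds hz)).fderiv_right (m := ∞) (by simp)).differentiableAt
      (by simp)).clm_apply (differentiableAt_const _)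
  have h4 : HasFDerivAt (fun z' : V × (V →L[ℝ] ℝ) => fderiv ℝ f z'.1 W.1) _ z :=
    h3.hasFDerivAt.comp z hasFDerivAt_fst
  rw [hessian, h2.fderiv_eq, h4.fderiv, hd z hz, leviCivita_eq,
    leviCivita_extension_fst hO hΓ hΦ hz, hessian]
  rfl

end LocalCoord

/-! ### The extension of a connection on the plane and its Weyl tensor -/

namespace LocalCoord

theorem plane_eq (u : Plane) :
    u = u 0 • EuclideanSpace.single 0 (1 : ℝ) + u 1 • EuclideanSpace.single 1 (1 : ℝ) := by
  ext i; fin_cases i <;> simp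

theorem dual_plane_apply {F : Type*} [AddCommGroup F] [Module ℝ F] [TopologicalSpace F]
    (τ : Plane →L[ℝ] F) (u : Plane) :
    τ u = u 0 • τ (EuclideanSpace.single 0 1) + u 1 • τ (EuclideanSpace.single 1 1) := by
  conv_lhs => rw [plane_eq u]
  simp

/-- A skew-symmetric form on the plane is a multiple of the determinant. -/
theorem skew_plane (f : Plane → Plane → ℝ) (L : Plane → Plane →L[ℝ] ℝ)
    (hL : ∀ u v, f u v = L u v) (hs : ∀ u v, f u v = - f v u) (u v : Plane) :
    f u v = f (EuclideanSpace.single 0 1) (EuclideanSpace.single 1 1)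
      * (u 0 * v 1 - u 1 * v 0) := by
  have h : ∀ i : Fin 2, f u (EuclideanSpace.single i 1) = -(u 0 *
      f (EuclideanSpace.single i 1) (EuclideanSpace.single 0 1)
      + u 1 * f (EuclideanSpace.single i 1) (EuclideanSpace.single 1 1)) := by
    intro i
    rw [hs, hL, dual_plane_apply, ← hL, ← hL]; simp
  have h0 := hs (EuclideanSpace.single 0 1) (EuclideanSpace.single 0 1)
  have h1 := hs (EuclideanSpace.single 1 1) (EuclideanSpace.single 1 1)
  have h2 := hs (EuclideanSpace.single 1 1) (EuclideanSpace.single 0 1)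
  rw [hL u v, dual_plane_apply, ← hL, ← hL, h, h, h2]
  simp only [smul_eq_mul]
  linear_combination (-(v 0 * u 0) / 2) * h0 - (v 1 * u 1) / 2 * h1

/-- In dimension two the curvature is determined by one endomorphism, and so is the Ricci tensor. -/
theorem exists_curvature_plane {Γ : Plane → Plane →L[ℝ] Plane →L[ℝ] Plane} {x : Plane}
    (hΓ : DifferentiableAt ℝ Γ x) : ∃ N : Plane →L[ℝ] Plane,
      (∀ u v w, curvature (fun x u v => Γ x u v) x u v w = (u 0 * v 1 - u 1 * v 0) • N w) ∧
      ∀ v w, ricci (fun x u v => Γ x u v) x v w = v 1 * N w 0 - v 0 * N w 1 := by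
  set e : Fin 2 → Plane := fun i => EuclideanSpace.single i 1 with he
  have hc := fun a b c => curvature_eq (Γ := fun x u v => Γ x u v) (z := x)
    (Filter.Eventually.of_forall fun _ _ _ => rfl) hΓ a b c
  set N : Plane →L[ℝ] Plane := fderiv ℝ Γ x (e 0) (e 1) - fderiv ℝ Γ x (e 1) (e 0)
    + (Γ x (e 0)).comp (Γ x (e 1)) - (Γ x (e 1)).comp (Γ x (e 0)) with hN
  have h1 : ∀ u v w, curvature (fun x u v => Γ x u v) x u v w
      = (u 0 * v 1 - u 1 * v 0) • N w := by
    intro u v w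
    rw [hc, dual_plane_apply (fderiv ℝ Γ x) u, dual_plane_apply (fderiv ℝ Γ x) v,
      dual_plane_apply (Γ x) u, dual_plane_apply (Γ x) v]
    simp only [add_apply, smul_apply, map_add, map_smul]
    rw [dual_plane_apply (fderiv ℝ Γ x (e 0)) v, dual_plane_apply (fderiv ℝ Γ x (e 1)) v,
      dual_plane_apply (fderiv ℝ Γ x (e 0)) u, dual_plane_apply (fderiv ℝ Γ x (e 1)) u]
    simp only [add_apply, smul_apply, hN, sub_apply,
      ContinuousLinearMap.comp_apply, he]
    module
  refine ⟨N, h1, fun v w => ?_⟩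
  rw [ricci_eq_trace (L := Γ) (Filter.Eventually.of_forall fun _ _ _ => rfl) hΓ,
    LinearMap.trace_eq_matrix_trace ℝ (EuclideanSpace.basisFun (Fin 2) ℝ).toBasis]
  have h2 : ∀ t, curvatureL Γ x v w t = (t 0 * v 1 - t 1 * v 0) • N w := fun t => by
    rw [← h1, curvature_eq_curvatureL (L := Γ) (Filter.Eventually.of_forall fun _ _ _ => rfl) hΓ]
  simp [Matrix.trace, LinearMap.toMatrix_apply, h2]
  ring

variable {Γ : Plane → Plane →L[ℝ] Plane →L[ℝ] Plane} {Φ : Plane → Plane →L[ℝ] Plane →L[ℝ] ℝ}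
  {O : Set Plane} (hO : IsOpen O) (hΓ : ContDiffOn ℝ ∞ Γ O) (hΦ : ContDiffOn ℝ ∞ Φ O)
  (hΓs : ∀ x ∈ O, ∀ u v, Γ x u v = Γ x v u) (hΦs : ∀ x ∈ O, ∀ u v, Φ x u v = Φ x v u)
include hO hΓ hΦ hΓs hΦs

/-- The scalar curvature of the extension vanishes: its Ricci operator is nilpotent. -/
theorem contraction_ricci_extension {z : Plane × (Plane →L[ℝ] ℝ)} (hz : z.1 ∈ O) :
    contraction (extension Γ Φ z) (ricci (leviCivita (extension Γ Φ)) z) = 0 := by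
  obtain ⟨N, -, hN⟩ := exists_curvature_plane
    ((hΓ.contDiffAt (hO.mem_nhds hz)).differentiableAt (by simp))
  let q : Fin 2 → Plane →L[ℝ] ℝ := fun i => EuclideanSpace.proj i
  let ρ : Plane →L[ℝ] Plane →L[ℝ] ℝ :=
    (q 1).smulRight ((q 0).comp N) - (q 0).smulRight ((q 1).comp N)
  have hρ : ∀ v w, ρ v w = ricci (fun x u v => Γ x u v) z.1 v w := fun v w => by
    rw [hN]; simp [ρ, q]
  let S : Plane × (Plane →L[ℝ] ℝ) →ₗ[ℝ] Plane × (Plane →L[ℝ] ℝ) :=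
    LinearMap.inr ℝ _ _ ∘ₗ (ρ + ρ.flip).toLinearMap ∘ₗ LinearMap.fst ℝ _ _
  refine contraction_eq_zero _ (extension_symm (hΓs _ hz) (hΦs _ hz)) _ S (fun U W => ?_) ?_
  · rw [ricci_extension hO hΓ hΦ hΓs hz, extension_apply, ← hρ, ← hρ]
    simp [S]
  · refine IsNilpotent.eq_zero (LinearMap.isNilpotent_trace_of_isNilpotent ⟨2, ?_⟩)
    refine LinearMap.ext fun U => ?_
    simp [S, pow_two]

/-- The Weyl tensor of the extension takes values in the span of `dx¹ ∧ dx²` and the symplectic form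
of the cotangent bundle. -/
theorem weyl4_extension {z : Plane × (Plane →L[ℝ] ℝ)} (hz : z.1 ∈ O)
    (X Y : Plane × (Plane →L[ℝ] ℝ)) : ∃ c k : ℝ, ∀ W T,
      weyl4 (extension Γ Φ) z X Y W T
        = c * (W.1 0 * T.1 1 - W.1 1 * T.1 0) + k * (T.2 W.1 - W.2 T.1) := by
  obtain ⟨N, hNc, hNr⟩ := exists_curvature_plane
    ((hΓ.contDiffAt (hO.mem_nhds hz)).differentiableAt (by simp))
  have hOE : IsOpen (Prod.fst ⁻¹' O : Set (Plane × (Plane →L[ℝ] ℝ))) := hO.preimage continuous_fst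
  have hsym := extension_symm (z := z) (hΓs _ hz) (hΦs _ hz)
  have hskew := fun A B => curvature_skew hOE (contDiffOn_extension hΓ hΦ)
    (fun z hz => extension_symm (z := z) (hΓs _ hz) (hΦs _ hz))
    (fun z _ => extension_isInvertible z) (z := z) hz X Y A B
  have hric := fun A B => ricci_extension hO hΓ hΦ hΓs hz A B
  -- The scalar curvature term drops out.
  have hw : ∀ W T, weyl4 (extension Γ Φ) z X Y W T
      = extension Γ Φ z (curvature (leviCivita (extension Γ Φ)) z X Y W) T
      - (1 / 2) * (ricci (leviCivita (extension Γ Φ)) z Y W * extension Γ Φ z X T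
        - ricci (leviCivita (extension Γ Φ)) z X W * extension Γ Φ z Y T
        + extension Γ Φ z Y W * ricci (leviCivita (extension Γ Φ)) z X T
        - extension Γ Φ z X W * ricci (leviCivita (extension Γ Φ)) z Y T) := by
    intro W T
    simp only [weyl4]
    rw [contraction_ricci_extension hO hΓ hΦ hΓs hΦs hz]
    ring
  have hwskew : ∀ W T, weyl4 (extension Γ Φ) z X Y W T = - weyl4 (extension Γ Φ) z X Y T W := by
    intro W T
    rw [hw, hw, hskew]
    ring
  let q : Fin 2 → Plane →L[ℝ] ℝ := fun i => EuclideanSpace.proj i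
  let ρ : Plane →L[ℝ] Plane →L[ℝ] ℝ :=
    (q 1).smulRight ((q 0).comp N) - (q 0).smulRight ((q 1).comp N)
  have hρ : ∀ v w, ρ v w = ricci (fun x u v => Γ x u v) z.1 v w := fun v w => by
    rw [hNr]; simp [ρ, q]
  let j : Plane →L[ℝ] Plane × (Plane →L[ℝ] ℝ) := .inl ℝ Plane (Plane →L[ℝ] ℝ)
  -- On horizontal vectors the Weyl tensor is a skew form on the plane, a multiple of `dx¹ ∧ dx²`.
  have hbase := skew_plane (fun v t => weyl4 (extension Γ Φ) z X Y (v, 0) (t, 0))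
    (fun v => (extension Γ Φ z (curvature (leviCivita (extension Γ Φ)) z X Y (v, 0))).comp j
      - (1 / 2 : ℝ) • (ricci (leviCivita (extension Γ Φ)) z Y (v, 0) • (extension Γ Φ z X).comp j
        - ricci (leviCivita (extension Γ Φ)) z X (v, 0) • (extension Γ Φ z Y).comp j
        + extension Γ Φ z Y (v, 0) • (ρ + ρ.flip) X.1
        - extension Γ Φ z X (v, 0) • (ρ + ρ.flip) Y.1))
    (fun v t => by simp [hw, j, hρ, hric]; ring) (fun v t => hwskew _ _)
  refine ⟨weyl4 (extension Γ Φ) z X Y (EuclideanSpace.single 0 1, 0)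
    (EuclideanSpace.single 1 1, 0), (X.1 0 * Y.1 1 - X.1 1 * Y.1 0)
    * (N (EuclideanSpace.single 0 1) 0 + N (EuclideanSpace.single 1 1) 1) / 2, fun W T => ?_⟩
  have hb := hbase W.1 T.1
  simp only at hb
  rw [← hb]
  obtain ⟨c1, c2⟩ := curvature_extension hO hΓ hΦ hΓs hz X Y W
  obtain ⟨d1, d2⟩ := curvature_extension hO hΓ hΦ hΓs hz X Y (W.1, 0)
  rw [hw, hw, extension_apply z (curvature _ z X Y W),
    extension_apply z (curvature _ z X Y (W.1, 0)),
    c1, c2, d1, d2]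
  simp only [hric, hNr, hNc, extension_apply]
  rw [dual_plane_apply N W.1, dual_plane_apply N T.1, dual_plane_apply N X.1,
    dual_plane_apply N Y.1]
  simp only [PiLp.add_apply, PiLp.smul_apply, smul_eq_mul, map_smul, map_add, zero_apply]
  rw [dual_plane_apply T.2 (N _), dual_plane_apply T.2 (N _), dual_plane_apply T.2 X.1,
    dual_plane_apply T.2 Y.1, dual_plane_apply T.2 W.1, dual_plane_apply W.2 (N _),
    dual_plane_apply W.2 (N _), dual_plane_apply W.2 X.1, dual_plane_apply W.2 Y.1,
    dual_plane_apply W.2 T.1]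
  simp only [smul_eq_mul]
  ring

/-- The Weyl tensor of the extension vanishes on the anti-self-dual bivectors of every
pseudo-orthonormal frame with positive `dx¹ ∧ dx² ∧ dy₁ ∧ dy₂`. -/
theorem weyl4_extension_selfDual {z : Plane × (Plane →L[ℝ] ℝ)} (hz : z.1 ∈ O)
    (e : Fin 4 → Plane × (Plane →L[ℝ] ℝ))
    (he : ∀ i j, extension Γ Φ z (e i) (e j)
      = if i = j then (![1, 1, -1, -1] : Fin 4 → ℝ) i else 0)
    (hdet : 0 < (Matrix.of fun i : Fin 4 => ![(e i).1 0, (e i).1 1,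
      (e i).2 (EuclideanSpace.single 0 1), (e i).2 (EuclideanSpace.single 1 1)]).det)
    (X Y : Plane × (Plane →L[ℝ] ℝ)) :
    weyl4 (extension Γ Φ) z X Y (e 0) (e 1) - weyl4 (extension Γ Φ) z X Y (e 2) (e 3) = 0 ∧
    weyl4 (extension Γ Φ) z X Y (e 0) (e 2) - weyl4 (extension Γ Φ) z X Y (e 1) (e 3) = 0 ∧
    weyl4 (extension Γ Φ) z X Y (e 0) (e 3) + weyl4 (extension Γ Φ) z X Y (e 1) (e 2) = 0 := by
  obtain ⟨c, k, hck⟩ := weyl4_extension hO hΓ hΦ hΓs hΦs hz X Y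
  -- Half of the horizontal part of the metric is absorbed into the fibre coordinates.
  let B : Plane →L[ℝ] Plane →L[ℝ] ℝ :=
    (1 / 2 : ℝ) • ((-2 : ℝ) • (ContinuousLinearMap.compL ℝ Plane Plane ℝ z.2).comp (Γ z.1) + Φ z.1)
  have hB : ∀ u v, B u v = 1 / 2 * (-2 * z.2 (Γ z.1 u v) + Φ z.1 u v) := fun u v => by
    simp [B]; ring
  have hBs : ∀ u v, B u v = B v u := fun u v => by
    rw [hB, hB, hΓs _ hz, hΦs _ hz]
  set ε : Fin 2 → Plane := fun i => EuclideanSpace.single i 1 with hε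
  have hexp : ∀ i j, (e i).2 (e j).1 + B (e i).1 (e j).1
      = ((e i).2 (ε 0) + B (e i).1 (ε 0)) * (e j).1 0
        + ((e i).2 (ε 1) + B (e i).1 (ε 1)) * (e j).1 1 := by
    intro i j
    rw [dual_plane_apply (e i).2, dual_plane_apply (B (e i).1)]
    simp only [smul_eq_mul, hε]
    ring
  refine splitFrame_selfDual (p := fun i => (e i).1 0) (q := fun i => (e i).1 1)
    (r := fun i => (e i).2 (ε 0) + B (e i).1 (ε 0)) (s := fun i => (e i).2 (ε 1) + B (e i).1 (ε 1))
    (fun i j => ?_) ?_ c k (fun i j => weyl4 (extension Γ Φ) z X Y (e i) (e j)) (fun i j => ?_)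
  · rw [← he, extension_apply]
    have h1 := hexp i j
    have h2 := hexp j i
    have h3 := hB (e i).1 (e j).1
    have h4 := hBs (e i).1 (e j).1
    linarith
  · refine lt_of_lt_of_eq hdet ?_
    rw [← Matrix.det_transpose]
    have hb : ∀ i a, B (e i).1 (ε a) = (e i).1 0 * B (ε 0) (ε a) + (e i).1 1 * B (ε 1) (ε a) := by
      intro i a
      rw [hBs, dual_plane_apply (B (ε a)), hBs _ (ε a), hBs _ (ε a)]
      simp [hε]
    simp only [hb]
    rw [Matrix.det_succ_row_zero, Matrix.det_succ_row_zero]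
    simp [Fin.sum_univ_succ, Matrix.det_succ_row_zero, Fin.succAbove]
    ring
  · simp only
    rw [hck]
    have h1 := hexp i j
    have h2 := hexp j i
    have h4 := hBs (e i).1 (e j).1
    linear_combination k * (h2 - h1 + h4)

end LocalCoord

/-! ### Calculus in the charts of a manifold -/

section ChartCalculus

variable {E : Type*} [NormedAddCommGroup E] [NormedSpace ℝ E] {H : Type*} [TopologicalSpace H]
  {I : ModelWithCorners ℝ E H} {N : Type*} [TopologicalSpace N] {φ : OpenPartialHomeomorph N H}

theorem extend_mem_target {q : N} (hq : q ∈ φ.source) : φ.extend I q ∈ (φ.extend I).target :=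
  (φ.extend I).map_source (by rwa [φ.extend_source])

theorem extend_symm_mem_source {z : E} (hz : z ∈ (φ.extend I).target) :
    (φ.extend I).symm z ∈ φ.source := by
  simpa only [φ.extend_source] using (φ.extend I).map_target hz

section

variable [ChartedSpace H N]

theorem chartVec_eq (q : N) (u : TangentSpace I q) :
    chartVec I φ q u = mvfderiv I (φ.extend I) q u := rfl

theorem chartField_eq (v : E) (q : N) :
    chartField I φ v q = (mvfderiv I (φ.extend I) q).inverse v := rfl

theorem tensorIn_apply (g : ∀ q : N, TangentSpace I q →L[ℝ] TangentSpace I q →L[ℝ] ℝ)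
    (φ : OpenPartialHomeomorph N H) (z v w : E) :
    tensorIn I g φ z v w = g ((φ.extend I).symm z) (chartField I φ v ((φ.extend I).symm z))
      (chartField I φ w ((φ.extend I).symm z)) := rfl

theorem tensorIn_extend_apply (g : ∀ q : N, TangentSpace I q →L[ℝ] TangentSpace I q →L[ℝ] ℝ)
    {q : N} (hq : q ∈ φ.source) (v w : E) :
    tensorIn I g φ (φ.extend I q) v w = g q (chartField I φ v q) (chartField I φ w q) := by
  rw [tensorIn_apply, φ.extend_left_inv hq]

end

variable [I.Boundaryless]

theorem extend_target_mem_nhds {z : E} (hz : z ∈ (φ.extend I).target) :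
    (φ.extend I).target ∈ 𝓝 z :=
  φ.isOpen_extend_target.mem_nhds hz

variable [ChartedSpace H N]

theorem contMDiffAt_extend_symm (hφ : φ ∈ IsManifold.maximalAtlas I ∞ N) {z : E}
    (hz : z ∈ (φ.extend I).target) : ContMDiffAt 𝓘(ℝ, E) I ∞ (φ.extend I).symm z := by
  have h := contMDiffOn_extend_symm hφ
  rw [← φ.extend_target'] at h
  exact h.contMDiffAt (extend_target_mem_nhds hz)

theorem isInvertible_mvfderiv_extend (hφ : φ ∈ IsManifold.maximalAtlas I ∞ N) {q : N}
    (hq : q ∈ φ.source) : (mvfderiv I (φ.extend I) q).IsInvertible := by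
  have hz := extend_mem_target (I := I) hq
  have h1 : MDifferentiableAt I 𝓘(ℝ, E) (φ.extend I) q :=
    (OpenPartialHomeomorph.contMDiffAt_extend hφ hq).mdifferentiableAt (by simp)
  have h2 : MDifferentiableAt 𝓘(ℝ, E) I (φ.extend I).symm (φ.extend I q) :=
    (contMDiffAt_extend_symm hφ hz).mdifferentiableAt (by simp)
  have hl := φ.extend_left_inv (I := I) hq
  refine ContinuousLinearMap.IsInvertible.of_inverse
    (g := mfderiv 𝓘(ℝ, E) I (φ.extend I).symm (φ.extend I q)) ?_ ?_
  · have h4 : φ.extend I ∘ (φ.extend I).symm =ᶠ[𝓝 (φ.extend I q)] id := by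
      filter_upwards [extend_target_mem_nhds hz] with z hz using (φ.extend I).right_inv hz
    have h5 := h4.mfderiv_eq (I := 𝓘(ℝ, E)) (I' := 𝓘(ℝ, E))
    rw [mfderiv_comp_of_eq h1 h2 hl, mfderiv_id] at h5
    have h6 : ∀ p, p = q → (mfderiv I 𝓘(ℝ, E) (φ.extend I) p : E →L[ℝ] E)
        = (mfderiv I 𝓘(ℝ, E) (φ.extend I) q : E →L[ℝ] E) := by rintro _ rfl; rfl
    exact (congrArg (fun A : E →L[ℝ] E => A.comp
      (mfderiv 𝓘(ℝ, E) I (φ.extend I).symm (φ.extend I q) : E →L[ℝ] E)) (h6 _ hl)).symm.trans h5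
  · have h4 : (φ.extend I).symm ∘ φ.extend I =ᶠ[𝓝 q] id := by
      filter_upwards [φ.open_source.mem_nhds hq] with q' hq' using φ.extend_left_inv hq'
    have h5 := h4.mfderiv_eq (I := I) (I' := I)
    rw [mfderiv_comp q h2 h1, mfderiv_id] at h5
    exact h5

/-- The derivative of a function is computed in a chart. -/
theorem mvfderiv_eq_fderiv (hφ : φ ∈ IsManifold.maximalAtlas I ∞ N) {q : N} (hq : q ∈ φ.source)
    {F : Type*} [NormedAddCommGroup F] [NormedSpace ℝ F] {f : N → F}
    (hf : MDifferentiableAt I 𝓘(ℝ, F) f q) (u : TangentSpace I q) :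
    mvfderiv I f q u = fderiv ℝ (f ∘ (φ.extend I).symm) (φ.extend I q) (chartVec I φ q u) := by
  have hz := extend_mem_target (I := I) hq
  have h1 : MDifferentiableAt I 𝓘(ℝ, E) (φ.extend I) q :=
    (OpenPartialHomeomorph.contMDiffAt_extend hφ hq).mdifferentiableAt (by simp)
  have h2 : MDifferentiableAt 𝓘(ℝ, E) I (φ.extend I).symm (φ.extend I q) :=
    (contMDiffAt_extend_symm hφ hz).mdifferentiableAt (by simp)
  have hl := φ.extend_left_inv (I := I) hq
  have h3 : MDifferentiableAt 𝓘(ℝ, E) 𝓘(ℝ, F) (f ∘ (φ.extend I).symm) (φ.extend I q) := by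
    refine MDifferentiableAt.comp _ ?_ h2
    rwa [hl]
  have h4 : f =ᶠ[𝓝 q] (f ∘ (φ.extend I).symm) ∘ φ.extend I := by
    filter_upwards [φ.open_source.mem_nhds hq] with q' hq'
    simp only [Function.comp_apply, φ.extend_left_inv hq']
  have h5 : mfderiv I 𝓘(ℝ, F) f q
      = (mfderiv 𝓘(ℝ, E) 𝓘(ℝ, F) (f ∘ (φ.extend I).symm) (φ.extend I q)).comp
        (mfderiv I 𝓘(ℝ, E) (φ.extend I) q) := by
    rw [h4.mfderiv_eq]
    exact mfderiv_comp q h3 h1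
  rw [mfderiv_eq_fderiv] at h5
  exact congrArg (fun L => L u) h5

theorem chartVec_chartField (hφ : φ ∈ IsManifold.maximalAtlas I ∞ N) {q : N} (hq : q ∈ φ.source)
    (v : E) : chartVec I φ q (chartField I φ v q) = v :=
  (isInvertible_mvfderiv_extend hφ hq).self_apply_inverse v

theorem chartField_chartVec (hφ : φ ∈ IsManifold.maximalAtlas I ∞ N) {q : N} (hq : q ∈ φ.source)
    (u : TangentSpace I q) : chartField I φ (chartVec I φ q u) q = u :=
  (isInvertible_mvfderiv_extend hφ hq).inverse_apply_self u

/-- The constant vector fields of two charts are related by the derivative of the transition map. -/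
theorem chartVec_chartField_of_mem {ψ : OpenPartialHomeomorph N H}
    (hφ : φ ∈ IsManifold.maximalAtlas I ∞ N)
    (hψ : ψ ∈ IsManifold.maximalAtlas I ∞ N) {q : N} (hq : q ∈ φ.source) (hq' : q ∈ ψ.source)
    (v : E) : chartVec I φ q (chartField I ψ v q)
      = fderiv ℝ (φ.extend I ∘ (ψ.extend I).symm) (ψ.extend I q) v := by
  rw [chartVec_eq, mvfderiv_eq_fderiv hψ hq' ((OpenPartialHomeomorph.contMDiffAt_extend hφ
    hq).mdifferentiableAt (by simp)), chartVec_chartField hψ hq']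

theorem contDiffAt_comp_extend_symm (hφ : φ ∈ IsManifold.maximalAtlas I ∞ N) {z : E}
    (hz : z ∈ (φ.extend I).target) {F : Type*} [NormedAddCommGroup F] [NormedSpace ℝ F] {f : N → F}
    (hf : ContMDiffAt I 𝓘(ℝ, F) ∞ f ((φ.extend I).symm z)) :
    ContDiffAt ℝ ∞ (f ∘ (φ.extend I).symm) z :=
  (hf.comp z (contMDiffAt_extend_symm hφ hz)).contDiffAt

variable [IsManifold I ∞ N]

theorem contMDiffAt_chartField [CompleteSpace E] (hφ : φ ∈ IsManifold.maximalAtlas I ∞ N) {q : N}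
    (hq : q ∈ φ.source) (v : E) : ContMDiffAt I I.tangent ∞
      (fun q => (⟨q, chartField I φ v q⟩ : TangentBundle I N)) q := by
  refine ContMDiffAt.mpullback_vectorField_preimage (n := ∞) ?_
    (OpenPartialHomeomorph.contMDiffAt_extend hφ hq) (isInvertible_mvfderiv_extend hφ hq) (by simp)
  exact contMDiffAt_vectorSpace_iff_contDiffAt.2 contDiffAt_const

omit [I.Boundaryless] in
theorem continuousLinearMapAt_eq_chartVec {p q : N} (hq : q ∈ (chartAt H p).source)
    (u : TangentSpace I q) :
    (trivializationAt E (TangentSpace I) p).continuousLinearMapAt ℝ q u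
      = chartVec I (chartAt H p) q u := by
  rw [TangentBundle.continuousLinearMapAt_trivializationAt hq]; rfl

theorem trivializationAt_symm_eq_chartField {p q : N} (hq : q ∈ (chartAt H p).source) (v : E) :
    (trivializationAt E (TangentSpace I) p).symm q v = chartField I (chartAt H p) v q := by
  have hp := IsManifold.chart_mem_maximalAtlas (I := I) (n := ∞) p
  have hq' : q ∈ (trivializationAt E (TangentSpace I) p).baseSet := by
    rwa [TangentBundle.trivializationAt_baseSet]
  rw [chartField_eq, eq_comm, (isInvertible_mvfderiv_extend hp hq).inverse_apply_eq, ← chartVec_eq,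
    ← continuousLinearMapAt_eq_chartVec hq]
  rw [← Bundle.Trivialization.symmL_apply (R := ℝ) _ hq',
    Bundle.Trivialization.continuousLinearMapAt_symmL _ hq']

omit [I.Boundaryless] in
/-- A vector field is smooth if and only if its coordinates in a chart of the atlas are. -/
theorem contMDiffAt_section_iff_chartVec {p q : N} (hq : q ∈ (chartAt H p).source)
    {Y : ∀ q : N, TangentSpace I q} :
    ContMDiffAt I I.tangent ∞ (fun q => (⟨q, Y q⟩ : TangentBundle I N)) q ↔
      ContMDiffAt I 𝓘(ℝ, E) ∞ (fun q => chartVec I (chartAt H p) q (Y q)) q := by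
  have hq' : q ∈ (trivializationAt E (TangentSpace I) p).baseSet := by
    rwa [TangentBundle.trivializationAt_baseSet]
  have h := (trivializationAt E (TangentSpace I) p).contMDiffAt_iff (IM := I) (IB := I) (n := ∞)
    (f := fun q => (⟨q, Y q⟩ : TangentBundle I N)) (x₀ := q)
    ((trivializationAt E (TangentSpace I) p).mem_source.2 hq')
  refine h.trans ⟨fun h => h.2.congr_of_eventuallyEq ?_, fun h =>
    ⟨contMDiffAt_id, h.congr_of_eventuallyEq ?_⟩⟩ <;>
  · filter_upwards [(chartAt H p).open_source.mem_nhds hq] with q1 hq1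
    rw [← continuousLinearMapAt_eq_chartVec hq1]
    have : q1 ∈ (trivializationAt E (TangentSpace I) p).baseSet := by
      rwa [TangentBundle.trivializationAt_baseSet]
    rw [Bundle.Trivialization.continuousLinearMapAt_apply,
      Bundle.Trivialization.coe_linearMapAt_of_mem _ this]

/-- The expression of a tensor field in a trivialization of the bundle of bilinear forms is its
expression in the corresponding chart. -/
theorem inCoordinates_eq_tensorIn
    (g : ∀ q : N, TangentSpace I q →L[ℝ] TangentSpace I q →L[ℝ] ℝ) {p q : N}
    (hq : q ∈ (chartAt H p).source) :
    ContinuousLinearMap.inCoordinates E (TangentSpace I : N → Type _) (E →L[ℝ] ℝ)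
      (fun q : N => TangentSpace I q →L[ℝ] ℝ) p q p q (g q)
      = tensorIn I g (chartAt H p) (extChartAt I p q) := by
  have hq' : q ∈ (trivializationAt E (TangentSpace I) p).baseSet := by
    rwa [TangentBundle.trivializationAt_baseSet]
  ext v w
  rw [inCoordinates_apply_eq₂ hq' hq' (by simp), trivializationAt_symm_eq_chartField hq,
    trivializationAt_symm_eq_chartField hq]
  erw [tensorIn_extend_apply g hq]
  simp

/-- A tensor field is smooth if and only if its expressions in the charts of the atlas are. -/
theorem isSmoothTensor_iff {g : ∀ q : N, TangentSpace I q →L[ℝ] TangentSpace I q →L[ℝ] ℝ} :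
    IsSmoothTensor I g ↔
      ∀ p : N, ContDiffOn ℝ ∞ (tensorIn I g (chartAt H p)) (extChartAt I p).target := by
  have key : ∀ p q : N, q ∈ (chartAt H p).source →
    (ContMDiffAt I (I.prod 𝓘(ℝ, E →L[ℝ] E →L[ℝ] ℝ)) ∞
      (fun q => Bundle.TotalSpace.mk' (E →L[ℝ] E →L[ℝ] ℝ)
      (E := fun q : N => TangentSpace I q →L[ℝ] TangentSpace I q →L[ℝ] ℝ) q (g q)) q ↔
      ContDiffAt ℝ ∞ (tensorIn I g (chartAt H p)) (extChartAt I p q)) := by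
    intro p q hq
    let e := trivializationAt (E →L[ℝ] E →L[ℝ] ℝ)
      (fun q : N => TangentSpace I q →L[ℝ] TangentSpace I q →L[ℝ] ℝ) p
    have hp := IsManifold.chart_mem_maximalAtlas (I := I) (n := ∞) p
    have hq' : q ∈ e.baseSet := by
      simp only [e, hom_trivializationAt_baseSet, TangentBundle.trivializationAt_baseSet]
      simpa using hq
    have h1 : (fun q => (e ⟨q, g q⟩).2) =ᶠ[𝓝 q]
        fun q => tensorIn I g (chartAt H p) (extChartAt I p q) := by
      filter_upwards [(chartAt H p).open_source.mem_nhds hq] with q1 hq1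
      rw [← inCoordinates_eq_tensorIn g hq1, hom_trivializationAt_apply]
    refine (e.contMDiffAt_iff (e.mem_source.2 hq')).trans ⟨fun h => ?_, fun h =>
      ⟨contMDiffAt_id, ?_⟩⟩
    · have hz := extend_mem_target (I := I) hq
      have h2 := contDiffAt_comp_extend_symm (φ := chartAt H p) hp hz
        (f := fun q => tensorIn I g (chartAt H p) (extChartAt I p q)) (by
          rw [(chartAt H p).extend_left_inv hq]
          exact h.2.congr_of_eventuallyEq h1.symm)
      refine h2.congr_of_eventuallyEq ?_
      filter_upwards [extend_target_mem_nhds hz] with z hz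
      exact congrArg _ ((extChartAt I p).right_inv hz).symm
    · refine ContMDiffAt.congr_of_eventuallyEq ?_ h1
      exact h.contMDiffAt.comp q (OpenPartialHomeomorph.contMDiffAt_extend hp hq)
  constructor
  · intro h p z hz
    have hq := extend_symm_mem_source (φ := chartAt H p) hz
    have h1 := (key p _ hq).1 (h _)
    rw [show extChartAt I p (((chartAt H p).extend I).symm z) = z from
      (extChartAt I p).right_inv hz] at h1
    exact h1.contDiffWithinAt
  · intro h q
    exact (key q q (mem_chart_source H q)).2 ((h q).contDiffAt
      (extChartAt_target_mem_nhds q))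

end ChartCalculus

/-! ### Christoffel symbols of a connection on the tangent bundle -/

section Connection

variable {E : Type*} [NormedAddCommGroup E] [NormedSpace ℝ E] {H : Type*} [TopologicalSpace H]
  {I : ModelWithCorners ℝ E H} {N : Type*} [TopologicalSpace N] [ChartedSpace H N]

theorem mvfderiv_clm_comp {F F' : Type*} [NormedAddCommGroup F] [NormedSpace ℝ F]
    [NormedAddCommGroup F'] [NormedSpace ℝ F'] {c : N → F} {q : N}
    (hc : MDifferentiableAt I 𝓘(ℝ, F) c q) (L : F →L[ℝ] F') (w : TangentSpace I q) :
    mvfderiv I (fun q => L (c q)) q w = L (mvfderiv I c q w) := by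
  have h := congrArg (fun A => A w) (mfderiv_comp (I := I) (I' := 𝓘(ℝ, F)) (I'' := 𝓘(ℝ, F'))
    (f := c) (g := L) q L.differentiableAt.mdifferentiableAt hc)
  refine h.trans ?_
  have h2 : mvfderiv 𝓘(ℝ, F) L (c q) = L := by
    rw [mvfderiv, mfderiv_eq_fderiv, L.fderiv]; rfl
  exact congrArg (fun A : F →L[ℝ] F' => A (mvfderiv I c q w)) h2

variable {φ : OpenPartialHomeomorph N H} [IsManifold I ∞ N]
  (nabla : CovariantDerivative I E (TangentSpace I : N → Type _))

theorem christoffel_extend {q : N} (hq : q ∈ φ.source) (u v : E) :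
    christoffel nabla φ (φ.extend I q) u v
      = chartVec I φ q (nabla (chartField I φ v) q (chartField I φ u q)) := by
  simp only [christoffel]
  rw [φ.extend_left_inv hq]

variable [FiniteDimensional ℝ E]

/-- The covariant derivative of a locally defined smooth vector field is smooth. -/
theorem contMDiffAt_covariantDerivative [T2Space N]
    [CovariantDerivative.ContMDiffCovariantDerivative nabla ∞] {q : N} {O : Set N} (hO : IsOpen O)
    (hq : q ∈ O) {X : ∀ q : N, TangentSpace I q}
    (hX : ContMDiffOn I I.tangent ∞ (fun q => (⟨q, X q⟩ : TangentBundle I N)) O) :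
    ContMDiffAt I (I.prod 𝓘(ℝ, E →L[ℝ] E)) ∞ (fun q => Bundle.TotalSpace.mk' (E →L[ℝ] E)
      (E := fun q : N => TangentSpace I q →L[ℝ] TangentSpace I q) q (nabla X q)) q := by
  obtain ⟨χ, -, hχ⟩ :=
    (SmoothBumpFunction.nhds_basis_tsupport (I := I) q).mem_iff.1 (hO.mem_nhds hq)
  -- A bump function extends the field to a global one without changing its germ at `q`.
  have hχX : ContMDiff I I.tangent ∞
      (fun q => (⟨q, ((χ : N → ℝ) • X) q⟩ : TangentBundle I N)) := by
    intro q'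
    by_cases hq' : q' ∈ O
    · exact χ.contMDiffAt.smul_section (hX.contMDiffAt (hO.mem_nhds hq'))
    · refine (Bundle.contMDiffAt_zeroSection ℝ
        (TangentSpace I : N → Type _)).congr_of_eventuallyEq ?_
      filter_upwards [(isClosed_tsupport χ).isOpen_compl.mem_nhds fun h => hq' (hχ h)] with q1 h1
      simp [Bundle.zeroSection, image_eq_zero_of_notMem_tsupport h1]
  have h1 := ((CovariantDerivative.ContMDiffCovariantDerivative.contMDiff
    (cov := nabla) (k := ∞)).contMDiff
    (σ := (χ : N → ℝ) • X) (by simpa using hχX.contMDiffOn)).contMDiffAt (x := q) Filter.univ_mem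
  refine h1.congr_of_eventuallyEq ?_
  filter_upwards [hO.mem_nhds hq, χ.eventuallyEq_one.eventuallyEq_nhds] with q1 h2 h3
  have h4 : MDifferentiableAt I I.tangent (fun q => (⟨q, X q⟩ : TangentBundle I N)) q1 :=
    (hX.contMDiffAt (hO.mem_nhds h2)).mdifferentiableAt (by simp)
  have h5 : nabla X q1 = nabla ((χ : N → ℝ) • X) q1 := by
    refine nabla.isCovariantDerivativeOnUniv.congr_of_eventuallyEq h4
      ((χ.contMDiffAt.mdifferentiableAt (by simp)).smul_section h4) Filter.univ_mem ?_
    filter_upwards [h3] with q2 h6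
    simp [h6]
  rw [h5]

variable [I.Boundaryless]

theorem mdifferentiableAt_chartField (hφ : φ ∈ IsManifold.maximalAtlas I ∞ N) {q : N}
    (hq : q ∈ φ.source) (v : E) : MDifferentiableAt I I.tangent
      (fun q => (⟨q, chartField I φ v q⟩ : TangentBundle I N)) q :=
  have : CompleteSpace E := FiniteDimensional.complete ℝ E
  (contMDiffAt_chartField hφ hq v).mdifferentiableAt (by simp)

/-- The covariant derivative of a vector field with coordinates `c` in the chart `φ`. -/
theorem chartVec_covariantDerivative (hφ : φ ∈ IsManifold.maximalAtlas I ∞ N) {q : N}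
    (hq : q ∈ φ.source) {c : N → E} (hc : MDifferentiableAt I 𝓘(ℝ, E) c q)
    (w : TangentSpace I q) :
    chartVec I φ q (nabla (fun q' => chartField I φ (c q') q') q w)
      = christoffel nabla φ (φ.extend I q) (chartVec I φ q w) (c q) + mvfderiv I c q w := by
  let b := Module.finBasis ℝ E
  have hcov := nabla.isCovariantDerivativeOnUniv
  have hb := fun j => mdifferentiableAt_chartField hφ hq (b j)
  -- A finite linear combination of the coordinate fields with function coefficients.
  have hsum : ∀ (a : Fin (Module.finrank ℝ E) → N → ℝ), (∀ j, MDifferentiableAt I 𝓘(ℝ, ℝ) (a j) q) →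
      ∀ S : Finset (Fin (Module.finrank ℝ E)),
      MDifferentiableAt I I.tangent
        (fun q' => (⟨q', (∑ j ∈ S, a j • chartField I φ (b j)) q'⟩ : TangentBundle I N)) q ∧
      nabla (∑ j ∈ S, a j • chartField I φ (b j)) q w
        = ∑ j ∈ S, (a j q • nabla (chartField I φ (b j)) q w
          + mvfderiv I (a j) q w • chartField I φ (b j) q) := by
    intro a ha S
    induction S using Finset.induction_on with
    | empty =>
      simp only [Finset.sum_empty, CovariantDerivative.zero]
      exact ⟨Bundle.mdifferentiableAt_zeroSection .., rfl⟩
    | insert j S hj ih =>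
      simp only [Finset.sum_insert hj]
      have h1 := (ha j).smul_section (hb j)
      refine ⟨mdifferentiableAt_add_section h1 ih.1, ?_⟩
      rw [hcov.add h1 ih.1, hcov.leibniz (hb j) (ha j), add_apply, ih.2]
      rfl
  have hexp : ∀ c : N → E, (fun q' => chartField I φ (c q') q')
      = ∑ j, (fun q' => b.coord j (c q')) • chartField I φ (b j) := by
    intro c
    funext q'
    rw [Finset.sum_apply]
    simp only [Pi.smul_apply', chartField_eq]
    conv_lhs => rw [← b.sum_repr (c q'), map_sum]
    simp
  have hc1 : ∀ j, MDifferentiableAt I 𝓘(ℝ, ℝ) (fun q' => b.coord j (c q')) q := fun j =>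
    (b.coord j).toContinuousLinearMap.differentiableAt.mdifferentiableAt.comp q hc
  have h1 := (hsum _ hc1 Finset.univ).2
  have h2 := (hsum (fun j _ => b.coord j (c q)) (fun j => mdifferentiableAt_const) Finset.univ).2
  rw [← hexp c] at h1
  rw [← hexp fun _ => c q] at h2
  rw [christoffel_extend nabla hq, chartField_chartVec hφ hq, h1]
  rw [show (chartField I φ (c q)) = fun q' => chartField I φ (c q) q' from rfl, h2]
  have h3 : ∀ j, mvfderiv I (fun q' => b.coord j (c q')) q w = b.coord j (mvfderiv I c q w) :=
    fun j => mvfderiv_clm_comp hc (b.coord j).toContinuousLinearMap w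
  simp only [h3, mvfderiv_const, chartVec_eq, map_sum, map_add, map_smul, Finset.sum_add_distrib]
  simp only [← chartVec_eq, chartVec_chartField hφ hq]
  simp

theorem christoffel_add_smul (hφ : φ ∈ IsManifold.maximalAtlas I ∞ N) {z : E}
    (hz : z ∈ (φ.extend I).target) (a : ℝ) (u v w : E) :
    christoffel nabla φ z u (v + a • w)
      = christoffel nabla φ z u v + a • christoffel nabla φ z u w := by
  have hq := extend_symm_mem_source hz
  rw [← (φ.extend I).right_inv hz]
  simp only [christoffel_extend nabla hq]
  have hv := mdifferentiableAt_chartField hφ hq v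
  have hw := mdifferentiableAt_chartField hφ hq w
  have h1 : chartField I φ (v + a • w)
      = chartField I φ v + (fun _ : N => a) • chartField I φ w := by
    funext q
    simp [chartField_eq]
  have hcov := nabla.isCovariantDerivativeOnUniv
  rw [h1, hcov.add hv (mdifferentiableAt_const.smul_section hw),
    hcov.leibniz hw mdifferentiableAt_const]
  simp only [chartVec_eq, mvfderiv_const]
  rw [add_apply, add_apply, smul_apply, map_add, map_add, map_smul,
    ContinuousLinearMap.smulRight_apply]
  simp only [zero_apply, zero_smul, map_zero, add_zero]

/-- The Christoffel symbols in a chart, as a field of bilinear maps. -/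
noncomputable def christoffelL (φ : OpenPartialHomeomorph N H) (z : E) : E →L[ℝ] E →L[ℝ] E :=
  ∑ i, ∑ j, ((Module.finBasis ℝ E).coord i).toContinuousLinearMap.smulRight
    (((Module.finBasis ℝ E).coord j).toContinuousLinearMap.smulRight
      (christoffel nabla φ z (Module.finBasis ℝ E i) (Module.finBasis ℝ E j)))

theorem christoffelL_apply (hφ : φ ∈ IsManifold.maximalAtlas I ∞ N) {z : E}
    (hz : z ∈ (φ.extend I).target) (u v : E) :
    christoffelL nabla φ z u v = christoffel nabla φ z u v := by
  let b := Module.finBasis ℝ E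
  have h0 : ∀ u, christoffel nabla φ z u 0 = 0 := fun u => by
    have := christoffel_add_smul nabla hφ hz (-1) u 0 0
    simpa using this
  let L : E →ₗ[ℝ] E →ₗ[ℝ] E := LinearMap.mk₂ ℝ (christoffel nabla φ z)
    (fun u u' v => by
      simp only [christoffel, chartField_eq, chartVec_eq]
      rw [map_add, map_add, map_add])
    (fun a u v => by
      simp only [christoffel, chartField_eq, chartVec_eq]
      rw [map_smul, map_smul, map_smul])
    (fun u v w => by simpa using christoffel_add_smul nabla hφ hz 1 u v w)
    (fun a u v => by simpa [h0] using christoffel_add_smul nabla hφ hz a u 0 v)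
  have hL : ∀ u v, christoffel nabla φ z u v = L u v := fun _ _ => rfl
  simp only [christoffelL, hL]
  have h1 : L u v = ∑ i, ∑ j, b.repr u i • b.repr v j • L (b i) (b j) := by
    conv_lhs => rw [← b.sum_repr u, ← b.sum_repr v]
    simp only [map_sum, LinearMap.sum_apply, map_smul, LinearMap.smul_apply, Finset.smul_sum]
    rw [Finset.sum_comm]
    exact Finset.sum_congr rfl fun i _ => Finset.sum_congr rfl fun j _ => smul_comm _ _ _
  rw [h1]
  simp [b]

/-- The transformation law of the Christoffel symbols, obtained by expanding the constant fields of
the chart `ψ` in those of the chart `φ`. -/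
theorem fderiv_christoffel {ψ : OpenPartialHomeomorph N H}
    (hφ : φ ∈ IsManifold.maximalAtlas I ∞ N) (hψ : ψ ∈ IsManifold.maximalAtlas I ∞ N) {q : N}
    (hq : q ∈ φ.source) (hq' : q ∈ ψ.source) (u v : E) :
    fderiv ℝ (φ.extend I ∘ (ψ.extend I).symm) (ψ.extend I q)
        (christoffel nabla ψ (ψ.extend I q) u v)
      = christoffel nabla φ (φ.extend I q)
          (fderiv ℝ (φ.extend I ∘ (ψ.extend I).symm) (ψ.extend I q) u)
          (fderiv ℝ (φ.extend I ∘ (ψ.extend I).symm) (ψ.extend I q) v)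
        + fderiv ℝ (fderiv ℝ (φ.extend I ∘ (ψ.extend I).symm)) (ψ.extend I q) u v := by
  set s := φ.extend I ∘ (ψ.extend I).symm with hs
  have hz := extend_mem_target (I := I) hq'
  have hs1 : ContDiffAt ℝ ∞ s (ψ.extend I q) := by
    refine contDiffAt_comp_extend_symm hψ hz ?_
    rw [ψ.extend_left_inv hq']
    exact OpenPartialHomeomorph.contMDiffAt_extend hφ hq
  have hs2 : ContDiffAt ℝ ∞ (fderiv ℝ s) (ψ.extend I q) := hs1.fderiv_right (by simp)
  let c : N → E := fun q' => fderiv ℝ s (ψ.extend I q') v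
  have hψd : MDifferentiableAt I 𝓘(ℝ, E) (ψ.extend I) q :=
    (OpenPartialHomeomorph.contMDiffAt_extend hψ hq').mdifferentiableAt (by simp)
  have hcd : DifferentiableAt ℝ (fun z => fderiv ℝ s z v) (ψ.extend I q) :=
    (hs2.differentiableAt (by simp)).clm_apply (differentiableAt_const v)
  have hc : MDifferentiableAt I 𝓘(ℝ, E) c q := hcd.mdifferentiableAt.comp q hψd
  have heq : ∀ᶠ q' in 𝓝 q, chartField I ψ v q' = chartField I φ (c q') q' := by
    filter_upwards [φ.open_source.mem_nhds hq, ψ.open_source.mem_nhds hq'] with q1 h1 h2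
    rw [← chartField_chartVec hφ h1 (chartField I ψ v q1), chartVec_chartField_of_mem hφ hψ h1 h2]
  have hψv := mdifferentiableAt_chartField hψ hq' v
  have h1 : nabla (chartField I ψ v) q = nabla (fun q' => chartField I φ (c q') q') q := by
    refine nabla.isCovariantDerivativeOnUniv.congr_of_eventuallyEq hψv
      (hψv.congr_of_eventuallyEq ?_) Filter.univ_mem heq
    filter_upwards [heq] with q' h
    rw [h]
  have h2 : ∀ w : TangentSpace I q,
      fderiv ℝ s (ψ.extend I q) (chartVec I ψ q w) = chartVec I φ q w := by
    intro w
    rw [← chartVec_chartField_of_mem hφ hψ hq hq', chartField_chartVec hψ hq']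
  rw [christoffel_extend nabla hq', h2, h1, chartVec_covariantDerivative nabla hφ hq hc,
    chartVec_chartField_of_mem hφ hψ hq hq']
  congr 1
  rw [mvfderiv_eq_fderiv hψ hq' hc, chartVec_chartField hψ hq']
  have h3 : c ∘ (ψ.extend I).symm =ᶠ[𝓝 (ψ.extend I q)] fun z => fderiv ℝ s z v := by
    filter_upwards [extend_target_mem_nhds hz] with z hz
    simp only [c, Function.comp_apply, (ψ.extend I).right_inv hz]
  rw [h3.fderiv_eq, fderiv_clm_apply (hs2.differentiableAt (by simp)) (differentiableAt_const v)]
  simp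

/-- The Christoffel symbols of a torsion-free connection are symmetric: constant fields commute. -/
theorem christoffel_symm (htorsion : nabla.torsion = 0) (hφ : φ ∈ IsManifold.maximalAtlas I ∞ N)
    {z : E} (hz : z ∈ (φ.extend I).target) (u v : E) :
    christoffel nabla φ z u v = christoffel nabla φ z v u := by
  have hq := extend_symm_mem_source hz
  rw [← (φ.extend I).right_inv hz]
  simp only [christoffel_extend nabla hq]
  have : CompleteSpace E := FiniteDimensional.complete ℝ E
  have h2' : (2 : ℕ∞ω) ≤ ∞ := WithTop.coe_le_coe.2 (le_top : (2 : ℕ∞) ≤ ⊤)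
  have : IsManifold I 2 N := IsManifold.of_le h2'
  have hm : minSmoothness ℝ 2 = 2 := minSmoothness_of_isRCLikeNormedField
  have : IsManifold I (minSmoothness ℝ 2) N := by rwa [hm]
  have h1 := (CovariantDerivative.torsion_eq_zero_iff nabla).1 htorsion
    (mdifferentiableAt_chartField hφ hq u) (mdifferentiableAt_chartField hφ hq v)
  have hc : ∀ v : E, MDifferentiableAt 𝓘(ℝ, E) 𝓘(ℝ, E).tangent
      (fun z => (⟨z, v⟩ : TangentBundle 𝓘(ℝ, E) E)) (φ.extend I ((φ.extend I).symm z)) := fun v =>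
    ((contMDiffAt_vectorSpace_iff_contDiffAt (n := 1) (V := fun _ => v)).2
      contDiffAt_const).mdifferentiableAt (by simp)
  let U : ∀ z : E, TangentSpace 𝓘(ℝ, E) z := fun _ => u
  let V : ∀ z : E, TangentSpace 𝓘(ℝ, E) z := fun _ => v
  have h2 := VectorField.mpullback_mlieBracket (hc u) (hc v)
    (OpenPartialHomeomorph.contMDiffAt_extend hφ hq) (hm.trans_le h2')
  have h3 : VectorField.mlieBracket 𝓘(ℝ, E) U V (φ.extend I ((φ.extend I).symm z)) = 0 := by
    rw [← VectorField.mlieBracketWithin_univ, VectorField.mlieBracketWithin_eq_lieBracketWithin,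
      VectorField.lieBracketWithin_univ, VectorField.lieBracket_eq]
    change fderiv ℝ (fun _ => v) _ _ - fderiv ℝ (fun _ => u) _ _ = 0
    simp
  change VectorField.mpullback I 𝓘(ℝ, E) (φ.extend I) (VectorField.mlieBracket 𝓘(ℝ, E) U V) _
    = _ at h2
  rw [VectorField.mpullback_apply, h3, map_zero] at h2
  rw [← sub_eq_zero, chartVec_eq, chartVec_eq, ← map_sub]
  exact (congrArg _ (h1.trans h2.symm)).trans (map_zero _)

theorem contDiffOn_christoffelL [T2Space N]
    [CovariantDerivative.ContMDiffCovariantDerivative nabla ∞] (p : N) :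
    ContDiffOn ℝ ∞ (christoffelL nabla (chartAt H p)) (extChartAt I p).target := by
  have : CompleteSpace E := FiniteDimensional.complete ℝ E
  have hp := IsManifold.chart_mem_maximalAtlas (I := I) (n := ∞) p
  have h1 : ∀ u v, ContDiffOn ℝ ∞ (fun z => christoffel nabla (chartAt H p) z u v)
      (extChartAt I p).target := by
    intro u v z hz
    have hq := extend_symm_mem_source (φ := chartAt H p) hz
    have h2 := contMDiffAt_covariantDerivative nabla (chartAt H p).open_source hq
      (X := chartField I (chartAt H p) v)
      (fun q hq => (contMDiffAt_chartField hp hq v).contMDiffWithinAt)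
    have h3 := (contMDiffAt_section_iff_chartVec
      (Y := fun q => nabla (chartField I (chartAt H p) v) q
      (chartField I (chartAt H p) u q)) hq).1
        (h2.clm_bundle_apply (contMDiffAt_chartField hp hq u))
    exact (contDiffAt_comp_extend_symm hp hz h3).contDiffWithinAt
  unfold christoffelL
  refine ContDiffOn.sum fun i _ => ContDiffOn.sum fun j _ => ?_
  exact ((ContinuousLinearMap.smulRightL ℝ E _ _).contDiff.comp_contDiffOn
    ((ContinuousLinearMap.smulRightL ℝ E _ _).contDiff.comp_contDiffOn (h1 _ _)))

end Connection

/-! ### The extension in the coordinates of the cotangent bundle -/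

section CotangentCharts

theorem mvfderiv_apply_of_hasFDerivAt {E : Type*} [NormedAddCommGroup E] [NormedSpace ℝ E]
    {H : Type*} [TopologicalSpace H] {I : ModelWithCorners ℝ E H} [I.Boundaryless] {N : Type*}
    [TopologicalSpace N] [ChartedSpace H N] {φ : OpenPartialHomeomorph N H}
    (hφ : φ ∈ IsManifold.maximalAtlas I ∞ N) {q : N} (hq : q ∈ φ.source) {F : Type*}
    [NormedAddCommGroup F] [NormedSpace ℝ F] {f : N → F} {f' : E →L[ℝ] F}
    (hf : HasFDerivAt (f ∘ (φ.extend I).symm) f' (φ.extend I q)) (u : TangentSpace I q) :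
    mvfderiv I f q u = f' (chartVec I φ q u) := by
  have h1 : MDifferentiableAt I 𝓘(ℝ, F) f q := by
    refine (hf.differentiableAt.mdifferentiableAt.comp q ((OpenPartialHomeomorph.contMDiffAt_extend
      hφ hq).mdifferentiableAt (by simp))).congr_of_eventuallyEq ?_
    filter_upwards [φ.open_source.mem_nhds hq] with q' hq'
    simp only [Function.comp_apply, φ.extend_left_inv hq']
  rw [mvfderiv_eq_fderiv hφ hq h1, hf.fderiv]

/-- The derivatives of a transition map of the manifold and of its inverse are inverse to each
other. -/
theorem fderiv_transition_comp {E : Type*} [NormedAddCommGroup E] [NormedSpace ℝ E]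
    {H : Type*} [TopologicalSpace H] {I : ModelWithCorners ℝ E H} [I.Boundaryless] {N : Type*}
    [TopologicalSpace N] [ChartedSpace H N] {φ ψ : OpenPartialHomeomorph N H}
    (hφ : φ ∈ IsManifold.maximalAtlas I ∞ N) (hψ : ψ ∈ IsManifold.maximalAtlas I ∞ N)
    {q : N} (hq : q ∈ φ.source) (hq' : q ∈ ψ.source) (v : E) :
    fderiv ℝ (φ.extend I ∘ (ψ.extend I).symm) (ψ.extend I q)
      (fderiv ℝ (ψ.extend I ∘ (φ.extend I).symm) (φ.extend I q) v) = v := by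
  rw [← chartVec_chartField_of_mem hφ hψ hq hq', ← chartVec_chartField_of_mem hψ hφ hq' hq,
    chartField_chartVec hψ hq', chartVec_chartField hφ hq]

open LocalCoord in
/-- The algebra behind the independence of the chart. Here `K` and `D` are the first and second
derivatives of a change of charts, `a`, `b` are the horizontal coordinates of two tangent vectors in
the first chart, `α`, `β` are their fibre coordinates in the second; the terms with `D` cancel. -/
theorem extension_frame (K : Plane →L[ℝ] Plane) {D Γ : Plane →L[ℝ] Plane →L[ℝ] Plane}
    (hD : ∀ u v, D u v = D v u) (F : Plane →L[ℝ] Plane →L[ℝ] ℝ) (η α β : Plane →L[ℝ] ℝ)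
    (a b : Plane) :
    ∑ i, (a i * (β (K (EuclideanSpace.single i 1)) + η (D b (EuclideanSpace.single i 1)))
        + (α (K (EuclideanSpace.single i 1)) + η (D a (EuclideanSpace.single i 1))) * b i)
      + ∑ i, ∑ j, (-2 * η (Γ (K (EuclideanSpace.single i 1)) (K (EuclideanSpace.single j 1))
          + D (EuclideanSpace.single i 1) (EuclideanSpace.single j 1))
        + F (K (EuclideanSpace.single i 1)) (K (EuclideanSpace.single j 1))) * (a i * b j)
      = α (K b) + β (K a) - 2 * η (Γ (K a) (K b)) + F (K a) (K b) := by
  have hDa := dual_plane_apply D a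
  have hDb := dual_plane_apply D b
  rw [dual_plane_apply K a, dual_plane_apply K b, hDa, hDb]
  have h10 := hD (EuclideanSpace.single 1 1) (EuclideanSpace.single 0 1)
  simp only [Fin.sum_univ_two, map_add, map_smul, add_apply, smul_apply, smul_eq_mul, h10]
  ring

open LocalCoord in
/-- The matrix relating the coframes `(dx, dy)` of two charts is block triangular, and its diagonal
blocks have inverse determinants. -/
theorem det_frame {C K : Plane →L[ℝ] Plane} (hKC : ∀ v, K (C v) = v)
    (L : Plane →L[ℝ] Plane →L[ℝ] ℝ) (U : Fin 4 → Plane × (Plane →L[ℝ] ℝ)) :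
    (Matrix.of fun i : Fin 4 => ![C (U i).1 0, C (U i).1 1,
      (U i).2 (K (EuclideanSpace.single 0 1)) + L (U i).1 (EuclideanSpace.single 0 1),
      (U i).2 (K (EuclideanSpace.single 1 1)) + L (U i).1 (EuclideanSpace.single 1 1)]).det
    = (Matrix.of fun i : Fin 4 => ![(U i).1 0, (U i).1 1,
      (U i).2 (EuclideanSpace.single 0 1), (U i).2 (EuclideanSpace.single 1 1)]).det := by
  set e₀ : Plane := EuclideanSpace.single 0 1
  set e₁ : Plane := EuclideanSpace.single 1 1
  let T : Matrix (Fin 4) (Fin 4) ℝ :=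
    !![C e₀ 0, C e₀ 1, L e₀ e₀, L e₀ e₁; C e₁ 0, C e₁ 1, L e₁ e₀, L e₁ e₁;
      0, 0, K e₀ 0, K e₁ 0; 0, 0, K e₀ 1, K e₁ 1]
  have hT : T.det = 1 := by
    have h0 := hKC e₀
    have h1 := hKC e₁
    rw [dual_plane_apply K] at h0 h1
    have h00 : C e₀ 0 * K e₀ 0 + C e₀ 1 * K e₁ 0 = 1 := by
      simpa [e₀] using congrArg (fun v : Plane => v 0) h0
    have h01 : C e₀ 0 * K e₀ 1 + C e₀ 1 * K e₁ 1 = 0 := by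
      simpa [e₀] using congrArg (fun v : Plane => v 1) h0
    have h10 : C e₁ 0 * K e₀ 0 + C e₁ 1 * K e₁ 0 = 0 := by
      simpa [e₁] using congrArg (fun v : Plane => v 0) h1
    have h11 : C e₁ 0 * K e₀ 1 + C e₁ 1 * K e₁ 1 = 1 := by
      simpa [e₁] using congrArg (fun v : Plane => v 1) h1
    have h2 : T.det
        = (C e₀ 0 * C e₁ 1 - C e₀ 1 * C e₁ 0) * (K e₀ 0 * K e₁ 1 - K e₁ 0 * K e₀ 1) := by
      simp [T, Matrix.det_succ_row_zero, Fin.sum_univ_succ, Fin.succAbove]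
      ring
    rw [h2]
    linear_combination h00 * (C e₁ 0 * K e₀ 1 + C e₁ 1 * K e₁ 1) + h11
      - h01 * (C e₁ 0 * K e₀ 0 + C e₁ 1 * K e₁ 0)
  rw [← mul_one (Matrix.det (Matrix.of fun i : Fin 4 => ![(U i).1 0, (U i).1 1,
    (U i).2 e₀, (U i).2 e₁])), ← hT, ← Matrix.det_mul]
  congr 1
  ext i j
  have hC := dual_plane_apply C (U i).1
  have hL := dual_plane_apply L (U i).1
  have hK0 := dual_plane_apply (U i).2 (K e₀)
  have hK1 := dual_plane_apply (U i).2 (K e₁)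
  fin_cases j <;> simp [Matrix.mul_apply, Fin.sum_univ_four, T, hC, hL, hK0, hK1, e₀, e₁] <;> ring

variable {M : Type*} [TopologicalSpace M] [ChartedSpace Plane M] [IsManifold (𝓡 2) ∞ M]

theorem mem_chartAt_cotangent_source (P₀ P : Cotangent M) :
    P ∈ (chartAt (ModelProd Plane (Plane →L[ℝ] ℝ)) P₀).source
      ↔ P.proj ∈ (chartAt Plane P₀.proj).source := by
  rw [FiberBundle.chartedSpace_chartAt]
  simp [hom_trivializationAt_apply]

theorem chartAt_cotangent_extend_fst (P₀ P : Cotangent M) :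
    ((chartAt (ModelProd Plane (Plane →L[ℝ] ℝ)) P₀).extend cotangentModel P).1
      = (chartAt Plane P₀.proj).extend (𝓡 2) P.proj := by
  change (extChartAt cotangentModel P₀ P).1 = _
  rw [FiberBundle.extChartAt]
  simp [hom_trivializationAt_apply]

/-- The fibre coordinates of a covector in a chart of the cotangent bundle are its components in the
corresponding chart of the surface. -/
theorem chartAt_cotangent_extend_snd (P₀ P : Cotangent M)
    (hP : P.proj ∈ (chartAt Plane P₀.proj).source) (v : Plane) :
    ((chartAt (ModelProd Plane (Plane →L[ℝ] ℝ)) P₀).extend cotangentModel P).2 v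
      = P.snd (chartField (𝓡 2) (chartAt Plane P₀.proj) v P.proj) := by
  change (extChartAt cotangentModel P₀ P).2 v = _
  have hq' : P.proj ∈ (trivializationAt Plane (TangentSpace (𝓡 2) : M → Type _)
      P₀.proj).baseSet := by
    rwa [TangentBundle.trivializationAt_baseSet]
  rw [FiberBundle.extChartAt, ← trivializationAt_symm_eq_chartField hP,
    ← Bundle.Trivialization.symmL_apply (R := ℝ) _ hq']
  simp [hom_trivializationAt_apply, ContinuousLinearMap.inCoordinates]

theorem mem_chartAt_cotangent_extend_target (P₀ : Cotangent M) (z : Plane × (Plane →L[ℝ] ℝ)) :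
    z ∈ ((chartAt (ModelProd Plane (Plane →L[ℝ] ℝ)) P₀).extend cotangentModel).target
      ↔ z.1 ∈ ((chartAt Plane P₀.proj).extend (𝓡 2)).target := by
  change z ∈ (extChartAt cotangentModel P₀).target ↔ _
  rw [FiberBundle.extChartAt_target]
  simp
  exact fun h => (chartAt Plane P₀.proj).map_target h

theorem chartAt_cotangent_extend_symm_proj (P₀ : Cotangent M) {z : Plane × (Plane →L[ℝ] ℝ)}
    (hz : z.1 ∈ ((chartAt Plane P₀.proj).extend (𝓡 2)).target) :
    (((chartAt (ModelProd Plane (Plane →L[ℝ] ℝ)) P₀).extend cotangentModel).symm z).proj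
      = ((chartAt Plane P₀.proj).extend (𝓡 2)).symm z.1 := by
  have hz' := (mem_chartAt_cotangent_extend_target P₀ z).2 hz
  have h := chartAt_cotangent_extend_fst P₀
    (((chartAt (ModelProd Plane (Plane →L[ℝ] ℝ)) P₀).extend cotangentModel).symm z)
  rw [PartialEquiv.right_inv _ hz'] at h
  rw [h, OpenPartialHomeomorph.extend_left_inv]
  exact (mem_chartAt_cotangent_source P₀ _).1 (extend_symm_mem_source hz')

/-- The form `dx^i` of one chart of `M` in the coordinates of `T*M` defined by another one. -/
theorem formX_apply (P₀ : Cotangent M) {φ : OpenPartialHomeomorph M Plane}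
    (hφ : φ ∈ IsManifold.maximalAtlas (𝓡 2) ∞ M) {P : Cotangent M} (hP : P.proj ∈ φ.source)
    (hP' : P.proj ∈ (chartAt Plane P₀.proj).source) (i : Fin 2) (U : CotangentTangent P) :
    formX φ i P U = fderiv ℝ (φ.extend (𝓡 2) ∘ ((chartAt Plane P₀.proj).extend (𝓡 2)).symm)
      ((chartAt Plane P₀.proj).extend (𝓡 2) P.proj)
      (chartVec cotangentModel (chartAt (ModelProd Plane (Plane →L[ℝ] ℝ)) P₀) P U).1 i := by
  have hκ := IsManifold.chart_mem_maximalAtlas (I := cotangentModel) (n := ∞) P₀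
  have hψ := IsManifold.chart_mem_maximalAtlas (I := 𝓡 2) (n := ∞) P₀.proj
  have hPκ := (mem_chartAt_cotangent_source P₀ P).2 hP'
  have hz := extend_mem_target (I := cotangentModel) hPκ
  set s := φ.extend (𝓡 2) ∘ ((chartAt Plane P₀.proj).extend (𝓡 2)).symm
  have hs : ContDiffAt ℝ ∞ s ((chartAt Plane P₀.proj).extend (𝓡 2) P.proj) := by
    refine contDiffAt_comp_extend_symm hψ (extend_mem_target hP') ?_
    rw [OpenPartialHomeomorph.extend_left_inv _ hP']
    exact OpenPartialHomeomorph.contMDiffAt_extend hφ hP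
  refine (mvfderiv_apply_of_hasFDerivAt (f := coordX φ i) hκ hPκ (f' :=
    (EuclideanSpace.proj i).comp ((fderiv ℝ s ((chartAt Plane P₀.proj).extend (𝓡 2) P.proj)).comp
      (.fst ℝ Plane (Plane →L[ℝ] ℝ)))) ?_ U).trans rfl
  rw [← chartAt_cotangent_extend_fst] at hs ⊢
  refine HasFDerivAt.congr_of_eventuallyEq ((EuclideanSpace.proj i).hasFDerivAt.comp _
    ((hs.differentiableAt (by simp)).hasFDerivAt.comp _ hasFDerivAt_fst)) ?_
  filter_upwards [extend_target_mem_nhds hz] with z hz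
  have h1 := chartAt_cotangent_extend_symm_proj P₀
    ((mem_chartAt_cotangent_extend_target P₀ z).1 hz)
  simp only [Function.comp_apply, coordX, s, h1]
  rfl

theorem coordY_apply (P₀ : Cotangent M) {φ : OpenPartialHomeomorph M Plane}
    (hφ : φ ∈ IsManifold.maximalAtlas (𝓡 2) ∞ M) {P : Cotangent M} (hP : P.proj ∈ φ.source)
    (hP' : P.proj ∈ (chartAt Plane P₀.proj).source) (i : Fin 2) :
    coordY φ i P = ((chartAt (ModelProd Plane (Plane →L[ℝ] ℝ)) P₀).extend cotangentModel P).2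
      (fderiv ℝ ((chartAt Plane P₀.proj).extend (𝓡 2) ∘ (φ.extend (𝓡 2)).symm)
        (φ.extend (𝓡 2) P.proj) (EuclideanSpace.single i 1)) := by
  have hψ := IsManifold.chart_mem_maximalAtlas (I := 𝓡 2) (n := ∞) P₀.proj
  rw [chartAt_cotangent_extend_snd P₀ P hP', ← chartVec_chartField_of_mem hψ hφ hP' hP,
    chartField_chartVec hψ hP']
  rfl

/-- The form `dy_i` of one chart of `M` in the coordinates of `T*M` defined by another one. It
involves the second derivative of the transition map. -/
theorem formY_apply (P₀ : Cotangent M) {φ : OpenPartialHomeomorph M Plane}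
    (hφ : φ ∈ IsManifold.maximalAtlas (𝓡 2) ∞ M) {P : Cotangent M} (hP : P.proj ∈ φ.source)
    (hP' : P.proj ∈ (chartAt Plane P₀.proj).source) (i : Fin 2) (U : CotangentTangent P) :
    formY φ i P U = (chartVec cotangentModel (chartAt (ModelProd Plane (Plane →L[ℝ] ℝ)) P₀) P U).2
        (fderiv ℝ ((chartAt Plane P₀.proj).extend (𝓡 2) ∘ (φ.extend (𝓡 2)).symm)
          (φ.extend (𝓡 2) P.proj) (EuclideanSpace.single i 1))
      + ((chartAt (ModelProd Plane (Plane →L[ℝ] ℝ)) P₀).extend cotangentModel P).2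
        (fderiv ℝ (fderiv ℝ ((chartAt Plane P₀.proj).extend (𝓡 2) ∘ (φ.extend (𝓡 2)).symm))
          (φ.extend (𝓡 2) P.proj)
          (fderiv ℝ (φ.extend (𝓡 2) ∘ ((chartAt Plane P₀.proj).extend (𝓡 2)).symm)
            ((chartAt Plane P₀.proj).extend (𝓡 2) P.proj)
            (chartVec cotangentModel (chartAt (ModelProd Plane (Plane →L[ℝ] ℝ)) P₀) P U).1)
          (EuclideanSpace.single i 1)) := by
  have hκ := IsManifold.chart_mem_maximalAtlas (I := cotangentModel) (n := ∞) P₀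
  have hψ := IsManifold.chart_mem_maximalAtlas (I := 𝓡 2) (n := ∞) P₀.proj
  have hPκ := (mem_chartAt_cotangent_source P₀ P).2 hP'
  have hz := extend_mem_target (I := cotangentModel) hPκ
  set s := φ.extend (𝓡 2) ∘ ((chartAt Plane P₀.proj).extend (𝓡 2)).symm with hs_def
  set r := (chartAt Plane P₀.proj).extend (𝓡 2) ∘ (φ.extend (𝓡 2)).symm
  have hs : ContDiffAt ℝ ∞ s ((chartAt Plane P₀.proj).extend (𝓡 2) P.proj) := by
    refine contDiffAt_comp_extend_symm hψ (extend_mem_target hP') ?_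
    rw [OpenPartialHomeomorph.extend_left_inv _ hP']
    exact OpenPartialHomeomorph.contMDiffAt_extend hφ hP
  have hr : ContDiffAt ℝ ∞ (fderiv ℝ r) (φ.extend (𝓡 2) P.proj) := by
    refine ContDiffAt.fderiv_right (m := ∞) (n := ∞) ?_ (by simp)
    refine contDiffAt_comp_extend_symm hφ (extend_mem_target hP) ?_
    rw [OpenPartialHomeomorph.extend_left_inv _ hP]
    exact OpenPartialHomeomorph.contMDiffAt_extend hψ hP'
  have hsz : s ((chartAt Plane P₀.proj).extend (𝓡 2) P.proj) = φ.extend (𝓡 2) P.proj := by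
    simp only [s, Function.comp_apply]
    rw [OpenPartialHomeomorph.extend_left_inv _ hP']
  rw [← hsz] at hr ⊢
  have h1 : HasFDerivAt (fun x => fderiv ℝ r (s x) (EuclideanSpace.single i 1))
      (((fderiv ℝ (fderiv ℝ r) (s ((chartAt Plane P₀.proj).extend (𝓡 2) P.proj))).comp
        (fderiv ℝ s ((chartAt Plane P₀.proj).extend (𝓡 2) P.proj))).flip
          (EuclideanSpace.single i 1))
      ((chartAt Plane P₀.proj).extend (𝓡 2) P.proj) := by
    refine (((hr.differentiableAt (by simp)).hasFDerivAt.comp _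
      (hs.differentiableAt (by simp)).hasFDerivAt).clm_apply
        (hasFDerivAt_const (EuclideanSpace.single i (1 : ℝ)) _)).congr_fderiv ?_
    ext; simp
  rw [← chartAt_cotangent_extend_fst] at h1 ⊢
  have h2 := LocalCoord.hasFDerivAt_snd_apply_fst h1
  refine (mvfderiv_apply_of_hasFDerivAt (f := coordY φ i) hκ hPκ (h2.congr_of_eventuallyEq ?_)
    U).trans ?_
  · have hcont : ContinuousAt (fun P : Cotangent M => P.proj)
        (((chartAt (ModelProd Plane (Plane →L[ℝ] ℝ)) P₀).extend cotangentModel).symm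
          ((chartAt (ModelProd Plane (Plane →L[ℝ] ℝ)) P₀).extend cotangentModel P)) :=
      (FiberBundle.continuous_proj _ _).continuousAt
    have hcont2 := hcont.comp (contMDiffAt_extend_symm hκ hz).continuousAt
    have hmem : ∀ᶠ z in 𝓝 ((chartAt (ModelProd Plane (Plane →L[ℝ] ℝ)) P₀).extend cotangentModel P),
        (((chartAt (ModelProd Plane (Plane →L[ℝ] ℝ)) P₀).extend cotangentModel).symm z).proj
          ∈ φ.source := by
      refine hcont2.eventually_mem (φ.open_source.mem_nhds ?_)
      simp only [Function.comp_apply]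
      rwa [OpenPartialHomeomorph.extend_left_inv _ hPκ]
    filter_upwards [extend_target_mem_nhds hz, hmem] with z hz hm
    have hz1 := (mem_chartAt_cotangent_extend_target P₀ z).1 hz
    have h3 := chartAt_cotangent_extend_symm_proj P₀ hz1
    have h4 := (mem_chartAt_cotangent_source P₀ _).1 (extend_symm_mem_source hz)
    rw [Function.comp_apply, coordY_apply P₀ hφ hm h4, PartialEquiv.right_inv _ hz, h3]
    rfl
  · exact add_comm _ _

/-- In the coordinates of the cotangent bundle defined by a chart of `M`, the expression of the
deformed Riemannian extension in any other chart of `M` is the coordinate model: the second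
derivatives of the transition map which enter the forms `dy_i` cancel those in the transformation
law of the Christoffel symbols. -/
theorem riemannianExtensionIn_apply
    (nabla : CovariantDerivative (𝓡 2) Plane (TangentSpace (𝓡 2) : M → Type _))
    (Φ : ∀ x : M, TangentSpace (𝓡 2) x →L[ℝ] TangentSpace (𝓡 2) x →L[ℝ] ℝ) (P₀ : Cotangent M)
    {φ : OpenPartialHomeomorph M Plane} (hφ : φ ∈ IsManifold.maximalAtlas (𝓡 2) ∞ M)
    {P : Cotangent M} (hP : P.proj ∈ φ.source) (hP' : P.proj ∈ (chartAt Plane P₀.proj).source)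
    (U V : CotangentTangent P) :
    riemannianExtensionIn nabla Φ φ P U V
      = LocalCoord.extension (christoffelL nabla (chartAt Plane P₀.proj))
          (tensorIn (𝓡 2) Φ (chartAt Plane P₀.proj))
          ((chartAt (ModelProd Plane (Plane →L[ℝ] ℝ)) P₀).extend cotangentModel P)
          (chartVec cotangentModel (chartAt (ModelProd Plane (Plane →L[ℝ] ℝ)) P₀) P U)
          (chartVec cotangentModel (chartAt (ModelProd Plane (Plane →L[ℝ] ℝ)) P₀) P V) := by
  have hψ := IsManifold.chart_mem_maximalAtlas (I := 𝓡 2) (n := ∞) P₀.proj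
  have hlaw := fderiv_christoffel nabla hψ hφ hP' hP
  have hKC := fderiv_transition_comp hψ hφ hP' hP
  have hX := formX_apply P₀ hφ hP hP'
  have hY := formY_apply P₀ hφ hP hP'
  have hy := coordY_apply P₀ hφ hP hP'
  have hpart : ∀ i, partialField φ i P.proj = chartField (𝓡 2) (chartAt Plane P₀.proj)
      (fderiv ℝ ((chartAt Plane P₀.proj).extend (𝓡 2) ∘ (φ.extend (𝓡 2)).symm)
        (φ.extend (𝓡 2) P.proj) (EuclideanSpace.single i 1)) P.proj := fun i => by
    rw [← chartVec_chartField_of_mem hψ hφ hP' hP, chartField_chartVec hψ hP', partialField]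
  have hsymm : ∀ u v, fderiv ℝ (fderiv ℝ ((chartAt Plane P₀.proj).extend (𝓡 2)
      ∘ (φ.extend (𝓡 2)).symm)) (φ.extend (𝓡 2) P.proj) u v
      = fderiv ℝ (fderiv ℝ ((chartAt Plane P₀.proj).extend (𝓡 2)
      ∘ (φ.extend (𝓡 2)).symm)) (φ.extend (𝓡 2) P.proj) v u := by
    intro u v
    have hr : ContDiffAt ℝ ∞ ((chartAt Plane P₀.proj).extend (𝓡 2)
        ∘ (φ.extend (𝓡 2)).symm) (φ.extend (𝓡 2) P.proj) := by
      refine contDiffAt_comp_extend_symm hφ (extend_mem_target hP) ?_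
      rw [OpenPartialHomeomorph.extend_left_inv _ hP]
      exact OpenPartialHomeomorph.contMDiffAt_extend hψ hP'
    refine (hr.isSymmSndFDerivAt ?_).eq u v
    rw [minSmoothness_of_isRCLikeNormedField]
    exact WithTop.coe_le_coe.2 (le_top : (2 : ℕ∞) ≤ ⊤)
  set U' := chartVec cotangentModel (chartAt (ModelProd Plane (Plane →L[ℝ] ℝ)) P₀) P U
  set V' := chartVec cotangentModel (chartAt (ModelProd Plane (Plane →L[ℝ] ℝ)) P₀) P V
  have hφe : φ P.proj = φ.extend (𝓡 2) P.proj := rfl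
  have hz1 := chartAt_cotangent_extend_fst P₀ P
  set z := (chartAt (ModelProd Plane (Plane →L[ℝ] ℝ)) P₀).extend cotangentModel P
  rw [LocalCoord.extension_apply, hz1]
  set K := fderiv ℝ ((chartAt Plane P₀.proj).extend (𝓡 2) ∘ (φ.extend (𝓡 2)).symm)
    (φ.extend (𝓡 2) P.proj)
  set C := fderiv ℝ (φ.extend (𝓡 2) ∘ ((chartAt Plane P₀.proj).extend (𝓡 2)).symm)
    ((chartAt Plane P₀.proj).extend (𝓡 2) P.proj)
  set D := fderiv ℝ (fderiv ℝ ((chartAt Plane P₀.proj).extend (𝓡 2) ∘ (φ.extend (𝓡 2)).symm))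
    (φ.extend (𝓡 2) P.proj)
  set η := z.2
  have hchr : ∀ i j, ∑ k, η (K (EuclideanSpace.single k 1)) * christoffel nabla φ
      (φ.extend (𝓡 2) P.proj) (EuclideanSpace.single i 1) (EuclideanSpace.single j 1) k
      = η (christoffelL nabla (chartAt Plane P₀.proj) ((chartAt Plane P₀.proj).extend (𝓡 2) P.proj)
        (K (EuclideanSpace.single i 1)) (K (EuclideanSpace.single j 1))
        + D (EuclideanSpace.single i 1) (EuclideanSpace.single j 1)) := by
    intro i j
    rw [christoffelL_apply nabla hψ (extend_mem_target hP'), ← hlaw]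
    have h := LocalCoord.dual_plane_apply (η.comp K) (christoffel nabla φ
      (φ.extend (𝓡 2) P.proj) (EuclideanSpace.single i 1) (EuclideanSpace.single j 1))
    simp only [ContinuousLinearMap.comp_apply, smul_eq_mul] at h
    rw [h, Fin.sum_univ_two]
    ring
  have hF : ∀ i j, Φ P.proj (partialField φ i P.proj) (partialField φ j P.proj)
      = tensorIn (𝓡 2) Φ (chartAt Plane P₀.proj) ((chartAt Plane P₀.proj).extend (𝓡 2) P.proj)
        (K (EuclideanSpace.single i 1)) (K (EuclideanSpace.single j 1)) := fun i j => by
    rw [tensorIn_extend_apply Φ hP', hpart, hpart]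
  have key := extension_frame (D := D) K hsymm (Γ := christoffelL nabla (chartAt Plane P₀.proj)
    ((chartAt Plane P₀.proj).extend (𝓡 2) P.proj)) (tensorIn (𝓡 2) Φ (chartAt Plane P₀.proj)
      ((chartAt Plane P₀.proj).extend (𝓡 2) P.proj)) η U'.2 V'.2 (C U'.1) (C V'.1)
  rw [hKC, hKC] at key
  rw [← key, riemannianExtensionIn]
  simp only [add_apply, sum_apply, smul_apply,
    ContinuousLinearMap.smulRight_apply, hX, hY, hy, smul_eq_mul, hφe, hchr, hF]
  rfl

/-- The volume form of a chart of `M`, in the coordinates of the cotangent bundle defined by any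
other chart of `M`. -/
theorem cotangentVolumeIn_apply (P₀ : Cotangent M) {φ : OpenPartialHomeomorph M Plane}
    (hφ : φ ∈ IsManifold.maximalAtlas (𝓡 2) ∞ M) {P : Cotangent M} (hP : P.proj ∈ φ.source)
    (hP' : P.proj ∈ (chartAt Plane P₀.proj).source) (U : Fin 4 → CotangentTangent P)
    (U' : Fin 4 → Plane × (Plane →L[ℝ] ℝ))
    (hU : ∀ i, U' i
      = chartVec cotangentModel (chartAt (ModelProd Plane (Plane →L[ℝ] ℝ)) P₀) P (U i)) :
    cotangentVolumeIn φ P U = (Matrix.of fun i : Fin 4 => ![(U' i).1 0, (U' i).1 1,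
      (U' i).2 (EuclideanSpace.single 0 1), (U' i).2 (EuclideanSpace.single 1 1)]).det := by
  have hψ := IsManifold.chart_mem_maximalAtlas (I := 𝓡 2) (n := ∞) P₀.proj
  have hKC := fderiv_transition_comp hψ hφ hP' hP
  have hX := formX_apply P₀ hφ hP hP'
  have hY := formY_apply P₀ hφ hP hP'
  set z := (chartAt (ModelProd Plane (Plane →L[ℝ] ℝ)) P₀).extend cotangentModel P
  set K := fderiv ℝ ((chartAt Plane P₀.proj).extend (𝓡 2) ∘ (φ.extend (𝓡 2)).symm)
    (φ.extend (𝓡 2) P.proj)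
  set C := fderiv ℝ (φ.extend (𝓡 2) ∘ ((chartAt Plane P₀.proj).extend (𝓡 2)).symm)
    ((chartAt Plane P₀.proj).extend (𝓡 2) P.proj)
  set D := fderiv ℝ (fderiv ℝ ((chartAt Plane P₀.proj).extend (𝓡 2) ∘ (φ.extend (𝓡 2)).symm))
    (φ.extend (𝓡 2) P.proj)
  rw [← det_frame hKC ((ContinuousLinearMap.compL ℝ Plane Plane ℝ z.2).comp (D.comp C)) U']
  have hX' : ∀ a i, formX φ a P (U i) = C (U' i).1 a := fun a i => by rw [hX, ← hU]
  have hY' : ∀ a i, formY φ a P (U i) = (U' i).2 (K (EuclideanSpace.single a 1))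
      + z.2 (D (C (U' i).1) (EuclideanSpace.single a 1)) := fun a i => by rw [hY, ← hU]
  have hM : cotangentVolumeIn φ P U = (Matrix.of fun i : Fin 4 => ![formX φ 0 P (U i),
      formX φ 1 P (U i), formY φ 0 P (U i), formY φ 1 P (U i)]).det := by
    refine congrArg (Matrix.det (n := Fin 4) (R := ℝ)) ?_
    ext i j
    fin_cases j <;> rfl
  rw [hM]
  simp only [hX', hY']
  rfl

end CotangentCharts

/-! ### Dependence on germs -/

namespace LocalCoord

variable {E : Type*} [NormedAddCommGroup E] [NormedSpace ℝ E]

theorem leviCivita_congr {G G' : E → E →L[ℝ] E →L[ℝ] ℝ} {z : E} (h : G =ᶠ[𝓝 z] G') :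
    leviCivita G =ᶠ[𝓝 z] leviCivita G' := by
  filter_upwards [h.eventuallyEq_nhds] with z' hz'
  funext u v
  rw [leviCivita, leviCivita, hz'.fderiv_eq, hz'.eq_of_nhds]

theorem curvature_congr {Γ Γ' : E → E → E → E} {z : E} (h : Γ =ᶠ[𝓝 z] Γ') :
    curvature Γ z = curvature Γ' z := by
  funext u v w
  have h1 : ∀ a b, (fun z' => Γ z' a b) =ᶠ[𝓝 z] fun z' => Γ' z' a b := fun a b => by
    filter_upwards [h] with z' hz'
    rw [hz']
  rw [curvature, curvature, (h1 _ _).fderiv_eq, (h1 _ _).fderiv_eq, h.eq_of_nhds]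

theorem ricci_congr [FiniteDimensional ℝ E] {Γ Γ' : E → E → E → E} {z : E} (h : Γ =ᶠ[𝓝 z] Γ') :
    ricci Γ z = ricci Γ' z := by
  funext u v
  rw [ricci, ricci, curvature_congr h]

theorem hessian_congr {Γ Γ' : E → E → E → E} {f f' : E → ℝ} {z : E} (h : Γ =ᶠ[𝓝 z] Γ')
    (hf : f =ᶠ[𝓝 z] f') : hessian Γ f z = hessian Γ' f' z := by
  funext u v
  have h1 : (fun z' => fderiv ℝ f z' v) =ᶠ[𝓝 z] fun z' => fderiv ℝ f' z' v := by
    filter_upwards [hf.eventuallyEq_nhds] with z' hz'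
    rw [hz'.fderiv_eq]
  rw [hessian, hessian, h1.fderiv_eq, hf.fderiv_eq, h.eq_of_nhds]

theorem weyl4_congr [FiniteDimensional ℝ E] {G G' : E → E →L[ℝ] E →L[ℝ] ℝ} {z : E}
    (h : G =ᶠ[𝓝 z] G') : weyl4 G z = weyl4 G' z := by
  funext x y v w
  rw [weyl4, weyl4, curvature_congr (leviCivita_congr h), ricci_congr (leviCivita_congr h),
    h.eq_of_nhds]

/-! ### The exponential substitution -/

theorem hessian_exp (Γ : E → E → E → E) {h : E → ℝ} {z : E} (hh : ContDiffAt ℝ ∞ h z) (c : ℝ)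
    (u v : E) : hessian Γ (fun x => Real.exp (c * h x)) z u v
      = Real.exp (c * h z)
        * (c * hessian Γ h z u v + c ^ 2 * (fderiv ℝ h z u * fderiv ℝ h z v)) := by
  have hd : ∀ᶠ x in 𝓝 z, fderiv ℝ (fun x => Real.exp (c * h x)) x
      = (Real.exp (c * h x) * c) • fderiv ℝ h x := by
    filter_upwards [(hh.of_le (m := 1) (by simp)).eventually (by simp)] with x hx
    have h1 := ((hx.differentiableAt (by simp)).hasFDerivAt.const_mul c).exp.fderiv
    rw [h1, smul_smul]
  have h1 : (fun x => fderiv ℝ (fun x => Real.exp (c * h x)) x v)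
      =ᶠ[𝓝 z] fun x => Real.exp (c * h x) * c * fderiv ℝ h x v := by
    filter_upwards [hd] with x hx
    rw [hx]; rfl
  have h2 : HasFDerivAt h (fderiv ℝ h z) z := (hh.differentiableAt (by simp)).hasFDerivAt
  have h3 : DifferentiableAt ℝ (fun x => fderiv ℝ h x v) z :=
    ((hh.fderiv_right (m := ∞) (by simp)).differentiableAt (by simp)).clm_apply
      (differentiableAt_const v)
  have h4 := ((h2.const_mul c).exp.mul_const c).mul h3.hasFDerivAt
  rw [hessian, h1.fderiv_eq, hd.self_of_nhds, hessian]
  rw [show fderiv ℝ (fun x => Real.exp (c * h x) * c * fderiv ℝ h x v) z = _ from h4.fderiv]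
  simp only [add_apply, smul_apply, smul_eq_mul]
  ring

end LocalCoord

section Affine

variable {E : Type*} [NormedAddCommGroup E] [NormedSpace ℝ E]
  {H : Type*} [TopologicalSpace H] {I : ModelWithCorners ℝ E H} [I.Boundaryless]
  {N : Type*} [TopologicalSpace N] [ChartedSpace H N] [IsManifold I ∞ N]
  (nabla : CovariantDerivative I E (TangentSpace I : N → Type _))

theorem affineHessian_exp {f : N → ℝ} (hf : ContMDiff I 𝓘(ℝ, ℝ) ∞ f) (c : ℝ) (q : N)
    (u v : TangentSpace I q) :
    affineHessian nabla (fun x => Real.exp (c * f x)) q u v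
      = Real.exp (c * f q)
        * (c * affineHessian nabla f q u v + c ^ 2 * (mvfderiv I f q u * mvfderiv I f q v)) := by
  have hφ := IsManifold.chart_mem_maximalAtlas (I := I) (n := ∞) q
  have hq := mem_chart_source H q
  have h1 := contDiffAt_comp_extend_symm hφ (extend_mem_target hq) (f := f) hf.contMDiffAt
  have h2 := LocalCoord.hessian_exp (christoffel nabla (chartAt H q)) h1 c
    (chartVec I (chartAt H q) q u) (chartVec I (chartAt H q) q v)
  have hfd := mvfderiv_eq_fderiv hφ hq (hf.mdifferentiableAt (by simp))
  rw [hfd, hfd]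
  simp only [Function.comp_apply, (chartAt H q).extend_left_inv hq] at h2
  exact h2

variable [FiniteDimensional ℝ E]

/-- The substitution `h = exp (-μ f / 2)` linearizes the equation for `f`. -/
theorem exp_mem_quasiEinsteinSpace_iff {μ : ℝ} (hμ : μ ≠ 0) {f : N → ℝ}
    (hf : ContMDiff I 𝓘(ℝ, ℝ) ∞ f) :
    (fun x => Real.exp (-(1 / 2) * μ * f x)) ∈ quasiEinsteinSpace μ nabla ↔
      SolvesNonlinearEquation μ nabla f := by
  have hexp : ContMDiff I 𝓘(ℝ, ℝ) ∞ fun x => Real.exp (-(1 / 2) * μ * f x) :=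
    (Real.contDiff_exp.comp (contDiff_const.mul contDiff_id)).contMDiff.comp hf
  refine (and_iff_right hexp).trans (Iff.trans ?_ (and_iff_right hf).symm)
  refine forall_congr' fun q => forall_congr' fun u => forall_congr' fun v => ?_
  rw [affineHessian_exp nabla hf]
  have h1 : μ * Real.exp (-(1 / 2) * μ * f q) ≠ 0 := mul_ne_zero hμ (Real.exp_pos _).ne'
  constructor
  · intro h
    refine (mul_eq_zero.1 (?_ : μ * Real.exp (-(1 / 2) * μ * f q) * _ = 0)).resolve_left h1
    linear_combination (-2) * h
  · intro h
    linear_combination (-1 / 2 * μ * Real.exp (-(1 / 2) * μ * f q)) * h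

end Affine

/-! ### Independence of the chart and orientation -/

section RiemannianExtension

variable {M : Type*} [TopologicalSpace M] [ChartedSpace Plane M] [IsManifold (𝓡 2) ∞ M]

section

variable (nabla : CovariantDerivative (𝓡 2) Plane (TangentSpace (𝓡 2) : M → Type _))
  (Φ : ∀ x : M, TangentSpace (𝓡 2) x →L[ℝ] TangentSpace (𝓡 2) x →L[ℝ] ℝ)

theorem riemannianExtension_apply (P₀ : Cotangent M) {P : Cotangent M}
    (hP' : P.proj ∈ (chartAt Plane P₀.proj).source) (U V : CotangentTangent P) :
    riemannianExtension nabla Φ P U V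
      = LocalCoord.extension (christoffelL nabla (chartAt Plane P₀.proj))
          (tensorIn (𝓡 2) Φ (chartAt Plane P₀.proj))
          ((chartAt (ModelProd Plane (Plane →L[ℝ] ℝ)) P₀).extend cotangentModel P)
          (chartVec cotangentModel (chartAt (ModelProd Plane (Plane →L[ℝ] ℝ)) P₀) P U)
          (chartVec cotangentModel (chartAt (ModelProd Plane (Plane →L[ℝ] ℝ)) P₀) P V) :=
  riemannianExtensionIn_apply nabla Φ P₀ (IsManifold.chart_mem_maximalAtlas _)
    (mem_chart_source _ _) hP' U V

theorem riemannianExtension_eq_riemannianExtensionIn {φ : OpenPartialHomeomorph M Plane}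
    (hφ : φ ∈ IsManifold.maximalAtlas (𝓡 2) ∞ M) {P : Cotangent M} (hP : P.proj ∈ φ.source) :
    riemannianExtension nabla Φ P = riemannianExtensionIn nabla Φ φ P := by
  ext U V
  rw [riemannianExtension_apply nabla Φ P (mem_chart_source _ _),
    riemannianExtensionIn_apply nabla Φ P hφ hP (mem_chart_source _ _)]

/-- In the charts of the cotangent bundle the metric is the coordinate model. -/
theorem tensorIn_riemannianExtension (P₀ : Cotangent M) {z : Plane × (Plane →L[ℝ] ℝ)}
    (hz : z.1 ∈ ((chartAt Plane P₀.proj).extend (𝓡 2)).target) :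
    tensorIn cotangentModel (riemannianExtension nabla Φ)
        (chartAt (ModelProd Plane (Plane →L[ℝ] ℝ)) P₀) z
      = LocalCoord.extension (christoffelL nabla (chartAt Plane P₀.proj))
          (tensorIn (𝓡 2) Φ (chartAt Plane P₀.proj)) z := by
  have hκ := IsManifold.chart_mem_maximalAtlas (I := cotangentModel) (n := ∞) P₀
  have hz' := (mem_chartAt_cotangent_extend_target P₀ z).2 hz
  have hP := extend_symm_mem_source hz'
  refine ContinuousLinearMap.ext fun U => ContinuousLinearMap.ext fun V => ?_
  rw [tensorIn_apply, riemannianExtension_apply nabla Φ P₀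
    ((mem_chartAt_cotangent_source P₀ _).1 hP), chartVec_chartField hκ hP,
    chartVec_chartField hκ hP, PartialEquiv.right_inv _ hz']

theorem tensorIn_riemannianExtension_eventuallyEq (P : Cotangent M) :
    tensorIn cotangentModel (riemannianExtension nabla Φ)
        (chartAt (ModelProd Plane (Plane →L[ℝ] ℝ)) P)
      =ᶠ[𝓝 (extChartAt cotangentModel P P)]
        LocalCoord.extension (christoffelL nabla (chartAt Plane P.proj))
          (tensorIn (𝓡 2) Φ (chartAt Plane P.proj)) := by
  filter_upwards [extChartAt_target_mem_nhds (I := cotangentModel) P] with z hz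
  exact tensorIn_riemannianExtension nabla Φ P ((mem_chartAt_cotangent_extend_target P z).1 hz)

end

theorem cotangentVolume_eq_cotangentVolumeIn {φ : OpenPartialHomeomorph M Plane}
    (hφ : φ ∈ IsManifold.maximalAtlas (𝓡 2) ∞ M) {P : Cotangent M} (hP : P.proj ∈ φ.source) :
    (cotangentVolume P : CotangentTangent P [⋀^Fin 4]→ₗ[ℝ] ℝ) = cotangentVolumeIn φ P := by
  ext U
  rw [cotangentVolumeIn_apply P hφ hP (mem_chart_source _ _) U _ fun _ => rfl]
  exact cotangentVolumeIn_apply P (IsManifold.chart_mem_maximalAtlas _) (mem_chart_source _ _)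
    (mem_chart_source _ _) U _ fun _ => rfl

theorem cotangentVolume_apply (P₀ : Cotangent M) {P : Cotangent M}
    (hP' : P.proj ∈ (chartAt Plane P₀.proj).source) (U : Fin 4 → CotangentTangent P)
    (U' : Fin 4 → Plane × (Plane →L[ℝ] ℝ))
    (hU : ∀ i, U' i
      = chartVec cotangentModel (chartAt (ModelProd Plane (Plane →L[ℝ] ℝ)) P₀) P (U i)) :
    (cotangentVolume P : CotangentTangent P [⋀^Fin 4]→ₗ[ℝ] ℝ) U
      = (Matrix.of fun i : Fin 4 => ![(U' i).1 0, (U' i).1 1,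
      (U' i).2 (EuclideanSpace.single 0 1), (U' i).2 (EuclideanSpace.single 1 1)]).det :=
  cotangentVolumeIn_apply P₀ (IsManifold.chart_mem_maximalAtlas _) (mem_chart_source _ _) hP' U U'
    hU

theorem finrank_plane_prod_dual : Module.finrank ℝ (Plane × (Plane →L[ℝ] ℝ)) = 4 := by
  rw [Module.finrank_prod, ← (LinearMap.toContinuousLinearMap (𝕜 := ℝ) (E := Plane)
    (F' := ℝ)).finrank_eq, Module.finrank_linearMap]
  simp

theorem isOrientationForm_cotangentVolume :
    IsOrientationForm cotangentModel (cotangentVolume (M := M)) := by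
  refine ⟨finrank_plane_prod_dual, fun P h => ?_, fun P₀ b => ?_⟩
  · have hκ := IsManifold.chart_mem_maximalAtlas (I := cotangentModel) (n := ∞) P
    let b : Fin 4 → Plane × (Plane →L[ℝ] ℝ) := ![(EuclideanSpace.single 0 1, 0),
      (EuclideanSpace.single 1 1, 0), (0, EuclideanSpace.proj 0), (0, EuclideanSpace.proj 1)]
    have h1 := cotangentVolume_apply P (P := P) (mem_chart_source _ _)
      (fun i => chartField cotangentModel (chartAt (ModelProd Plane (Plane →L[ℝ] ℝ)) P) (b i) P) b
      fun i => (chartVec_chartField hκ (mem_chart_source _ _) _).symm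
    rw [h] at h1
    have h2 : (Matrix.of fun i : Fin 4 => ![(b i).1 0, (b i).1 1,
        (b i).2 (EuclideanSpace.single 0 1), (b i).2 (EuclideanSpace.single 1 1)]) = 1 := by
      ext i j
      fin_cases i <;> fin_cases j <;> simp [b]
    rw [h2, Matrix.det_one] at h1
    exact zero_ne_one h1
  · have hκ := IsManifold.chart_mem_maximalAtlas (I := cotangentModel) (n := ∞) P₀
    refine continuousOn_const.congr fun P hP => cotangentVolume_apply P₀
      ((mem_chartAt_cotangent_source P₀ P).1 hP) _ b fun i => (chartVec_chartField hκ hP _).symm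

end RiemannianExtension

/-! ### The geometry of the extension -/

section Geometry

theorem tensorIn_symm {E : Type*} [NormedAddCommGroup E] [NormedSpace ℝ E] {H : Type*}
    [TopologicalSpace H] {I : ModelWithCorners ℝ E H} {N : Type*} [TopologicalSpace N]
    [ChartedSpace H N] {g : ∀ q : N, TangentSpace I q →L[ℝ] TangentSpace I q →L[ℝ] ℝ}
    (hg : ∀ (q : N) (u v : TangentSpace I q), g q u v = g q v u) (φ : OpenPartialHomeomorph N H)
    (z u v : E) : tensorIn I g φ z u v = tensorIn I g φ z v u := by
  rw [tensorIn_apply, tensorIn_apply, hg]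

variable {M : Type*} [TopologicalSpace M] [ChartedSpace Plane M] [IsManifold (𝓡 2) ∞ M]
  {nabla : CovariantDerivative (𝓡 2) Plane (TangentSpace (𝓡 2) : M → Type _)}
  {Φ : ∀ x : M, TangentSpace (𝓡 2) x →L[ℝ] TangentSpace (𝓡 2) x →L[ℝ] ℝ}

theorem riemannianExtension_nondegenerate (P : Cotangent M) (U : CotangentTangent P)
    (h : ∀ V, riemannianExtension nabla Φ P U V = 0) : U = 0 := by
  have hκ := IsManifold.chart_mem_maximalAtlas (I := cotangentModel) (n := ∞) P
  have hP := mem_chart_source (ModelProd Plane (Plane →L[ℝ] ℝ)) P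
  have h1 := LocalCoord.eq_zero_of_extension_eq_zero
    (Γ := christoffelL nabla (chartAt Plane P.proj))
    (Φ := tensorIn (𝓡 2) Φ (chartAt Plane P.proj))
    ((chartAt (ModelProd Plane (Plane →L[ℝ] ℝ)) P).extend cotangentModel P)
    (chartVec cotangentModel (chartAt (ModelProd Plane (Plane →L[ℝ] ℝ)) P) P U) fun W => by
      have h2 := h (chartField cotangentModel (chartAt (ModelProd Plane (Plane →L[ℝ] ℝ)) P) W P)
      rwa [riemannianExtension_apply nabla Φ P (mem_chart_source _ _),
        chartVec_chartField hκ hP] at h2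
  rw [← chartField_chartVec hκ hP U, h1, chartField_eq, map_zero]

theorem isPseudoRiemannianMetric_riemannianExtension [T2Space M]
    [CovariantDerivative.ContMDiffCovariantDerivative nabla ∞] (htorsion : nabla.torsion = 0)
    (hΦ : IsSmoothTensor (𝓡 2) Φ)
    (hΦsymm : ∀ (x : M) (u v : TangentSpace (𝓡 2) x), Φ x u v = Φ x v u) :
    IsPseudoRiemannianMetric cotangentModel (riemannianExtension nabla Φ) where
  smooth := by
    refine isSmoothTensor_iff.2 fun P => ContDiffOn.congr (f := LocalCoord.extension _ _) ?_
      fun z hz => tensorIn_riemannianExtension nabla Φ P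
        ((mem_chartAt_cotangent_extend_target P z).1 hz)
    exact (LocalCoord.contDiffOn_extension (contDiffOn_christoffelL nabla P.proj)
      (isSmoothTensor_iff.1 hΦ P.proj)).mono fun z hz =>
        (mem_chartAt_cotangent_extend_target P z).1 hz
  symm P U V := by
    have hψ := IsManifold.chart_mem_maximalAtlas (I := 𝓡 2) (n := ∞) P.proj
    have hz : ((chartAt (ModelProd Plane (Plane →L[ℝ] ℝ)) P).extend cotangentModel P).1
        ∈ ((chartAt Plane P.proj).extend (𝓡 2)).target := by
      rw [chartAt_cotangent_extend_fst]
      exact extend_mem_target (mem_chart_source _ _)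
    rw [riemannianExtension_apply nabla Φ P (mem_chart_source _ _),
      riemannianExtension_apply nabla Φ P (mem_chart_source _ _)]
    refine LocalCoord.extension_symm (fun u v => ?_) (fun u v => tensorIn_symm hΦsymm _ _ u v) _ _
    rw [christoffelL_apply nabla hψ hz, christoffelL_apply nabla hψ hz,
      christoffel_symm nabla htorsion hψ hz]
  nondegenerate := riemannianExtension_nondegenerate

theorem chartAt_cotangent_extend_fst_mem (P : Cotangent M) :
    ((chartAt (ModelProd Plane (Plane →L[ℝ] ℝ)) P).extend cotangentModel P).1
      ∈ ((chartAt Plane P.proj).extend (𝓡 2)).target := by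
  rw [chartAt_cotangent_extend_fst]
  exact extend_mem_target (mem_chart_source _ _)

theorem mvfderiv_comp_proj {f : M → ℝ} (hf : ContMDiff (𝓡 2) 𝓘(ℝ, ℝ) ∞ f) (P : Cotangent M)
    (U : CotangentTangent P) :
    mvfderiv cotangentModel (fun P : Cotangent M => f P.proj) P U
      = fderiv ℝ (f ∘ ((chartAt Plane P.proj).extend (𝓡 2)).symm)
        ((chartAt Plane P.proj).extend (𝓡 2) P.proj)
        (chartVec cotangentModel (chartAt (ModelProd Plane (Plane →L[ℝ] ℝ)) P) P U).1 := by
  have hκ := IsManifold.chart_mem_maximalAtlas (I := cotangentModel) (n := ∞) P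
  have hψ := IsManifold.chart_mem_maximalAtlas (I := 𝓡 2) (n := ∞) P.proj
  have hP := mem_chart_source (ModelProd Plane (Plane →L[ℝ] ℝ)) P
  have h1 := ((contDiffAt_comp_extend_symm hψ (chartAt_cotangent_extend_fst_mem P)
    (f := f) hf.contMDiffAt).differentiableAt (by simp)).hasFDerivAt
  rw [← chartAt_cotangent_extend_fst]
  refine (mvfderiv_apply_of_hasFDerivAt hκ hP
    ((h1.comp _ hasFDerivAt_fst).congr_of_eventuallyEq ?_) U).trans rfl
  filter_upwards [extend_target_mem_nhds (extend_mem_target hP)] with z hz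
  simp only [Function.comp_apply]
  rw [chartAt_cotangent_extend_symm_proj P ((mem_chartAt_cotangent_extend_target P z).1 hz)]

/-- Hessian and Ricci tensor of the extension are the pull-backs of `ℋ_∇ f` and `2 ρ_{s,∇}`, so the
quasi-Einstein equation is the pull-back of the equation for `f`. -/
theorem isQuasiEinstein_riemannianExtension [T2Space M]
    [CovariantDerivative.ContMDiffCovariantDerivative nabla ∞] (htorsion : nabla.torsion = 0)
    (hΦ : IsSmoothTensor (𝓡 2) Φ)
    (hΦsymm : ∀ (x : M) (u v : TangentSpace (𝓡 2) x), Φ x u v = Φ x v u) {μ : ℝ} {f : M → ℝ}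
    (hf : SolvesNonlinearEquation μ nabla f) :
    IsQuasiEinstein cotangentModel (riemannianExtension nabla Φ)
      (fun P : Cotangent M => f P.proj) (μ / 2) 0 where
  metric := isPseudoRiemannianMetric_riemannianExtension htorsion hΦ hΦsymm
  smooth := hf.1.comp (Bundle.contMDiff_proj _)
  equation P U V := by
    have hκ := IsManifold.chart_mem_maximalAtlas (I := cotangentModel) (n := ∞) P
    have hψ := IsManifold.chart_mem_maximalAtlas (I := 𝓡 2) (n := ∞) P.proj
    have hP := mem_chart_source (ModelProd Plane (Plane →L[ℝ] ℝ)) P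
    have hp := mem_chart_source Plane P.proj
    have hz := chartAt_cotangent_extend_fst_mem P
    have hO := ((chartAt Plane P.proj).isOpen_extend_target (I := 𝓡 2))
    have hΓ := contDiffOn_christoffelL nabla P.proj
    have hΦ' := isSmoothTensor_iff.1 hΦ P.proj
    have hΓs : ∀ x ∈ ((chartAt Plane P.proj).extend (𝓡 2)).target, ∀ u v,
        christoffelL nabla (chartAt Plane P.proj) x u v
          = christoffelL nabla (chartAt Plane P.proj) x v u := fun x hx u v => by
      rw [christoffelL_apply nabla hψ hx, christoffelL_apply nabla hψ hx,
        christoffel_symm nabla htorsion hψ hx]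
    have hLC := LocalCoord.leviCivita_congr (tensorIn_riemannianExtension_eventuallyEq nabla Φ P)
    have hchr : (fun x u v => christoffelL nabla (chartAt Plane P.proj) x u v)
        =ᶠ[𝓝 ((chartAt Plane P.proj).extend (𝓡 2) P.proj)]
          christoffel nabla (chartAt Plane P.proj) := by
      filter_upwards [extend_target_mem_nhds (extend_mem_target hp)] with x hx
      funext u v
      exact christoffelL_apply nabla hψ hx u v
    have hF : (fun P : Cotangent M => f P.proj) ∘ (extChartAt cotangentModel P).symm
        =ᶠ[𝓝 (extChartAt cotangentModel P P)]
          fun z => (f ∘ ((chartAt Plane P.proj).extend (𝓡 2)).symm) z.1 := by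
      filter_upwards [extChartAt_target_mem_nhds (I := cotangentModel) P] with z hz
      exact congrArg f (chartAt_cotangent_extend_symm_proj P
        ((mem_chartAt_cotangent_extend_target P z).1 hz))
    have hf' : ContDiffOn ℝ ∞ (f ∘ ((chartAt Plane P.proj).extend (𝓡 2)).symm)
        ((chartAt Plane P.proj).extend (𝓡 2)).target := fun x hx =>
      (contDiffAt_comp_extend_symm hψ hx hf.1.contMDiffAt).contDiffWithinAt
    set U' := chartVec cotangentModel (chartAt (ModelProd Plane (Plane →L[ℝ] ℝ)) P) P U with hU'
    set V' := chartVec cotangentModel (chartAt (ModelProd Plane (Plane →L[ℝ] ℝ)) P) P V with hV'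
    -- The projections of `U` and `V` to the surface.
    have hu := chartVec_chartField hψ hp U'.1
    have hv := chartVec_chartField hψ hp V'.1
    have hfd := mvfderiv_eq_fderiv hψ hp (hf.1.mdifferentiableAt (by simp))
    have heq : LocalCoord.hessian (christoffel nabla (chartAt Plane P.proj))
          (f ∘ ((chartAt Plane P.proj).extend (𝓡 2)).symm)
          ((chartAt Plane P.proj).extend (𝓡 2) P.proj) U'.1 V'.1
        + 2 * (1 / 2 * (LocalCoord.ricci (christoffel nabla (chartAt Plane P.proj))
            ((chartAt Plane P.proj).extend (𝓡 2) P.proj) U'.1 V'.1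
          + LocalCoord.ricci (christoffel nabla (chartAt Plane P.proj))
            ((chartAt Plane P.proj).extend (𝓡 2) P.proj) V'.1 U'.1))
        - 1 / 2 * μ * (fderiv ℝ (f ∘ ((chartAt Plane P.proj).extend (𝓡 2)).symm)
            ((chartAt Plane P.proj).extend (𝓡 2) P.proj) U'.1
          * fderiv ℝ (f ∘ ((chartAt Plane P.proj).extend (𝓡 2)).symm)
            ((chartAt Plane P.proj).extend (𝓡 2) P.proj) V'.1) = 0 := by
      have h := hf.2 P.proj (chartField (𝓡 2) (chartAt Plane P.proj) U'.1 P.proj)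
        (chartField (𝓡 2) (chartAt Plane P.proj) V'.1 P.proj)
      rw [hfd, hfd, affineRicciSymm, affineRicci, affineRicci, affineHessian, hu, hv] at h
      exact h
    have h1 : metricHessian cotangentModel (riemannianExtension nabla Φ)
        (fun P : Cotangent M => f P.proj) P U V
        = LocalCoord.hessian (christoffel nabla (chartAt Plane P.proj))
          (f ∘ ((chartAt Plane P.proj).extend (𝓡 2)).symm)
          ((chartAt Plane P.proj).extend (𝓡 2) P.proj) U'.1 V'.1 := by
      rw [metricHessian, LocalCoord.hessian_congr hLC hF, ← hU', ← hV',
        ← LocalCoord.hessian_congr hchr Filter.EventuallyEq.rfl, ← chartAt_cotangent_extend_fst]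
      exact LocalCoord.hessian_extension hO hΓ hΦ' hf' hz U' V'
    have h2 : metricRicci cotangentModel (riemannianExtension nabla Φ) P U V
        = LocalCoord.ricci (christoffel nabla (chartAt Plane P.proj))
          ((chartAt Plane P.proj).extend (𝓡 2) P.proj) U'.1 V'.1
        + LocalCoord.ricci (christoffel nabla (chartAt Plane P.proj))
          ((chartAt Plane P.proj).extend (𝓡 2) P.proj) V'.1 U'.1 := by
      rw [metricRicci, LocalCoord.ricci_congr hLC, ← hU', ← hV',
        ← LocalCoord.ricci_congr hchr, ← chartAt_cotangent_extend_fst]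
      exact LocalCoord.ricci_extension hO hΓ hΦ' hΓs hz U' V'
    rw [h1, h2, mvfderiv_comp_proj hf.1, mvfderiv_comp_proj hf.1, ← hU', ← hV', zero_mul]
    linear_combination heq

/-- The differential of a function pulled back from the surface vanishes on vertical vectors, and
its gradient is vertical. -/
theorem isIsotropic_riemannianExtension {f : M → ℝ} (hf : ContMDiff (𝓡 2) 𝓘(ℝ, ℝ) ∞ f) :
    IsIsotropic cotangentModel (riemannianExtension nabla Φ)
      (fun P : Cotangent M => f P.proj) := by
  intro P
  have hκ := IsManifold.chart_mem_maximalAtlas (I := cotangentModel) (n := ∞) P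
  have hP := mem_chart_source (ModelProd Plane (Plane →L[ℝ] ℝ)) P
  -- The gradient is the vertical vector defined by the differential of `f`.
  have h1 : (riemannianExtension nabla Φ P).inverse
      (mvfderiv cotangentModel (fun P : Cotangent M => f P.proj) P)
      = chartField cotangentModel (chartAt (ModelProd Plane (Plane →L[ℝ] ℝ)) P)
        (0, fderiv ℝ (f ∘ ((chartAt Plane P.proj).extend (𝓡 2)).symm)
        ((chartAt Plane P.proj).extend (𝓡 2) P.proj)) P := by
    have : FiniteDimensional ℝ (TangentSpace cotangentModel P) :=
      inferInstanceAs (FiniteDimensional ℝ (Plane × (Plane →L[ℝ] ℝ)))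
    have : T2Space (TangentSpace cotangentModel P) :=
      inferInstanceAs (T2Space (Plane × (Plane →L[ℝ] ℝ)))
    rw [(isInvertible_of_nondegenerate _
      (riemannianExtension_nondegenerate P)).inverse_apply_eq]
    ext V
    rw [mvfderiv_comp_proj hf, riemannianExtension_apply nabla Φ P (mem_chart_source _ _),
      chartVec_chartField hκ hP, LocalCoord.extension_apply]
    simp
  rw [h1, mvfderiv_comp_proj hf, chartVec_chartField hκ hP]
  simp

/-- Four vectors with Gram matrix `diag(1, 1, -1, -1)` are linearly independent. -/
theorem linearIndependent_of_gram {F : Type*} [AddCommGroup F] [Module ℝ F] (B : F →ₗ[ℝ] F →ₗ[ℝ] ℝ)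
    (e : Fin 4 → F)
    (h : ∀ i j, B (e i) (e j) = if i = j then (![1, 1, -1, -1] : Fin 4 → ℝ) i else 0) :
    LinearIndependent ℝ e := by
  refine Fintype.linearIndependent_iff.2 fun c hc j => ?_
  have h1 := congrArg (fun u => B u (e j)) hc
  simp only [map_sum, map_smul, LinearMap.sum_apply, LinearMap.smul_apply, h, map_zero,
    LinearMap.zero_apply, smul_eq_mul, mul_ite, mul_zero, Finset.sum_ite_eq', Finset.mem_univ,
    if_true] at h1
  refine (mul_eq_zero.1 h1).resolve_right ?_
  fin_cases j <;> simp

/-- A pseudo-orthonormal frame obtained from two hyperbolic pairs. -/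
theorem gram_of_hyperbolic {F : Type*} [AddCommGroup F] [Module ℝ F] (B : F →ₗ[ℝ] F →ₗ[ℝ] ℝ)
    (f h : Fin 2 → F) (hff : ∀ i j, B (f i) (f j) = 0)
    (hfh : ∀ i j, B (f i) (h j) = if i = j then 1 else 0)
    (hhf : ∀ i j, B (h i) (f j) = if i = j then 1 else 0) (hhh : ∀ i j, B (h i) (h j) = 0)
    (i j : Fin 4) :
    B ((![f 0 + (1 / 2 : ℝ) • h 0, f 1 + (1 / 2 : ℝ) • h 1, f 0 - (1 / 2 : ℝ) • h 0,
        f 1 - (1 / 2 : ℝ) • h 1] : Fin 4 → F) i)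
      ((![f 0 + (1 / 2 : ℝ) • h 0, f 1 + (1 / 2 : ℝ) • h 1, f 0 - (1 / 2 : ℝ) • h 0,
        f 1 - (1 / 2 : ℝ) • h 1] : Fin 4 → F) j)
      = if i = j then (![1, 1, -1, -1] : Fin 4 → ℝ) i else 0 := by
  fin_cases i <;> fin_cases j <;> simp [hff, hfh, hhf, hhh] <;> norm_num

theorem hasSignature22_riemannianExtension (htorsion : nabla.torsion = 0)
    (hΦsymm : ∀ (x : M) (u v : TangentSpace (𝓡 2) x), Φ x u v = Φ x v u) :
    HasSignature22 cotangentModel (riemannianExtension nabla Φ) := by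
  intro P
  have hκ := IsManifold.chart_mem_maximalAtlas (I := cotangentModel) (n := ∞) P
  have hψ := IsManifold.chart_mem_maximalAtlas (I := 𝓡 2) (n := ∞) P.proj
  have hP := mem_chart_source (ModelProd Plane (Plane →L[ℝ] ℝ)) P
  have hz := chartAt_cotangent_extend_fst_mem P
  set Γ := christoffelL nabla (chartAt Plane P.proj) with hΓ
  set F := tensorIn (𝓡 2) Φ (chartAt Plane P.proj) with hF
  set z := (chartAt (ModelProd Plane (Plane →L[ℝ] ℝ)) P).extend cotangentModel P
  have hΓs : ∀ u v, Γ z.1 u v = Γ z.1 v u := fun u v => by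
    rw [hΓ, christoffelL_apply nabla hψ hz, christoffelL_apply nabla hψ hz,
      christoffel_symm nabla htorsion hψ hz]
  have hFs : ∀ u v, F z.1 u v = F z.1 v u := tensorIn_symm hΦsymm _ _
  -- Null vectors with prescribed horizontal part, dual to the vertical vectors.
  let f : Fin 2 → Plane × (Plane →L[ℝ] ℝ) := fun i => (EuclideanSpace.single i 1,
    z.2.comp (Γ z.1 (EuclideanSpace.single i 1)) - (1 / 2 : ℝ) • F z.1 (EuclideanSpace.single i 1))
  let h : Fin 2 → Plane × (Plane →L[ℝ] ℝ) := fun i => (0, EuclideanSpace.proj i)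
  have hff : ∀ i j, LocalCoord.extension Γ F z (f i) (f j) = 0 := fun i j => by
    rw [LocalCoord.extension_apply]
    simp only [f, sub_apply, smul_apply, ContinuousLinearMap.comp_apply, smul_eq_mul]
    rw [hΓs (EuclideanSpace.single j 1), hFs (EuclideanSpace.single j 1)]
    ring
  have hfh : ∀ i j, LocalCoord.extension Γ F z (f i) (h j) = if i = j then 1 else 0 := fun i j => by
    rw [LocalCoord.extension_apply]
    simp [f, h, eq_comm]
  have hhf : ∀ i j, LocalCoord.extension Γ F z (h i) (f j) = if i = j then 1 else 0 := fun i j => by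
    rw [LocalCoord.extension_apply]
    simp [f, h]
  have hhh : ∀ i j, LocalCoord.extension Γ F z (h i) (h j) = 0 := fun i j => by
    rw [LocalCoord.extension_apply]
    simp [h]
  let e' : Fin 4 → Plane × (Plane →L[ℝ] ℝ) := ![f 0 + (1 / 2 : ℝ) • h 0, f 1 + (1 / 2 : ℝ) • h 1,
    f 0 - (1 / 2 : ℝ) • h 0, f 1 - (1 / 2 : ℝ) • h 1]
  have he' : ∀ i j, LocalCoord.extension Γ F z (e' i) (e' j)
      = if i = j then (![1, 1, -1, -1] : Fin 4 → ℝ) i else 0 := by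
    exact gram_of_hyperbolic (LinearMap.mk₂ ℝ (fun u v => LocalCoord.extension Γ F z u v)
      (by simp) (by simp) (by simp) (by simp)) f h hff hfh hhf hhh
  let e : Fin 4 → TangentSpace cotangentModel P := fun i =>
    chartField cotangentModel (chartAt (ModelProd Plane (Plane →L[ℝ] ℝ)) P) (e' i) P
  have he : IsFrame22 cotangentModel (riemannianExtension nabla Φ) P e := fun i j => by
    rw [riemannianExtension_apply nabla Φ P (mem_chart_source _ _), chartVec_chartField hκ hP,
      chartVec_chartField hκ hP]
    exact he' i j
  have hli : LinearIndependent ℝ e := linearIndependent_of_gram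
    (LinearMap.mk₂ ℝ (fun u v => riemannianExtension nabla Φ P u v) (by simp) (by simp) (by simp)
      (by simp)) e he
  have hcard : Fintype.card (Fin 4) = Module.finrank ℝ (TangentSpace cotangentModel P) :=
    finrank_plane_prod_dual.symm
  refine ⟨basisOfLinearIndependentOfCardEqFinrank hli hcard, ?_⟩
  rwa [coe_basisOfLinearIndependentOfCardEqFinrank]

/-- The vertical planes of the projection `T*M → M`. -/
noncomputable def verticalPlane (P : Cotangent M) : Submodule ℝ (CotangentTangent P) :=
  ⨅ i, LinearMap.ker (formX (chartAt Plane P.proj) i P).toLinearMap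

/-- In every chart of the cotangent bundle the vertical plane is given by the vanishing of the
horizontal coordinates. -/
theorem mem_verticalPlane (P₀ : Cotangent M) {P : Cotangent M}
    (hP' : P.proj ∈ (chartAt Plane P₀.proj).source) (U : CotangentTangent P) :
    U ∈ verticalPlane P ↔
      (chartVec cotangentModel (chartAt (ModelProd Plane (Plane →L[ℝ] ℝ)) P₀) P U).1 = 0 := by
  have hψ₀ := IsManifold.chart_mem_maximalAtlas (I := 𝓡 2) (n := ∞) P₀.proj
  have hψ := IsManifold.chart_mem_maximalAtlas (I := 𝓡 2) (n := ∞) P.proj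
  have hX := fun i => formX_apply P₀ hψ (mem_chart_source _ _) hP' i U
  have hKC := fderiv_transition_comp hψ₀ hψ hP' (mem_chart_source _ _)
  simp only [verticalPlane, Submodule.mem_iInf, LinearMap.mem_ker, ContinuousLinearMap.coe_coe, hX]
  constructor
  · intro h
    rw [← hKC (chartVec cotangentModel (chartAt (ModelProd Plane (Plane →L[ℝ] ℝ)) P₀) P U).1]
    exact (congrArg _ (PiLp.ext h)).trans (map_zero _)
  · intro h i
    rw [h, map_zero]; rfl

theorem finrank_verticalPlane (P : Cotangent M) : Module.finrank ℝ (verticalPlane P) = 2 := by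
  have hκ := IsManifold.chart_mem_maximalAtlas (I := cotangentModel) (n := ∞) P
  have hP := mem_chart_source (ModelProd Plane (Plane →L[ℝ] ℝ)) P
  have : FiniteDimensional ℝ (TangentSpace cotangentModel P) :=
    inferInstanceAs (FiniteDimensional ℝ (Plane × (Plane →L[ℝ] ℝ)))
  let L : TangentSpace cotangentModel P →ₗ[ℝ] Plane := ((ContinuousLinearMap.fst ℝ Plane
    (Plane →L[ℝ] ℝ)).comp (mvfderiv cotangentModel
      ((chartAt (ModelProd Plane (Plane →L[ℝ] ℝ)) P).extend cotangentModel) P)).toLinearMap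
  have hL : ∀ U, L U
      = (chartVec cotangentModel (chartAt (ModelProd Plane (Plane →L[ℝ] ℝ)) P) P U).1 :=
    fun U => rfl
  have h1 : verticalPlane P = LinearMap.ker L := by
    ext U
    rw [mem_verticalPlane P (mem_chart_source _ _), LinearMap.mem_ker, hL]
  have h2 : LinearMap.range L = ⊤ := LinearMap.range_eq_top.2 fun v =>
    ⟨chartField cotangentModel (chartAt (ModelProd Plane (Plane →L[ℝ] ℝ)) P) (v, 0) P, by
      rw [hL, chartVec_chartField hκ hP]⟩
  have h3 := LinearMap.finrank_range_add_finrank_ker L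
  have h4 : Module.finrank ℝ (TangentSpace cotangentModel P) = 4 := finrank_plane_prod_dual
  have h5 : Module.finrank ℝ Plane = 2 := by simp
  rw [h2, finrank_top, h4, h5, ← h1] at h3
  exact Nat.add_left_cancel (n := 2) h3

end Geometry

section Geometry

variable {M : Type*} [TopologicalSpace M] [ChartedSpace Plane M] [IsManifold (𝓡 2) ∞ M]
  {nabla : CovariantDerivative (𝓡 2) Plane (TangentSpace (𝓡 2) : M → Type _)}
  {Φ : ∀ x : M, TangentSpace (𝓡 2) x →L[ℝ] TangentSpace (𝓡 2) x →L[ℝ] ℝ} [T2Space M]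
  [CovariantDerivative.ContMDiffCovariantDerivative nabla ∞]

/-- The vertical planes are parallel, since the horizontal part of `∇_U W` in the coordinates of
the cotangent bundle is the covariant derivative of the horizontal part of `W` on the surface. -/
theorem isWalker4_riemannianExtension (hΦ : IsSmoothTensor (𝓡 2) Φ) :
    IsWalker4 cotangentModel (riemannianExtension nabla Φ) := by
  refine ⟨finrank_plane_prod_dual, verticalPlane, finrank_verticalPlane, fun P V hV => ?_,
    fun P U hU V hV => ?_, fun P O hO Y hY U => ?_⟩
  · have hκ := IsManifold.chart_mem_maximalAtlas (I := cotangentModel) (n := ∞) P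
    have hP := mem_chart_source (ModelProd Plane (Plane →L[ℝ] ℝ)) P
    refine ⟨_, (chartAt (ModelProd Plane (Plane →L[ℝ] ℝ)) P).open_source.mem_nhds hP,
      chartField cotangentModel (chartAt (ModelProd Plane (Plane →L[ℝ] ℝ)) P)
        (chartVec cotangentModel (chartAt (ModelProd Plane (Plane →L[ℝ] ℝ)) P) P V),
      ⟨fun Q hQ => (contMDiffAt_chartField hκ hQ _).contMDiffWithinAt, fun Q hQ => ?_⟩,
      chartField_chartVec hκ hP V⟩
    rw [mem_verticalPlane P ((mem_chartAt_cotangent_source P Q).1 hQ), chartVec_chartField hκ hQ]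
    exact (mem_verticalPlane P (mem_chart_source _ _) V).1 hV
  · rw [riemannianExtension_apply nabla Φ P (mem_chart_source _ _), LocalCoord.extension_apply,
      (mem_verticalPlane P (mem_chart_source _ _) U).1 hU,
      (mem_verticalPlane P (mem_chart_source _ _) V).1 hV]
    simp
  · have hκ := IsManifold.chart_mem_maximalAtlas (I := cotangentModel) (n := ∞) P
    have hP := mem_chart_source (ModelProd Plane (Plane →L[ℝ] ℝ)) P
    have hz := chartAt_cotangent_extend_fst_mem P
    have hzt := extend_mem_target (I := cotangentModel) hP
    rw [mem_verticalPlane P (mem_chart_source _ _), leviCivitaDeriv, chartVec_chartField hκ hP,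
      Prod.fst_add]
    have h1 : ContDiffAt ℝ ∞ ((fun Q => chartVec cotangentModel
        (chartAt (ModelProd Plane (Plane →L[ℝ] ℝ)) P) Q (Y Q))
        ∘ ((chartAt (ModelProd Plane (Plane →L[ℝ] ℝ)) P).extend cotangentModel).symm)
        ((chartAt (ModelProd Plane (Plane →L[ℝ] ℝ)) P).extend cotangentModel P) := by
      refine contDiffAt_comp_extend_symm hκ hzt ?_
      rw [OpenPartialHomeomorph.extend_left_inv _ hP]
      exact (contMDiffAt_section_iff_chartVec hP).1 (hY.1.contMDiffAt hO)
    -- The horizontal part of the coordinates of `Y` vanishes identically.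
    have h2 : (fun z => (chartVec cotangentModel (chartAt (ModelProd Plane (Plane →L[ℝ] ℝ)) P)
        (((chartAt (ModelProd Plane (Plane →L[ℝ] ℝ)) P).extend cotangentModel).symm z)
        (Y (((chartAt (ModelProd Plane (Plane →L[ℝ] ℝ)) P).extend cotangentModel).symm z))).1)
        =ᶠ[𝓝 ((chartAt (ModelProd Plane (Plane →L[ℝ] ℝ)) P).extend cotangentModel P)]
          fun _ => 0 := by
      have hc := (contMDiffAt_extend_symm hκ hzt).continuousAt
      have hO' := hO
      rw [← OpenPartialHomeomorph.extend_left_inv (I := cotangentModel) _ hP] at hO'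
      filter_upwards [extend_target_mem_nhds hzt, hc.preimage_mem_nhds hO'] with z hz hzO
      exact (mem_verticalPlane P ((mem_chartAt_cotangent_source P _).1
        (extend_symm_mem_source hz)) _).1 (hY.2 _ hzO)
    have h3 := ((h1.differentiableAt (by simp)).hasFDerivAt.fst).fderiv
    have h4 := h3.symm.trans (h2.fderiv_eq.trans (fderiv_const_apply 0))
    have h5 := fun W => congrArg (fun A => A W) h4
    have h6 : (chartVec cotangentModel (chartAt (ModelProd Plane (Plane →L[ℝ] ℝ)) P) P (Y P)).1
        = 0 := (mem_verticalPlane P (mem_chart_source _ _) _).1 (hY.2 P (mem_of_mem_nhds hO))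
    rw [(LocalCoord.leviCivita_congr
      (tensorIn_riemannianExtension_eventuallyEq nabla Φ P)).eq_of_nhds]
    have h7 := LocalCoord.leviCivita_extension_fst
      ((chartAt Plane P.proj).isOpen_extend_target (I := 𝓡 2))
      (contDiffOn_christoffelL nabla P.proj) (isSmoothTensor_iff.1 hΦ P.proj) hz
      (chartVec cotangentModel (chartAt (ModelProd Plane (Plane →L[ℝ] ℝ)) P) P U)
      (chartVec cotangentModel (chartAt (ModelProd Plane (Plane →L[ℝ] ℝ)) P) P (Y P))
    rw [h6, map_zero] at h7
    refine (congrArg₂ (· + ·) (h5 _) ?_).trans (add_zero 0)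
    exact (congrArg Prod.fst (LocalCoord.leviCivita_eq _ _ _ _)).trans h7

theorem isSelfDual_riemannianExtension (htorsion : nabla.torsion = 0)
    (hΦ : IsSmoothTensor (𝓡 2) Φ)
    (hΦsymm : ∀ (x : M) (u v : TangentSpace (𝓡 2) x), Φ x u v = Φ x v u) :
    IsSelfDual cotangentModel (riemannianExtension nabla Φ) cotangentVolume := by
  intro P e he hvol x y
  have hψ := IsManifold.chart_mem_maximalAtlas (I := 𝓡 2) (n := ∞) P.proj
  have hΓs : ∀ x ∈ ((chartAt Plane P.proj).extend (𝓡 2)).target, ∀ u v,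
      christoffelL nabla (chartAt Plane P.proj) x u v
        = christoffelL nabla (chartAt Plane P.proj) x v u := fun x hx u v => by
    rw [christoffelL_apply nabla hψ hx, christoffelL_apply nabla hψ hx,
      christoffel_symm nabla htorsion hψ hx]
  simp only [metricWeyl4]
  rw [LocalCoord.weyl4_congr (tensorIn_riemannianExtension_eventuallyEq nabla Φ P)]
  refine LocalCoord.weyl4_extension_selfDual
    ((chartAt Plane P.proj).isOpen_extend_target (I := 𝓡 2)) (contDiffOn_christoffelL nabla P.proj)
    (isSmoothTensor_iff.1 hΦ P.proj) hΓs (fun x hx u v => tensorIn_symm hΦsymm _ _ u v)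
    (chartAt_cotangent_extend_fst_mem P)
    (fun i => chartVec cotangentModel (chartAt (ModelProd Plane (Plane →L[ℝ] ℝ)) P) P (e i))
    (fun i j => ?_) ?_ _ _
  · rw [← he i j, riemannianExtension_apply nabla Φ P (mem_chart_source _ _)]
  · rwa [← cotangentVolume_apply P (mem_chart_source _ _) e _ fun _ => rfl]

end Geometry

end

theorem theorem1p1 {M : Type*} [TopologicalSpace M] [T2Space M] [ChartedSpace Plane M]
    [IsManifold (𝓡 2) ∞ M]
    (nabla : CovariantDerivative (𝓡 2) Plane (TangentSpace (𝓡 2) : M → Type _))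
    [CovariantDerivative.ContMDiffCovariantDerivative nabla ∞] (htorsion : nabla.torsion = 0)
    (Φ : ∀ x : M, TangentSpace (𝓡 2) x →L[ℝ] TangentSpace (𝓡 2) x →L[ℝ] ℝ)
    (hΦ : IsSmoothTensor (𝓡 2) Φ)
    (hΦsymm : ∀ (x : M) (u v : TangentSpace (𝓡 2) x), Φ x u v = Φ x v u)
    (μ : ℝ) (fhat : M → ℝ) (hfhat : ContMDiff (𝓡 2) 𝓘(ℝ, ℝ) ∞ fhat) :
    (μ ≠ 0 →
      ((fun x => Real.exp (-(1 / 2) * μ * fhat x)) ∈ quasiEinsteinSpace μ nabla ↔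
        SolvesNonlinearEquation μ nabla fhat)) ∧
    (SolvesNonlinearEquation μ nabla fhat →
      (∀ φ ∈ IsManifold.maximalAtlas (𝓡 2) ∞ M, ∀ P : Cotangent M, P.proj ∈ φ.source →
        riemannianExtension nabla Φ P = riemannianExtensionIn nabla Φ φ P ∧
        (cotangentVolume P : CotangentTangent P [⋀^Fin 4]→ₗ[ℝ] ℝ) = cotangentVolumeIn φ P) ∧
      IsQuasiEinstein cotangentModel (riemannianExtension nabla Φ)
        (fun P : Cotangent M => fhat P.proj) (μ / 2) 0 ∧
      HasSignature22 cotangentModel (riemannianExtension nabla Φ) ∧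
      IsIsotropic cotangentModel (riemannianExtension nabla Φ)
        (fun P : Cotangent M => fhat P.proj) ∧
      IsWalker4 cotangentModel (riemannianExtension nabla Φ) ∧
      IsOrientationForm cotangentModel (cotangentVolume (M := M)) ∧
      IsSelfDual cotangentModel (riemannianExtension nabla Φ) cotangentVolume) := by
  refine ⟨fun hμ => exp_mem_quasiEinsteinSpace_iff nabla hμ hfhat, fun h =>
    ⟨fun φ hφ P hP => ⟨riemannianExtension_eq_riemannianExtensionIn nabla Φ hφ hP,
      cotangentVolume_eq_cotangentVolumeIn hφ hP⟩,
    isQuasiEinstein_riemannianExtension htorsion hΦ hΦsymm h,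
    hasSignature22_riemannianExtension htorsion hΦsymm, isIsotropic_riemannianExtension hfhat,
    isWalker4_riemannianExtension hΦ, isOrientationForm_cotangentVolume,
    isSelfDual_riemannianExtension htorsion hΦ hΦsymm⟩⟩
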